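/- **Setting.** Let $m\ge d\ge 0$ and $M\ge 0$ be integers and consider in $\mathbb R^m$ the system $$x_{n+1}=\alpha_nx_n+b_nu_n+c_nv_n,\qquad n=0,1,\dots ,M-1,$$ with given $x_0$, $\alpha_n,b_n,c_n\in\mathbb R^{m\times m}$ and disturbances $v_n=(v_n^1,\dots ,v_n^d,0,\dots ,0)^T$. The parameter is $\lambda=(\lambda_1,\dots ,\lambda_d,0,\dots ,0)^T$, where the $\lambda_i$ are independent and $\lambda_i$ has the Pareto density $\beta_ir_i^{\beta_i}\lambda^{-\beta_i-1}\mathbf 1_{[r_i,\infty)}(\lambda)$ with $r_i>0$, $\beta_i>2$; given $\lambda$, all $v_n^i$ are independent and $v_n^i$ is uniform on $[0,\lambda_i]$. The disturbances can be recovered from the states and controls: each $c_n$ $(n<M)$ is injective on the vectors supported on the first $d$ coordinates. The horizon $N$ is independent of everything else, $P(N=i)=p_i$ for $0\le i\le M$, $\sum_{i=0}^{M} p_i=1$, $p_M\ne 0$; put $\varphi_n=\sum_{i=n}^Mp_i$ (so $\varphi_{M+1}=0$). A policy chooses $u_n$ as a Borel function of the observed states $X_n=(x_0,\dots ,x_n)$.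 With $y_i=(x_i;\lambda)\in\mathbb R^{2m}$, $k_i$ symmetric positive semidefinite, and $s_i\in\mathbb R^{2m\times 2m}$ with $y^Ts_iy\ge 0$ for all $y$, the expected risk of a policy $U$ in the problem truncated at time $n\le M$ is $$r_n(U)=\mathbb E\Big[\sum_{j=n}^M\frac{p_j}{\varphi_n}\sum_{i=n}^{j}\big(y_i^Ts_iy_i+u_i^Tk_iu_i\big)\,\Big|\,X_n\Big]\in[0,\infty]$$ (and $r_{M+1}=0$); the Bayes risk $W_n$ is the essential infimum of $r_n$ over all policies with the prescribed controls before time $n$. A policy attaining it is a Bayes policy for the problem truncated at $n$, and its controls $u_i^*$, $n\le i\le M$, are Bayes controls. Put $\beta_n^i=\beta_i+n$ and $r_n^i=\max(r_i,v_0^i,\dots ,v_{n-1}^i)$, $\bar r_n=(r_n^1,\dots ,r_n^d,0,\dots ,0)^T$, and let $Q^n,Q_2^n$ be the diagonal matrices with $i$-th entries $\frac{\beta_n^i}{2(\beta_n^i-1)}$ and $\frac{(\beta_n^i)^2}{(\beta_n^i)^2-1}$ for $i\le d$, and $0$ for $i>d$. **Theorem.** There are matrices $A_n,B_n,C_n\in\mathbb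 R^{m\times m}$ $(0\le n\le M)$, $A_n$ symmetric, such that for all $n\le M$, all $x_0$, all $r\in(0,\infty)^d$ and all past controls, almost surely $$W_n=x_n^TA_nx_n+2\bar r_n^TB_nx_n+2\bar r_n^TC_n\bar r_n .$$ For any such matrices and any $n\le M$ put $$K_n=k_n+\tfrac{\varphi_{n+1}}{\varphi_n}b_n^TA_{n+1}b_n,\qquad L_n=-\tfrac{\varphi_{n+1}}{\varphi_n}b_n^T\big[A_{n+1}\alpha_nx_n+(A_{n+1}c_nQ^n+B_{n+1}^TQ_2^n)\bar r_n\big]$$ (for $n=M$ the factor is $0$). Then: (a) If $K_n$ has full rank, then for all $x_0$, $r$ and past controls there is a Bayes policy for the problem truncated at $n$, and the Bayes control at time $n$ of every Bayes policy for the problem truncated at any $j\le n$ is, almost surely, $u_n^*=K_n^{-1}L_n$. (b) If $K_n$ is rank deficient, there is a constant $\kappa\ge 0$, not depending on $x_0$, $r$, the past controls or $E$, such that for every real matrix $E$ with $m$ columns, $K_n^TK_n+E^TE$ invertible and spectral norm $\|E\|_2=\theta>0$, the control $$\hat u_n^*=(K_n^TK_n+E^TE)^{-1}K_n^TL_n$$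 is Bayesian optimal in the following regularized sense: - it is the unique minimizer of $u\mapsto\|K_nu-L_n\|_2^2+\|Eu\|_2^2$; - almost surely $\|K_n\hat u_n^*-L_n\|_2^2\le\kappa\,\theta^2\|L_n\|_2^2$; - there are policies with the given past controls which use $\hat u_n^*$ (almost surely) at time $n$ and are Bayes for the problem truncated at $n+1$, and every such policy has, almost surely, $r_n\le W_n+\kappa\,\theta^2\|L_n\|_2^2$. So for $\theta\ll 1$ it attains the Bayes risk up to $O(\theta^2)$. -/

import Mathlib

open MeasureTheory ProbabilityTheory
open scoped ENNReal Matrix Matrix.Norms.L2Operator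

noncomputable section

namespace BayesControl

/-- The vector of `ℝ^m` whose first `d` coordinates are `z` and whose other coordinates vanish. -/
def pad {m d : ℕ} (z : Fin d → ℝ) : Fin m → ℝ :=
  fun i => if h : (i : ℕ) < d then z ⟨i, h⟩ else 0

/-- The data of the linear control problem: horizon bound `M`, coefficients
`x (n+1) = α n x n + b n u n + c n v n`, cost matrices `s n` and `k n`, the distribution `p` of the
random horizon on `{0, …, M}`, and the shape parameters `β` of the Pareto priors of the `d` unknown
parameters. -/
structure ControlSystem (m d : ℕ) where
  M : ℕ
  α : ℕ → Matrix (Fin m) (Fin m) ℝ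
  b : ℕ → Matrix (Fin m) (Fin m) ℝ
  c : ℕ → Matrix (Fin m) (Fin m) ℝ
  s : ℕ → Matrix (Fin m ⊕ Fin m) (Fin m ⊕ Fin m) ℝ
  k : ℕ → Matrix (Fin m) (Fin m) ℝ
  p : ℕ → ℝ
  β : Fin d → ℝ

/-- A control policy: at time `n` a Borel function of the observed states `x 0, …, x n` is applied.
(Earlier controls are themselves functions of these states.) -/
structure Policy (m : ℕ) where
  act : ∀ n : ℕ, (Fin (n + 1) → Fin m → ℝ) → Fin m → ℝ
  measurable_act : ∀ n, Measurable (act n)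

/-- Two policies use the same controls at all times before `n`. -/
def Policy.AgreeBefore {m : ℕ} (n : ℕ) (U U' : Policy m) : Prop :=
  ∀ j < n, U.act j = U'.act j

/-- The density of the uniform distribution on `[0, l]`. -/
def uniformDensity (l x : ℝ) : ℝ≥0∞ :=
  ENNReal.ofReal (if 0 ≤ x ∧ x ≤ l then 1 / l else 0)

namespace ControlSystem

variable {m d : ℕ} (S : ControlSystem m d)

/-- Outcomes: the unknown parameters and the nonzero coordinates of the disturbances at the times
`0, …, M - 1`. -/
abbrev Outcome : Type := (Fin d → ℝ) × (Fin S.M → Fin d → ℝ)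

/-- The joint law of the parameters and the disturbances. The parameters are independent, Pareto
with scale `r i` and shape `β i`; given the parameters, all disturbance coordinates are independent,
the `i`-th one uniform on `[0, λ i]`. -/
def law (r : Fin d → ℝ) : Measure S.Outcome :=
  ((Measure.pi fun i => paretoMeasure (r i) (S.β i)).prod
      (volume : Measure (Fin S.M → Fin d → ℝ))).withDensity
    fun ω => ∏ n, ∏ i, uniformDensity (ω.1 i) (ω.2 n i)

/-- The nonzero coordinates of the disturbance at time `n` (set to `0` after the last one). -/
def disturbance (ω : S.Outcome) (n : ℕ) : Fin d → ℝ :=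
  if h : n < S.M then ω.2 ⟨n, h⟩ else 0

/-- The list `x 0, …, x n` of states under the policy `U` started at `x₀`. -/
def history (U : Policy m) (x₀ : Fin m → ℝ) (ω : S.Outcome) : (n : ℕ) → Fin (n + 1) → Fin m → ℝ
  | 0 => fun _ => x₀
  | n + 1 => Fin.snoc (α := fun _ => Fin m → ℝ) (history U x₀ ω n)
      (S.α n *ᵥ history U x₀ ω n (Fin.last n) + S.b n *ᵥ U.act n (history U x₀ ω n)
        + S.c n *ᵥ pad (S.disturbance ω n))

/-- The state at time `n`. -/
def state (U : Policy m) (x₀ : Fin m → ℝ) (n : ℕ) (ω : S.Outcome) : Fin m → ℝ :=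
  S.history U x₀ ω n (Fin.last n)

/-- The control applied at time `n`. -/
def control (U : Policy m) (x₀ : Fin m → ℝ) (n : ℕ) (ω : S.Outcome) : Fin m → ℝ :=
  U.act n (S.history U x₀ ω n)

/-- The information available at time `n`: the σ-algebra generated by `x 0, …, x n`. -/
@[reducible] def information (U : Policy m) (x₀ : Fin m → ℝ) (n : ℕ) : MeasurableSpace S.Outcome :=
  MeasurableSpace.comap (fun ω => S.history U x₀ ω n) inferInstance

/-- The cost `yᵀ s y + uᵀ k u` incurred at time `i`, where `y = (x, λ)`. -/
def stageCost (U : Policy m) (x₀ : Fin m → ℝ) (i : ℕ) (ω : S.Outcome) : ℝ :=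
  Sum.elim (S.state U x₀ i ω) (pad ω.1) ⬝ᵥ (S.s i *ᵥ Sum.elim (S.state U x₀ i ω) (pad ω.1))
    + S.control U x₀ i ω ⬝ᵥ (S.k i *ᵥ S.control U x₀ i ω)

/-- The probability that the horizon is at least `n`. -/
def tailProb (n : ℕ) : ℝ := ∑ i ∈ Finset.Icc n S.M, S.p i

/-- The expected risk of the problem truncated at time `n`: the conditional expectation, given the
observed states `x 0, …, x n`, of the cost from time `n` up to the horizon, averaged over the
horizon's distribution given that the horizon is at least `n`. The cost is nonnegative, so that this
is always defined as an element of `[0, ∞]`. -/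
def risk (r : Fin d → ℝ) (U : Policy m) (x₀ : Fin m → ℝ) (n : ℕ) : S.Outcome → ℝ≥0∞ :=
  (S.law r)⁻[fun ω => ENNReal.ofReal (∑ N ∈ Finset.Icc n S.M,
      S.p N / S.tailProb n * ∑ i ∈ Finset.Icc n N, S.stageCost U x₀ i ω) |
    S.information U x₀ n]

/-- `W` is the Bayes risk at time `n` after the controls of `U` before time `n`: the (essential)
infimum of the expected risks of all policies with these past controls. -/
def IsBayesRisk (r : Fin d → ℝ) (U : Policy m) (x₀ : Fin m → ℝ) (n : ℕ)
    (W : S.Outcome → ℝ≥0∞) : Prop :=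
  Measurable W ∧
  (∀ U' : Policy m, U'.AgreeBefore n U → W ≤ᵐ[S.law r] S.risk r U' x₀ n) ∧
  ∀ W' : S.Outcome → ℝ≥0∞, Measurable W' →
    (∀ U' : Policy m, U'.AgreeBefore n U → W' ≤ᵐ[S.law r] S.risk r U' x₀ n) → W' ≤ᵐ[S.law r] W

/-- From time `n` on, `U` is a Bayes policy for the problem truncated at time `n`: its expected risk
is the Bayes risk. Its controls from time `n` on are then Bayes controls. -/
def IsBayesPolicy (r : Fin d → ℝ) (U : Policy m) (x₀ : Fin m → ℝ) (n : ℕ) : Prop :=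
  S.IsBayesRisk r U x₀ n (S.risk r U x₀ n)

/-- Scale parameters of the posterior Pareto distribution after `n` observed disturbances:
`r 0 = r` and `r (n+1) = max (r n) (v n)`. -/
def scale (r : Fin d → ℝ) (ω : S.Outcome) : ℕ → Fin d → ℝ
  | 0 => r
  | n + 1 => scale r ω n ⊔ S.disturbance ω n

/-- Shape parameters of the posterior Pareto distribution after `n` observed disturbances. -/
def shape (n : ℕ) (i : Fin d) : ℝ := S.β i + n

/-- The diagonal matrix `Q n` with `E[v n | x 0, …, x n] = Q n (r n)`. -/
def Q (n : ℕ) : Matrix (Fin m) (Fin m) ℝ :=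
  Matrix.diagonal (pad fun i => S.shape n i / (2 * (S.shape n i - 1)))

/-- The diagonal matrix `Q₂ n` with `E[r (n+1) | x 0, …, x n] = Q₂ n (r n)`. -/
def Q₂ (n : ℕ) : Matrix (Fin m) (Fin m) ℝ :=
  Matrix.diagonal (pad fun i => S.shape n i ^ 2 / (S.shape n i ^ 2 - 1))

/-- The quadratic form `xᵀ A x + 2 rᵀ B x + 2 rᵀ C r` at the state and posterior scale at time
`n`. -/
def riskForm (A B C : ℕ → Matrix (Fin m) (Fin m) ℝ) (r : Fin d → ℝ) (U : Policy m)
    (x₀ : Fin m → ℝ) (n : ℕ) (ω : S.Outcome) : ℝ :=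
  S.state U x₀ n ω ⬝ᵥ (A n *ᵥ S.state U x₀ n ω)
    + 2 * (pad (S.scale r ω n) ⬝ᵥ (B n *ᵥ S.state U x₀ n ω))
    + 2 * (pad (S.scale r ω n) ⬝ᵥ (C n *ᵥ pad (S.scale r ω n)))

/-- `A n, B n, C n` (`n ≤ M`, `A n` symmetric) are the coefficients of the Bayes risk: for all
initial states, prior scales and past controls, the Bayes risk at time `n` is the finite nonnegative
number `xᵀ A x + 2 rᵀ B x + 2 rᵀ C r`, with `x` the state and `r` the posterior scale at time
`n`. -/
def IsRiskCoefficients (A B C : ℕ → Matrix (Fin m) (Fin m) ℝ) : Prop :=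
  ∀ n ≤ S.M, (A n).IsSymm ∧
    ∀ (x₀ : Fin m → ℝ) (r : Fin d → ℝ), (∀ i, 0 < r i) → ∀ U : Policy m,
      (∀ᵐ ω ∂S.law r, 0 ≤ S.riskForm A B C r U x₀ n ω) ∧
      S.IsBayesRisk r U x₀ n fun ω => ENNReal.ofReal (S.riskForm A B C r U x₀ n ω)

/-- The probability that the horizon is at least `n + 1`, given that it is at least `n`. -/
def continueProb (n : ℕ) : ℝ := S.tailProb (n + 1) / S.tailProb n

/-- The matrix `K n = k n + ρ n • (b n)ᵀ A (n+1) (b n)`, where `ρ n` is the continuation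
probability (`ρ M = 0`). -/
def K (A : ℕ → Matrix (Fin m) (Fin m) ℝ) (n : ℕ) : Matrix (Fin m) (Fin m) ℝ :=
  S.k n + S.continueProb n • ((S.b n)ᵀ * A (n + 1) * S.b n)

/-- The vector `L n = -ρ n • (b n)ᵀ [A (n+1) (α n) x + (A (n+1) (c n) (Q n) + B (n+1)ᵀ (Q₂ n)) r]`,
with `x` the state and `r` the posterior scale at time `n`. -/
def L (A B : ℕ → Matrix (Fin m) (Fin m) ℝ) (r : Fin d → ℝ) (U : Policy m) (x₀ : Fin m → ℝ)
    (n : ℕ) (ω : S.Outcome) : Fin m → ℝ :=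
  -(S.continueProb n • ((S.b n)ᵀ *ᵥ
      (A (n + 1) *ᵥ (S.α n *ᵥ S.state U x₀ n ω)
        + (A (n + 1) * S.c n * S.Q n + (B (n + 1))ᵀ * S.Q₂ n) *ᵥ pad (S.scale r ω n))))

/-- The regularized least-squares control `(Kᵀ K + Eᵀ E)⁻¹ Kᵀ L` at time `n`. -/
def regularizedControl (A B : ℕ → Matrix (Fin m) (Fin m) ℝ) (r : Fin d → ℝ) (U : Policy m)
    (x₀ : Fin m → ℝ) (n : ℕ) {l : ℕ} (E : Matrix (Fin l) (Fin m) ℝ) (ω : S.Outcome) :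
    Fin m → ℝ :=
  ((S.K A n)ᵀ * S.K A n + Eᵀ * E)⁻¹ *ᵥ ((S.K A n)ᵀ *ᵥ S.L A B r U x₀ n ω)

/-- The regularized least-squares functional `‖K u - L‖² + ‖E u‖²` (Euclidean norms). -/
def regularizedResidual (A B : ℕ → Matrix (Fin m) (Fin m) ℝ) (r : Fin d → ℝ) (U : Policy m)
    (x₀ : Fin m → ℝ) (n : ℕ) {l : ℕ} (E : Matrix (Fin l) (Fin m) ℝ) (ω : S.Outcome)
    (u : Fin m → ℝ) : ℝ :=
  (S.K A n *ᵥ u - S.L A B r U x₀ n ω) ⬝ᵥ (S.K A n *ᵥ u - S.L A B r U x₀ n ω)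
    + (E *ᵥ u) ⬝ᵥ (E *ᵥ u)

end ControlSystem

end BayesControl

end

/-! ### Product densities, scale families and Pareto–uniform conjugacy -/

noncomputable section

namespace BayesControl

/-! Pareto and uniform laws are scale families and are conjugate. Given `v_0, …, v_{n-1}`, the
parameter is the posterior scale `r̄_n` times a unit Pareto vector of shape `β + n`, and `v_n` is
the parameter times a uniform vector of the unit cube (`lintegral_posterior`, `lintegral_marginal`,
`condLExp_joint`). Injectivity of `c_n` makes the states carry exactly the information of the past
disturbances (`information_eq`). What is learned therefore does not depend on the controls, and all
policies are compared under one filtration.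

Suppose that `W_{n+1}` is quadratic in `(x_{n+1}, r̄_{n+1})`. Then its conditional mean is quadratic
in `(x_n, r̄_n, u_n)`. A policy that applies `u` at time `n` and is Bayes from `n+1` on has risk
`u·Ku - 2 u·L + q(x_n, r̄_n)`, and any policy applying `u` has at least this risk
(`exists_stepCost`). Costs are nonnegative, so this quadratic is nonnegative for all `u`, which
forces `K` to be positive semidefinite and `L` to lie in its range. If `K G K = K`, then `u = G L`
is a minimizer that is linear in `(x_n, r̄_n)`, so `W_n` is quadratic again. The recursion runs
backwards from `W_{M+1} = 0`.

Conversely, a Bayes policy must attain equality in both inequalities. Hence its control solves `K u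
= L`, and it is still Bayes from `n+1` on, because ordered functions with equal finite conditional
means coincide (`ae_eq_of_condLExp_ae_eq`). For invertible `K` this is (a). For (b), comparing the
regularized minimizer with `G L` bounds its squared residual by `‖G‖² θ² ‖L‖²`, and the excess risk
`(u - GL)·K(u - GL)` is at most `1 + ‖G‖²` times the squared residual (`regularized_residual_le`,
`excess_le`). -/

theorem lintegral_pi_prod {n : ℕ} {E : Type*} {mE : MeasurableSpace E}
    {μ : Fin n → Measure E} [∀ i, SigmaFinite (μ i)]
    (f : Fin n → E → ℝ≥0∞) (hf : ∀ i, Measurable (f i)) :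
    ∫⁻ x : Fin n → E, ∏ i, f i (x i) ∂(Measure.pi μ) = ∏ i, ∫⁻ x, f i x ∂(μ i) := by
  induction n with
  | zero => simp
  | succ n ih =>
    have hg : Measurable fun y : Fin n → E => ∏ i : Fin n, f i.succ (y i) :=
      Finset.measurable_fun_prod _ fun i _ => (hf i.succ).comp (measurable_pi_apply i)
    have h1 := (measurePreserving_piFinSuccAbove μ 0).lintegral_comp_emb
      (MeasurableEquiv.measurableEmbedding _)
      (fun p : E × (Fin n → E) => f 0 p.1 * ∏ i : Fin n, f i.succ (p.2 i))
    have h2 := lintegral_prod_mul (μ := μ 0) (ν := Measure.pi fun i => μ (Fin.succAbove 0 i))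
      (hf 0).aemeasurable hg.aemeasurable
    have h3 := ih (μ := fun i => μ i.succ) (fun i => f i.succ) fun i => hf i.succ
    calc _ = _ := lintegral_congr fun x => by rw [Fin.prod_univ_succ]; rfl
      _ = _ := h1.trans h2
      _ = _ := by rw [Fin.prod_univ_succ]; exact congrArg _ h3

theorem pi_withDensity {n : ℕ} {E : Type*} {mE : MeasurableSpace E}
    {μ : Fin n → Measure E} [∀ i, SigmaFinite (μ i)]
    (f : Fin n → E → ℝ≥0∞) (hf : ∀ i, Measurable (f i))
    [∀ i, SigmaFinite ((μ i).withDensity (f i))] :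
    Measure.pi (fun i => (μ i).withDensity (f i))
      = (Measure.pi μ).withDensity fun x => ∏ i, f i (x i) := by
  refine Measure.pi_eq fun s hs => ?_
  rw [withDensity_apply _ (MeasurableSet.univ_pi hs), Measure.restrict_pi_pi,
    lintegral_pi_prod f hf]
  exact Finset.prod_congr rfl fun i _ => (withDensity_apply _ (hs i)).symm

theorem lintegral_volume_mul_left {l : ℝ} (hl : 0 < l) (f : ℝ → ℝ≥0∞) (hf : Measurable f) :
    ∫⁻ x, f x = ENNReal.ofReal l * ∫⁻ x, f (l * x) := by
  conv_lhs => rw [← Real.smul_map_volume_mul_left hl.ne']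
  rw [lintegral_smul_measure, lintegral_map hf (by fun_prop), abs_of_pos hl, smul_eq_mul]

theorem measurable_uniformDensity :
    Measurable fun p : ℝ × ℝ => uniformDensity p.1 p.2 := by
  unfold uniformDensity
  refine ENNReal.measurable_ofReal.comp (Measurable.ite ?_ (by fun_prop) (by fun_prop))
  exact (measurableSet_le measurable_const measurable_snd).inter
    (measurableSet_le measurable_snd measurable_fst)

/-- Together with `paretoMeasure_eq_map`, this removes the parameters from the laws: all dependence
on scales becomes multiplication, so that second moments are quadratic in the scale. -/
theorem withDensity_uniformDensity {l : ℝ} (hl : 0 < l) :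
    (volume : Measure ℝ).withDensity (uniformDensity l)
      = (volume.restrict (Set.Icc 0 1)).map (l * ·) := by
  have hm : Measurable (uniformDensity l) := measurable_uniformDensity.comp measurable_prodMk_left
  refine Measure.ext_of_lintegral _ fun f hf => ?_
  rw [lintegral_withDensity_eq_lintegral_mul _ hm hf, lintegral_map hf (by fun_prop),
    lintegral_volume_mul_left hl _ (hm.mul hf), ← lintegral_const_mul _ (by fun_prop),
    ← lintegral_indicator measurableSet_Icc]
  congr with x
  rw [Pi.mul_apply, ← mul_assoc, uniformDensity, ← ENNReal.ofReal_mul hl.le]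
  by_cases hx : x ∈ Set.Icc (0 : ℝ) 1
  · rw [Set.indicator_of_mem hx, if_pos ⟨by have := hx.1; positivity, by nlinarith [hx.2]⟩,
      mul_one_div_cancel hl.ne', ENNReal.ofReal_one, one_mul]
  · rw [Set.indicator_of_notMem hx, if_neg, mul_zero, ENNReal.ofReal_zero, zero_mul]
    rintro ⟨h1, h2⟩
    exact hx ⟨by by_contra! h; nlinarith, by by_contra! h; nlinarith⟩

theorem measurable_paretoPDF_uncurry (b : ℝ) :
    Measurable fun p : ℝ × ℝ => paretoPDF p.1 b p.2 := by
  unfold paretoPDF paretoPDFReal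
  refine ENNReal.measurable_ofReal.comp (Measurable.ite ?_ (by fun_prop) (by fun_prop))
  exact measurableSet_le measurable_fst measurable_snd

theorem paretoMeasure_eq_map {t b : ℝ} (ht : 0 < t) :
    paretoMeasure t b = (paretoMeasure 1 b).map (t * ·) := by
  have hm (t : ℝ) : Measurable (paretoPDF t b) :=
    (measurable_paretoPDF_uncurry b).comp measurable_prodMk_left
  refine Measure.ext_of_lintegral _ fun f hf => ?_
  rw [paretoMeasure, lintegral_withDensity_eq_lintegral_mul _ (hm t) hf,
    lintegral_map hf (by fun_prop), paretoMeasure,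
    lintegral_withDensity_eq_lintegral_mul _ (hm 1) (by fun_prop),
    lintegral_volume_mul_left ht _ ((hm t).mul hf), ← lintegral_const_mul _ (by fun_prop)]
  congr with x
  rw [Pi.mul_apply, Pi.mul_apply, ← mul_assoc, paretoPDF, paretoPDF, ← ENNReal.ofReal_mul ht.le]
  congr 2
  unfold paretoPDFReal
  by_cases hx : 1 ≤ x
  · rw [if_pos hx, if_pos (by nlinarith), Real.mul_rpow ht.le (by linarith), Real.rpow_neg ht.le,
      Real.rpow_add ht, Real.rpow_one, Real.one_rpow]
    have := Real.rpow_pos_of_pos ht b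
    field_simp
  · rw [if_neg hx, if_neg (by intro h; exact hx (by nlinarith)), mul_zero]

/-- The mixture of uniform densities over a Pareto distribution. -/
def predictiveDensity (t b z : ℝ) : ℝ≥0∞ :=
  if 0 ≤ z then ENNReal.ofReal (b * t ^ b / ((b + 1) * (t ⊔ z) ^ (b + 1))) else 0

theorem measurable_predictiveDensity (t b : ℝ) : Measurable (predictiveDensity t b) := by
  unfold predictiveDensity
  exact Measurable.ite measurableSet_Ici (by fun_prop) (by fun_prop)

/-- Bayes' rule for a uniform observation with Pareto prior. -/
theorem paretoPDF_mul_uniformDensity {t b : ℝ} (ht : 0 < t) (hb : 0 < b) (x z : ℝ) :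
    paretoPDF t b x * uniformDensity x z
      = predictiveDensity t b z * paretoPDF (t ⊔ z) (b + 1) x := by
  unfold paretoPDF uniformDensity predictiveDensity paretoPDFReal
  -- Both sides vanish unless `0 ≤ z` and `t ⊔ z ≤ x`; there the identity is one of powers of `x`
  -- and `t ⊔ z`.
  by_cases hz : 0 ≤ z
  · by_cases hx : t ⊔ z ≤ x
    · have h1 := le_sup_left.trans hx
      have h2 := le_sup_right.trans hx
      have hx0 : 0 < x := ht.trans_le h1
      have hs : 0 < t ⊔ z := ht.trans_le le_sup_left
      rw [if_pos h1, if_pos ⟨hz, h2⟩, if_pos hz, if_pos hx, ← ENNReal.ofReal_mul (by positivity),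
        ← ENNReal.ofReal_mul (by positivity)]
      congr 1
      have e : x ^ (-(b + 1 + 1)) = x ^ (-(b + 1)) * (1 / x) := by
        rw [show -(b + 1 + 1) = -(b + 1) - 1 by ring, Real.rpow_sub_one hx0.ne']; ring
      rw [e]
      field_simp
    · rw [if_neg hx, ENNReal.ofReal_zero, mul_zero]
      rw [sup_le_iff, not_and_or] at hx
      rcases hx with h | h
      · rw [if_neg h, ENNReal.ofReal_zero, zero_mul]
      · rw [if_neg (c := 0 ≤ z ∧ z ≤ x) (fun h' => h h'.2), ENNReal.ofReal_zero, mul_zero]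
  · rw [if_neg hz, if_neg (c := 0 ≤ z ∧ z ≤ x) (fun h => hz h.1), ENNReal.ofReal_zero, mul_zero, zero_mul]

variable {d : ℕ}

/-- Independent Pareto variables with unit scale. -/
def paretoUnit (b : Fin d → ℝ) : Measure (Fin d → ℝ) :=
  Measure.pi fun i => paretoMeasure 1 (b i)

/-- The uniform distribution on the unit cube. -/
def unitCube (d : ℕ) : Measure (Fin d → ℝ) :=
  Measure.pi fun _ => volume.restrict (Set.Icc 0 1)

instance isProbabilityMeasure_uniform :
    IsProbabilityMeasure ((volume : Measure ℝ).restrict (Set.Icc 0 1)) :=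
  ⟨by simp⟩

instance : IsProbabilityMeasure (unitCube d) := by unfold unitCube; infer_instance

theorem isProbabilityMeasure_paretoUnit {b : Fin d → ℝ} (hb : ∀ i, 0 < b i) :
    IsProbabilityMeasure (paretoUnit b) := by
  have := fun i => isProbabilityMeasure_paretoMeasure one_pos (hb i)
  unfold paretoUnit; infer_instance

theorem pi_paretoMeasure {t b : Fin d → ℝ} (ht : ∀ i, 0 < t i) (hb : ∀ i, 0 < b i) :
    Measure.pi (fun i => paretoMeasure (t i) (b i)) = (paretoUnit b).map (t * ·) := by
  have := fun i => isProbabilityMeasure_paretoMeasure one_pos (hb i)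
  have : ∀ i, SigmaFinite ((paretoMeasure 1 (b i)).map (t i * ·)) := fun i => by
    have := Measure.isProbabilityMeasure_map (μ := paretoMeasure 1 (b i)) (f := (t i * ·))
      (by fun_prop)
    infer_instance
  have := Measure.pi_map_pi (μ := fun i => paretoMeasure 1 (b i)) (f := fun i x => t i * x)
    fun i => by fun_prop
  simp_rw [fun i => paretoMeasure_eq_map (b := b i) (ht i)]
  exact this.symm

theorem pi_paretoMeasure_eq_withDensity {t b : Fin d → ℝ} (ht : ∀ i, 0 < t i)
    (hb : ∀ i, 0 < b i) :
    Measure.pi (fun i => paretoMeasure (t i) (b i))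
      = volume.withDensity fun x => ∏ i, paretoPDF (t i) (b i) (x i) := by
  have h := fun i => isProbabilityMeasure_paretoMeasure (ht i) (hb i)
  have : ∀ i, SigmaFinite ((volume : Measure ℝ).withDensity (paretoPDF (t i) (b i))) :=
    fun i => by have := h i; rw [paretoMeasure] at this; infer_instance
  exact pi_withDensity (μ := fun _ => (volume : Measure ℝ)) (fun i => paretoPDF (t i) (b i))
    fun i => (measurable_paretoPDF_uncurry (b i)).comp measurable_prodMk_left

theorem withDensity_prod_uniformDensity {l : Fin d → ℝ} (hl : ∀ i, 0 < l i) :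
    (volume : Measure (Fin d → ℝ)).withDensity (fun x => ∏ i, uniformDensity (l i) (x i))
      = (unitCube d).map (l * ·) := by
  have h : ∀ i, IsProbabilityMeasure
      ((volume : Measure ℝ).withDensity (uniformDensity (l i))) := fun i => by
    rw [withDensity_uniformDensity (hl i)]
    exact Measure.isProbabilityMeasure_map (by fun_prop)
  have h' : ∀ i, IsProbabilityMeasure
      (((volume : Measure ℝ).restrict (Set.Icc 0 1)).map (l i * ·)) := fun i =>
    Measure.isProbabilityMeasure_map (by fun_prop)
  have e := Measure.pi_map_pi (μ := fun _ : Fin d => (volume : Measure ℝ).restrict (Set.Icc 0 1))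
    (f := fun i x => l i * x) fun i => by fun_prop
  have e' := pi_withDensity (μ := fun _ : Fin d => (volume : Measure ℝ))
    (fun i => uniformDensity (l i))
    fun i => measurable_uniformDensity.comp measurable_prodMk_left
  rw [volume_pi, ← e']
  simp_rw [fun i => withDensity_uniformDensity (hl i)]
  exact e.symm

theorem ae_paretoUnit_ge {b : Fin d → ℝ} (hb : ∀ i, 0 < b i) :
    ∀ᵐ x ∂paretoUnit b, ∀ i, 1 ≤ x i := by
  have := fun i => isProbabilityMeasure_paretoMeasure one_pos (hb i)
  rw [ae_all_iff]
  intro i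
  have h : ∀ᵐ y ∂paretoMeasure 1 (b i), 1 ≤ y := by
    rw [ae_iff, paretoMeasure, withDensity_apply _ (by measurability)]
    simp only [not_le]
    exact lintegral_paretoPDF_of_le le_rfl
  exact (measurePreserving_eval (fun i => paretoMeasure 1 (b i)) i).quasiMeasurePreserving.ae h

theorem ae_unitCube : ∀ᵐ w ∂unitCube d, ∀ i, 0 ≤ w i ∧ w i ≤ 1 := by
  rw [ae_all_iff]
  intro i
  have h : ∀ᵐ y ∂(volume : Measure ℝ).restrict (Set.Icc 0 1), 0 ≤ y ∧ y ≤ 1 :=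
    ae_restrict_mem measurableSet_Icc
  exact (measurePreserving_eval
    (fun _ : Fin d => (volume : Measure ℝ).restrict (Set.Icc 0 1)) i).quasiMeasurePreserving.ae h

/-- The joint density of independent Pareto variables. -/
def paretoDensity (t b x : Fin d → ℝ) : ℝ≥0∞ := ∏ i, paretoPDF (t i) (b i) (x i)

/-- The joint density of independent uniform variables. -/
def boxDensity (l z : Fin d → ℝ) : ℝ≥0∞ := ∏ i, uniformDensity (l i) (z i)

theorem measurable_paretoDensity (b : Fin d → ℝ) :
    Measurable fun p : (Fin d → ℝ) × (Fin d → ℝ) => paretoDensity p.1 b p.2 := by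
  unfold paretoDensity
  refine Finset.measurable_fun_prod _ fun i _ => ?_
  exact (measurable_paretoPDF_uncurry (b i)).comp
    (f := fun p : (Fin d → ℝ) × (Fin d → ℝ) => (p.1 i, p.2 i)) (by fun_prop)

theorem measurable_boxDensity :
    Measurable fun p : (Fin d → ℝ) × (Fin d → ℝ) => boxDensity p.1 p.2 := by
  unfold boxDensity
  refine Finset.measurable_fun_prod _ fun i _ => ?_
  exact measurable_uniformDensity.comp
    (f := fun p : (Fin d → ℝ) × (Fin d → ℝ) => (p.1 i, p.2 i)) (by fun_prop)

theorem lintegral_paretoUnit {t b : Fin d → ℝ} (ht : ∀ i, 0 < t i) (hb : ∀ i, 0 < b i)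
    {f : (Fin d → ℝ) → ℝ≥0∞} (hf : Measurable f) :
    ∫⁻ x, f (t * x) ∂paretoUnit b = ∫⁻ x, paretoDensity t b x * f x := by
  have h := lintegral_map (μ := paretoUnit b) (f := f) (g := (t * ·)) hf (by fun_prop)
  rw [← h, ← pi_paretoMeasure ht hb, pi_paretoMeasure_eq_withDensity ht hb]
  exact lintegral_withDensity_eq_lintegral_mul _
    ((measurable_paretoDensity b).comp measurable_prodMk_left) hf

theorem lintegral_unitCube {l : Fin d → ℝ} (hl : ∀ i, 0 < l i)
    {f : (Fin d → ℝ) → ℝ≥0∞} (hf : Measurable f) :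
    ∫⁻ w, f (l * w) ∂unitCube d = ∫⁻ z, boxDensity l z * f z := by
  have h := lintegral_map (μ := unitCube d) (f := f) (g := (l * ·)) hf (by fun_prop)
  rw [← h, ← withDensity_prod_uniformDensity hl]
  exact lintegral_withDensity_eq_lintegral_mul _
    (measurable_boxDensity.comp measurable_prodMk_left) hf

theorem paretoDensity_mul_boxDensity {t b : Fin d → ℝ} (ht : ∀ i, 0 < t i) (hb : ∀ i, 0 < b i)
    (x z : Fin d → ℝ) :
    paretoDensity t b x * boxDensity x z
      = (∏ i, predictiveDensity (t i) (b i) (z i)) * paretoDensity (t ⊔ z) (b + 1) x := by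
  unfold paretoDensity boxDensity
  rw [← Finset.prod_mul_distrib, ← Finset.prod_mul_distrib]
  exact Finset.prod_congr rfl fun i _ => paretoPDF_mul_uniformDensity (ht i) (hb i) _ _

theorem measurable_sup_left (t : Fin d → ℝ) : Measurable fun z : Fin d → ℝ => t ⊔ z :=
  measurable_pi_lambda _ fun i => measurable_const.sup (measurable_pi_apply i)

/-- Bayes' rule in integrated form: both unit laws are turned into densities, the joint density is
factored as predictive times posterior, and Tonelli puts the observation `z` outermost. -/
theorem lintegral_paretoUnit_unitCube {t b : Fin d → ℝ} (ht : ∀ i, 0 < t i) (hb : ∀ i, 0 < b i)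
    {f : (Fin d → ℝ) × (Fin d → ℝ) → ℝ≥0∞} (hf : Measurable f) :
    ∫⁻ x, ∫⁻ w, f (t * x, t * x * w) ∂unitCube d ∂paretoUnit b
      = ∫⁻ z, (∏ i, predictiveDensity (t i) (b i) (z i)) *
          ∫⁻ x, f ((t ⊔ z) * x, z) ∂paretoUnit (b + 1) := by
  have hb1 : ∀ i, 0 < (b + 1) i := fun i => add_pos (hb i) one_pos
  have hqm : Measurable fun z : Fin d → ℝ => ∏ i, predictiveDensity (t i) (b i) (z i) :=
    Finset.measurable_fun_prod _ fun i _ =>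
      (measurable_predictiveDensity _ _).comp (measurable_pi_apply i)
  have hbf : Measurable fun p : (Fin d → ℝ) × (Fin d → ℝ) => boxDensity p.1 p.2 * f p :=
    measurable_boxDensity.mul hf
  have e1 : ∀ᵐ x ∂paretoUnit b, ∫⁻ w, f (t * x, t * x * w) ∂unitCube d
      = ∫⁻ z, boxDensity (t * x) z * f (t * x, z) := by
    filter_upwards [ae_paretoUnit_ge hb] with x hx
    exact lintegral_unitCube (f := fun z => f (t * x, z))
      (fun i => mul_pos (ht i) (one_pos.trans_le (hx i))) (hf.comp measurable_prodMk_left)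
  have hF : Measurable fun x : Fin d → ℝ => ∫⁻ z : Fin d → ℝ, boxDensity x z * f (x, z) :=
    hbf.lintegral_prod_right'
  have hpj : Measurable fun p : (Fin d → ℝ) × (Fin d → ℝ) =>
      paretoDensity (t ⊔ p.2) (b + 1) p.1 :=
    (measurable_paretoDensity (b + 1)).comp
      (((measurable_sup_left t).comp measurable_snd).prodMk measurable_fst)
  have e2 : ∀ x : Fin d → ℝ, paretoDensity t b x * ∫⁻ z, boxDensity x z * f (x, z)
      = ∫⁻ z : Fin d → ℝ, (∏ i, predictiveDensity (t i) (b i) (z i)) *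
        (paretoDensity (t ⊔ z) (b + 1) x * f (x, z)) := by
    intro x
    have hx : Measurable fun z => boxDensity x z * f (x, z) :=
      Measurable.of_uncurry_left (f := fun x z => boxDensity x z * f (x, z)) hbf
    rw [← lintegral_const_mul _ hx]
    refine lintegral_congr fun z => ?_
    exact (mul_assoc _ _ _).symm.trans ((congrArg (· * f (x, z))
      (paretoDensity_mul_boxDensity ht hb x z)).trans (mul_assoc _ _ _))
  have hj : Measurable fun p : (Fin d → ℝ) × (Fin d → ℝ) =>
      (∏ i, predictiveDensity (t i) (b i) (p.2 i)) *
        (paretoDensity (t ⊔ p.2) (b + 1) p.1 * f p) :=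
    (hqm.comp measurable_snd).mul (hpj.mul hf)
  have hsw := lintegral_lintegral_swap (μ := (volume : Measure (Fin d → ℝ)))
    (ν := (volume : Measure (Fin d → ℝ)))
    (f := fun x z => (∏ i, predictiveDensity (t i) (b i) (z i)) *
      (paretoDensity (t ⊔ z) (b + 1) x * f (x, z))) hj.aemeasurable
  rw [lintegral_congr_ae e1,
    lintegral_paretoUnit (f := fun x => ∫⁻ z, boxDensity x z * f (x, z)) ht hb hF,
    lintegral_congr e2, hsw]
  refine lintegral_congr fun z => ?_
  have hfz : Measurable fun x => f (x, z) := hf.comp measurable_prodMk_right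
  have hpf : Measurable fun x => paretoDensity (t ⊔ z) (b + 1) x * f (x, z) :=
    Measurable.of_uncurry_right
      (f := fun x z => paretoDensity (t ⊔ z) (b + 1) x * f (x, z)) (hpj.mul hf)
  rw [lintegral_const_mul _ hpf,
    lintegral_paretoUnit (f := fun x => f (x, z)) (t := t ⊔ z)
      (fun i => lt_sup_of_lt_left (ht i)) hb1 hfz]

/-- Conjugacy of the Pareto and uniform distributions: the posterior given the observation `z` has
scale `t ⊔ z` and shape `b + 1`. -/
theorem lintegral_posterior {t b : Fin d → ℝ} (ht : ∀ i, 0 < t i) (hb : ∀ i, 0 < b i)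
    {f : (Fin d → ℝ) × (Fin d → ℝ) → ℝ≥0∞} (hf : Measurable f) :
    ∫⁻ x, ∫⁻ w, f (t * x, t * x * w) ∂unitCube d ∂paretoUnit b
      = ∫⁻ x, ∫⁻ w, ∫⁻ y, f ((t ⊔ (t * x * w)) * y, t * x * w) ∂paretoUnit (b + 1)
          ∂unitCube d ∂paretoUnit b := by
  have hb1 : ∀ i, 0 < (b + 1) i := fun i => add_pos (hb i) one_pos
  have := isProbabilityMeasure_paretoUnit hb1
  have hg : Measurable fun z : Fin d → ℝ => ∫⁻ y, f ((t ⊔ z) * y, z) ∂paretoUnit (b + 1) :=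
    Measurable.lintegral_prod_right' (f := fun q : (Fin d → ℝ) × (Fin d → ℝ) =>
      f ((t ⊔ q.1) * q.2, q.1))
      (hf.comp ((((measurable_sup_left t).comp measurable_fst).mul measurable_snd).prodMk
        measurable_fst))
  -- The same formula is applied to the posterior mean of `f`. It depends on `z` only, so the inner
  -- integral over a probability measure drops out and both sides agree.
  have h := lintegral_paretoUnit_unitCube
    (f := fun p => ∫⁻ y, f ((t ⊔ p.2) * y, p.2) ∂paretoUnit (b + 1)) ht hb
    (hg.comp measurable_snd)
  rw [lintegral_paretoUnit_unitCube ht hb hf, h]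
  simp only [lintegral_const, measure_univ, mul_one]

end BayesControl

end

/-! ### The law of the outcome and the posterior given past disturbances -/

noncomputable section

namespace BayesControl

/-- Resampling one coordinate of a product of probability measures does not change the law: the
averaged function no longer depends on that coordinate, so integrating over it once more has no
effect. -/
theorem lintegral_pi_update {ι : Type*} [Fintype ι] [DecidableEq ι] {X : ι → Type*}
    [∀ i, MeasurableSpace (X i)] {μ : ∀ i, Measure (X i)} [∀ i, IsProbabilityMeasure (μ i)]
    (i : ι) {f : (∀ i, X i) → ℝ≥0∞} (hf : Measurable f) :
    ∫⁻ x, f x ∂Measure.pi μ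
      = ∫⁻ x, ∫⁻ z, f (Function.update x i z) ∂μ i ∂Measure.pi μ := by
  rcases isEmpty_or_nonempty (∀ i, X i) with h | ⟨⟨x₀⟩⟩
  · simp
  have hg : Measurable fun x => ∫⁻ z, f (Function.update x i z) ∂μ i :=
    Measurable.lintegral_prod_right' (f := fun p : (∀ i, X i) × X i => f (Function.update p.1 i p.2))
      (hf.comp measurable_update')
  rw [lintegral_eq_lmarginal_univ x₀, lintegral_eq_lmarginal_univ x₀,
    lmarginal_erase' f hf (Finset.mem_univ i), lmarginal_erase' _ hg (Finset.mem_univ i)]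
  simp

variable {m d : ℕ}

namespace ControlSystem

variable (S : ControlSystem m d)

/-- The outcome is realized as `λ = r x`, `v_n = λ W_n` with `x` unit Pareto and the `W_n`
independent uniform vectors on the cube. Almost surely `x ≥ 1`, so that the scale `r x` of the
uniform laws is positive. -/
theorem lintegral_law {r : Fin d → ℝ} (hr : ∀ i, 0 < r i) (hβ : ∀ i, 0 < S.β i)
    {f : S.Outcome → ℝ≥0∞} (hf : Measurable f) :
    ∫⁻ ω, f ω ∂S.law r = ∫⁻ x, ∫⁻ W, f (r * x, fun n => r * x * W n)
      ∂(Measure.pi fun _ : Fin S.M => unitCube d) ∂paretoUnit S.β := by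
  have := isProbabilityMeasure_paretoUnit hβ
  have hD : Measurable fun ω : S.Outcome => ∏ n, ∏ i, uniformDensity (ω.1 i) (ω.2 n i) :=
    Finset.measurable_fun_prod _ fun n _ => measurable_boxDensity.comp
      (f := fun ω : S.Outcome => (ω.1, ω.2 n)) (by fun_prop)
  have hDf : Measurable fun ω : S.Outcome =>
      (∏ n, ∏ i, uniformDensity (ω.1 i) (ω.2 n i)) * f ω := hD.mul hf
  have hpp : IsProbabilityMeasure (Measure.pi fun i => paretoMeasure (r i) (S.β i)) := by
    rw [pi_paretoMeasure hr hβ]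
    exact Measure.isProbabilityMeasure_map (by fun_prop)
  rw [law, lintegral_withDensity_eq_lintegral_mul _ hD hf]
  change ∫⁻ ω : S.Outcome, (∏ n, ∏ i, uniformDensity (ω.1 i) (ω.2 n i)) * f ω ∂_ = _
  rw [lintegral_prod _ hDf.aemeasurable, pi_paretoMeasure hr hβ,
    lintegral_map hDf.lintegral_prod_right' (by fun_prop)]
  refine lintegral_congr_ae ?_
  filter_upwards [ae_paretoUnit_ge hβ] with x hx
  have hl : ∀ i, 0 < (r * x) i := fun i => mul_pos (hr i) (one_pos.trans_le (hx i))
  have hfx : Measurable fun V : Fin S.M → Fin d → ℝ => f (r * x, V) :=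
    hf.comp measurable_prodMk_left
  have hmap : IsProbabilityMeasure ((unitCube d).map (r * x * ·)) :=
    Measure.isProbabilityMeasure_map (by fun_prop)
  have hwd : IsProbabilityMeasure
      ((volume : Measure (Fin d → ℝ)).withDensity (boxDensity (r * x))) := by
    have := withDensity_prod_uniformDensity hl
    unfold boxDensity
    rwa [this]
  have e := pi_withDensity (n := S.M) (μ := fun _ => (volume : Measure (Fin d → ℝ)))
    (fun _ => boxDensity (r * x)) fun _ => measurable_boxDensity.comp measurable_prodMk_left
  have e' := Measure.pi_map_pi (μ := fun _ : Fin S.M => unitCube d)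
    (f := fun _ w => r * x * w) fun i => by fun_prop
  have e'' : (volume : Measure (Fin d → ℝ)).withDensity (boxDensity (r * x))
      = (unitCube d).map (r * x * ·) := withDensity_prod_uniformDensity hl
  have hb : Measurable fun V : Fin S.M → Fin d → ℝ => ∏ n, boxDensity (r * x) (V n) :=
    Finset.measurable_fun_prod _ fun n _ => measurable_boxDensity.comp
      (f := fun V : Fin S.M → Fin d → ℝ => (r * x, V n)) (by fun_prop)
  have h1 := lintegral_withDensity_eq_lintegral_mul
    (Measure.pi fun _ : Fin S.M => (volume : Measure (Fin d → ℝ))) hb hfx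
  have h2 := lintegral_map (μ := Measure.pi fun _ : Fin S.M => unitCube d) hfx
    (g := fun W n => r * x * W n) (by fun_prop)
  refine Eq.trans h1.symm (Eq.trans ?_ h2)
  rw [← e, e', e'']

theorem isProbabilityMeasure_law {r : Fin d → ℝ} (hr : ∀ i, 0 < r i) (hβ : ∀ i, 0 < S.β i) :
    IsProbabilityMeasure (S.law r) := by
  have := isProbabilityMeasure_paretoUnit hβ
  constructor
  rw [← lintegral_one, S.lintegral_law hr hβ measurable_const]
  simp

/-- The disturbances before time `n`. -/
def past (n : ℕ) (ω : S.Outcome) : Fin n → Fin d → ℝ := fun j => S.disturbance ω j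

theorem measurable_disturbance (n : ℕ) : Measurable fun ω : S.Outcome => S.disturbance ω n := by
  unfold disturbance
  by_cases h : n < S.M
  · simp only [h, dif_pos]; fun_prop
  · simp only [h, dif_neg, not_false_eq_true]; fun_prop

theorem measurable_past (n : ℕ) : Measurable (S.past n) :=
  measurable_pi_lambda _ fun j => S.measurable_disturbance j

theorem past_succ (n : ℕ) (ω : S.Outcome) :
    S.past (n + 1) ω = Fin.snoc (α := fun _ => Fin d → ℝ) (S.past n ω) (S.disturbance ω n) := by
  ext j : 1
  refine Fin.lastCases ?_ (fun j => ?_) j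
  · rw [Fin.snoc_last]; rfl
  · rw [Fin.snoc_castSucc]; rfl

/-- The posterior scale as a function of the past disturbances. -/
def scaleOf (r : Fin d → ℝ) : (n : ℕ) → (Fin n → Fin d → ℝ) → Fin d → ℝ
  | 0, _ => r
  | n + 1, p => scaleOf r n (fun j => p j.castSucc) ⊔ p (Fin.last n)

theorem scale_eq (r : Fin d → ℝ) (n : ℕ) (ω : S.Outcome) :
    S.scale r ω n = scaleOf r n (S.past n ω) := by
  induction n with
  | zero => rfl
  | succ n ih => rw [scale, scaleOf, ih]; rfl

theorem measurable_sup_pi :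
    Measurable fun p : (Fin d → ℝ) × (Fin d → ℝ) => p.1 ⊔ p.2 :=
  measurable_pi_lambda _ fun i =>
    ((measurable_pi_apply i).comp measurable_fst).sup ((measurable_pi_apply i).comp measurable_snd)

theorem measurable_scaleOf (r : Fin d → ℝ) (n : ℕ) : Measurable (scaleOf r n) := by
  induction n with
  | zero => exact measurable_const
  | succ n ih =>
    exact measurable_sup_pi.comp ((ih.comp (by fun_prop)).prodMk (measurable_pi_apply (Fin.last n)))

theorem scaleOf_pos {r : Fin d → ℝ} (hr : ∀ i, 0 < r i) (n : ℕ) (p : Fin n → Fin d → ℝ) (i : Fin d) :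
    0 < scaleOf r n p i := by
  induction n with
  | zero => exact hr i
  | succ n ih => exact lt_sup_of_lt_left (ih _)

theorem scaleOf_snoc (r : Fin d → ℝ) (n : ℕ) (p : Fin n → Fin d → ℝ) (z : Fin d → ℝ) :
    scaleOf r (n + 1) (Fin.snoc (α := fun _ => Fin d → ℝ) p z) = scaleOf r n p ⊔ z := by
  simp [scaleOf]

theorem measurable_snoc {E : Type*} [MeasurableSpace E] (n : ℕ) :
    Measurable fun p : (Fin n → E) × E => Fin.snoc (α := fun _ => E) p.1 p.2 := by
  refine measurable_pi_lambda _ fun j => ?_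
  refine Fin.lastCases ?_ (fun j => ?_) j
  · simp only [Fin.snoc_last]; fun_prop
  · simp only [Fin.snoc_castSucc]; fun_prop

theorem past_update (n : ℕ) (hn : n < S.M) (l : Fin d → ℝ) (V : Fin S.M → Fin d → ℝ)
    (W : Fin S.M → Fin d → ℝ) (hVW : ∀ j, j ≠ ⟨n, hn⟩ → V j = W j) :
    S.past n (l, V) = S.past n (l, W) := by
  funext j
  have hj : (j : ℕ) < S.M := j.2.trans hn
  simp only [past, disturbance, hj, dif_pos]
  exact hVW _ fun h => j.2.ne (congrArg Fin.val h)

/-- Given the parameter, `v_n` is independent of the past, since the past does not involve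
coordinate `n` of the noise; that coordinate may be resampled. -/
theorem lintegral_disturbance {r : Fin d → ℝ} (hr : ∀ i, 0 < r i) (hβ : ∀ i, 0 < S.β i)
    {n : ℕ} (hn : n < S.M) {f : (Fin n → Fin d → ℝ) × (Fin d → ℝ) × (Fin d → ℝ) → ℝ≥0∞}
    (hf : Measurable f) :
    ∫⁻ ω, f (S.past n ω, ω.1, S.disturbance ω n) ∂S.law r
      = ∫⁻ ω, ∫⁻ w, f (S.past n ω, ω.1, ω.1 * w) ∂unitCube d ∂S.law r := by
  have hp := S.measurable_past n
  have hv := S.measurable_disturbance n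
  have hg : Measurable fun ω : S.Outcome => ∫⁻ w, f (S.past n ω, ω.1, ω.1 * w) ∂unitCube d :=
    Measurable.lintegral_prod_right' (f := fun q : S.Outcome × (Fin d → ℝ) =>
      f (S.past n q.1, q.1.1, q.1.1 * q.2)) (hf.comp (by fun_prop))
  have hf' : Measurable fun ω : S.Outcome => f (S.past n ω, ω.1, S.disturbance ω n) :=
    hf.comp (hp.prodMk (measurable_fst.prodMk hv))
  rw [S.lintegral_law hr hβ hf', S.lintegral_law hr hβ hg]
  refine lintegral_congr fun x => ?_
  rw [lintegral_pi_update ⟨n, hn⟩]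
  · refine lintegral_congr fun W => lintegral_congr fun z => ?_
    rw [S.past_update n hn (r * x) (fun j => r * x * Function.update W ⟨n, hn⟩ z j)
      (fun j => r * x * W j) fun j hj => by rw [Function.update_of_ne hj]]
    simp [disturbance, hn]
  · have : Measurable fun W : Fin S.M → Fin d → ℝ =>
        ((r * x, fun n => r * x * W n) : S.Outcome) := by
      refine measurable_const.prodMk (by fun_prop)
    exact (hf.comp (hp.prodMk (measurable_fst.prodMk hv))).comp this

theorem shape_pos (hβ : ∀ i, 0 < S.β i) (n : ℕ) (i : Fin d) : 0 < S.shape n i := by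
  have := hβ i
  unfold shape; positivity

theorem shape_succ (n : ℕ) : S.shape (n + 1) = S.shape n + 1 := by
  ext i; simp [shape, add_assoc]

/-- The posterior of the parameter enters as a hypothesis because the induction in
`lintegral_marginal` uses this statement at each step. -/
theorem lintegral_joint_of_marginal {r : Fin d → ℝ} (hr : ∀ i, 0 < r i) (hβ : ∀ i, 0 < S.β i)
    {n : ℕ} (hn : n < S.M)
    (h : ∀ f : (Fin n → Fin d → ℝ) × (Fin d → ℝ) → ℝ≥0∞, Measurable f →
      ∫⁻ ω, f (S.past n ω, ω.1) ∂S.law r = ∫⁻ ω, ∫⁻ x,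
        f (S.past n ω, scaleOf r n (S.past n ω) * x) ∂paretoUnit (S.shape n) ∂S.law r)
    {f : (Fin n → Fin d → ℝ) × (Fin d → ℝ) × (Fin d → ℝ) → ℝ≥0∞} (hf : Measurable f) :
    ∫⁻ ω, f (S.past n ω, ω.1, S.disturbance ω n) ∂S.law r
      = ∫⁻ ω, ∫⁻ x, ∫⁻ w, f (S.past n ω, scaleOf r n (S.past n ω) * x,
          scaleOf r n (S.past n ω) * x * w) ∂unitCube d ∂paretoUnit (S.shape n) ∂S.law r := by
  rw [S.lintegral_disturbance hr hβ hn hf]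
  refine h (fun p => ∫⁻ w, f (p.1, p.2, p.2 * w) ∂unitCube d) ?_
  exact Measurable.lintegral_prod_right'
    (f := fun q : ((Fin n → Fin d → ℝ) × (Fin d → ℝ)) × (Fin d → ℝ) => f (q.1.1, q.1.2, q.1.2 * q.2))
    (hf.comp (by fun_prop))

/-- Induction on the number of observations: the joint law of the past, the parameter and `v_n` is
known from the induction hypothesis, and one use of conjugacy absorbs `v_n` into scale and shape. -/
theorem lintegral_marginal {r : Fin d → ℝ} (hr : ∀ i, 0 < r i) (hβ : ∀ i, 0 < S.β i)
    {n : ℕ} (hn : n ≤ S.M) {f : (Fin n → Fin d → ℝ) × (Fin d → ℝ) → ℝ≥0∞} (hf : Measurable f) :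
    ∫⁻ ω, f (S.past n ω, ω.1) ∂S.law r = ∫⁻ ω, ∫⁻ x,
        f (S.past n ω, scaleOf r n (S.past n ω) * x) ∂paretoUnit (S.shape n) ∂S.law r := by
  induction n with
  | zero =>
    have := isProbabilityMeasure_paretoUnit hβ
    have := S.isProbabilityMeasure_law hr hβ
    have e : S.shape 0 = S.β := by ext i; simp [shape]
    have hs (ω : S.Outcome) : S.past 0 ω = default := Subsingleton.elim _ _
    simp_rw [hs, e, scaleOf, lintegral_const, measure_univ, mul_one]
    have hf' : Measurable fun ω : S.Outcome => f (default, ω.1) :=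
      hf.comp (measurable_const.prodMk measurable_fst)
    rw [S.lintegral_law hr hβ hf']
    simp
  | succ n ih =>
    have hn' : n < S.M := hn
    have hsm := measurable_scaleOf r n
    have := isProbabilityMeasure_paretoUnit (S.shape_pos hβ (n + 1))
    have hsn := measurable_snoc (E := Fin d → ℝ) n
    have J := fun {f} hf => S.lintegral_joint_of_marginal hr hβ hn'
      (fun f hf => ih hn'.le hf) (f := f) hf
    have hf1 : Measurable fun q : (Fin n → Fin d → ℝ) × (Fin d → ℝ) × (Fin d → ℝ) =>
        f (Fin.snoc (α := fun _ => Fin d → ℝ) q.1 q.2.2, q.2.1) :=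
      hf.comp ((hsn.comp (measurable_fst.prodMk (measurable_snd.comp measurable_snd))).prodMk
        (measurable_fst.comp measurable_snd))
    have hf2 : Measurable fun q : (Fin n → Fin d → ℝ) × (Fin d → ℝ) × (Fin d → ℝ) =>
        ∫⁻ y, f (Fin.snoc (α := fun _ => Fin d → ℝ) q.1 q.2.2, (scaleOf r n q.1 ⊔ q.2.2) * y)
          ∂paretoUnit (S.shape (n + 1)) := by
      refine Measurable.lintegral_prod_right' (f := fun q :
        ((Fin n → Fin d → ℝ) × (Fin d → ℝ) × (Fin d → ℝ)) × (Fin d → ℝ) =>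
          f (Fin.snoc (α := fun _ => Fin d → ℝ) q.1.1 q.1.2.2,
            (scaleOf r n q.1.1 ⊔ q.1.2.2) * q.2)) (hf.comp (Measurable.prodMk ?_ (Measurable.mul ?_ ?_)))
      · exact hsn.comp (f := fun q : ((Fin n → Fin d → ℝ) × (Fin d → ℝ) × (Fin d → ℝ)) ×
          (Fin d → ℝ) => (q.1.1, q.1.2.2)) (by fun_prop)
      · exact measurable_sup_pi.comp (f := fun q : ((Fin n → Fin d → ℝ) × (Fin d → ℝ) ×
          (Fin d → ℝ)) × (Fin d → ℝ) => (scaleOf r n q.1.1, q.1.2.2)) (by fun_prop)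
      · fun_prop
    -- `hf1` belongs to the left side, `hf2` to the right side, in which the parameter has been
    -- redrawn from the new posterior. After both are expanded by the joint law, they agree for each
    -- fixed past by `lintegral_posterior`.
    have h1 := J hf1
    have h2 := J hf2
    simp_rw [past_succ, scaleOf_snoc]
    refine h1.trans (Eq.trans ?_ h2.symm)
    refine lintegral_congr fun ω => ?_
    have hpz : Measurable fun p : (Fin d → ℝ) × (Fin d → ℝ) =>
        f (Fin.snoc (α := fun _ => Fin d → ℝ) (S.past n ω) p.2, p.1) :=
      hf.comp ((hsn.comp (f := fun p : (Fin d → ℝ) × (Fin d → ℝ) => (S.past n ω, p.2))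
        (measurable_const.prodMk measurable_snd)).prodMk measurable_fst)
    rw [shape_succ]
    exact lintegral_posterior (t := scaleOf r n (S.past n ω)) (scaleOf_pos hr n _)
      (S.shape_pos hβ n) hpz

theorem lintegral_joint {r : Fin d → ℝ} (hr : ∀ i, 0 < r i) (hβ : ∀ i, 0 < S.β i)
    {n : ℕ} (hn : n < S.M)
    {f : (Fin n → Fin d → ℝ) × (Fin d → ℝ) × (Fin d → ℝ) → ℝ≥0∞} (hf : Measurable f) :
    ∫⁻ ω, f (S.past n ω, ω.1, S.disturbance ω n) ∂S.law r
      = ∫⁻ ω, ∫⁻ x, ∫⁻ w, f (S.past n ω, scaleOf r n (S.past n ω) * x,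
          scaleOf r n (S.past n ω) * x * w) ∂unitCube d ∂paretoUnit (S.shape n) ∂S.law r :=
  S.lintegral_joint_of_marginal hr hβ hn (fun _ hf => S.lintegral_marginal hr hβ hn.le hf) hf

/-- The information in the disturbances before time `n`. -/
@[reducible] def pastInfo (n : ℕ) : MeasurableSpace S.Outcome :=
  MeasurableSpace.comap (S.past n) inferInstance

theorem pastInfo_le (n : ℕ) : S.pastInfo n ≤ (inferInstance : MeasurableSpace S.Outcome) :=
  (S.measurable_past n).comap_le

/-- The conditional law of the parameter and the current disturbance, for an integrand depending on
the past. -/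
theorem condLExp_joint {r : Fin d → ℝ} (hr : ∀ i, 0 < r i) (hβ : ∀ i, 0 < S.β i)
    {n : ℕ} (hn : n < S.M) {E : Type*} [MeasurableSpace E] [StandardBorelSpace E] [Nonempty E]
    {X : S.Outcome → E} (hX : Measurable[S.pastInfo n] X)
    {f : E × (Fin d → ℝ) × (Fin d → ℝ) → ℝ≥0∞} (hf : Measurable f) :
    (S.law r)⁻[fun ω => f (X ω, ω.1, S.disturbance ω n) | S.pastInfo n] =ᵐ[S.law r]
      fun ω => ∫⁻ q, f (X ω, S.scale r ω n * q.1, S.scale r ω n * q.1 * q.2)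
        ∂(paretoUnit (S.shape n)).prod (unitCube d) := by
  have := S.isProbabilityMeasure_law hr hβ
  have := isProbabilityMeasure_paretoUnit (S.shape_pos hβ n)
  -- `X` is a Borel function of the past disturbances, so everything reduces to functions on the
  -- space of pasts.
  obtain ⟨h, hh, rfl⟩ := hX.exists_eq_measurable_comp
  have hsm := measurable_scaleOf r n
  have hG : Measurable fun p : Fin n → Fin d → ℝ =>
      ∫⁻ q, f (h p, scaleOf r n p * q.1, scaleOf r n p * q.1 * q.2)
        ∂(paretoUnit (S.shape n)).prod (unitCube d) :=
    Measurable.lintegral_prod_right' (f := fun z : (Fin n → Fin d → ℝ) ×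
      (Fin d → ℝ) × (Fin d → ℝ) =>
        f (h z.1, scaleOf r n z.1 * z.2.1, scaleOf r n z.1 * z.2.1 * z.2.2))
      (hf.comp (by fun_prop))
  symm
  simp_rw [scale_eq]
  refine ae_eq_condLExp (S.pastInfo_le n) _ _ (hG.comp (comap_measurable (S.past n))) ?_
  rintro _ ⟨s, hs, rfl⟩
  have hs' := S.measurable_past n hs
  rw [← lintegral_indicator hs', ← lintegral_indicator hs']
  -- Weighting by the indicator of a past event turns the defining identity of the conditional
  -- expectation into an instance of `lintegral_joint`.
  have hf' : Measurable fun z : (Fin n → Fin d → ℝ) × (Fin d → ℝ) × (Fin d → ℝ) =>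
      s.indicator 1 z.1 * f (h z.1, z.2) :=
    (((measurable_one.indicator hs).comp measurable_fst).mul (hf.comp (by fun_prop)))
  have key := S.lintegral_joint hr hβ hn hf'
  refine Eq.trans ?_ (key.symm.trans ?_)
  · refine lintegral_congr fun ω => ?_
    by_cases hω : S.past n ω ∈ s
    · rw [Set.indicator_of_mem (by exact hω)]
      simp only [Set.indicator_of_mem hω, Pi.one_apply, one_mul]
      exact lintegral_prod _ (hf.comp (by fun_prop)).aemeasurable
    · rw [Set.indicator_of_notMem (by exact hω)]
      simp [Set.indicator_of_notMem hω]
  · refine lintegral_congr fun ω => ?_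
    by_cases hω : S.past n ω ∈ s
    · simp [Set.indicator, hω]
    · simp [Set.indicator, hω]

/-- The conditional law of the parameter, for an integrand depending on the past. -/
theorem condLExp_marginal {r : Fin d → ℝ} (hr : ∀ i, 0 < r i) (hβ : ∀ i, 0 < S.β i)
    {n : ℕ} (hn : n ≤ S.M) {E : Type*} [MeasurableSpace E] [StandardBorelSpace E] [Nonempty E]
    {X : S.Outcome → E} (hX : Measurable[S.pastInfo n] X)
    {f : E × (Fin d → ℝ) → ℝ≥0∞} (hf : Measurable f) :
    (S.law r)⁻[fun ω => f (X ω, ω.1) | S.pastInfo n] =ᵐ[S.law r]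
      fun ω => ∫⁻ x, f (X ω, S.scale r ω n * x) ∂paretoUnit (S.shape n) := by
  have := S.isProbabilityMeasure_law hr hβ
  have := isProbabilityMeasure_paretoUnit (S.shape_pos hβ n)
  obtain ⟨h, hh, rfl⟩ := hX.exists_eq_measurable_comp
  have hsm := measurable_scaleOf r n
  have hG : Measurable fun p : Fin n → Fin d → ℝ =>
      ∫⁻ x, f (h p, scaleOf r n p * x) ∂paretoUnit (S.shape n) :=
    Measurable.lintegral_prod_right' (f := fun z : (Fin n → Fin d → ℝ) × (Fin d → ℝ) =>
        f (h z.1, scaleOf r n z.1 * z.2))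
      (hf.comp (by fun_prop))
  symm
  simp_rw [scale_eq]
  refine ae_eq_condLExp (S.pastInfo_le n) _ _ (hG.comp (comap_measurable (S.past n))) ?_
  rintro _ ⟨s, hs, rfl⟩
  have hs' := S.measurable_past n hs
  rw [← lintegral_indicator hs', ← lintegral_indicator hs']
  have hf' : Measurable fun z : (Fin n → Fin d → ℝ) × (Fin d → ℝ) =>
      s.indicator 1 z.1 * f (h z.1, z.2) :=
    (((measurable_one.indicator hs).comp measurable_fst).mul (hf.comp (by fun_prop)))
  have key := S.lintegral_marginal hr hβ hn hf'
  refine Eq.trans ?_ (key.symm.trans ?_)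
  · refine lintegral_congr fun ω => ?_
    by_cases hω : S.past n ω ∈ s
    · simp [Set.indicator, hω]
    · simp [Set.indicator, hω]
  · refine lintegral_congr fun ω => ?_
    by_cases hω : S.past n ω ∈ s
    · simp [Set.indicator, hω]
    · simp [Set.indicator, hω]

end ControlSystem

end BayesControl

end

/-! ### Moments and conditional means of quadratic forms -/

noncomputable section

namespace BayesControl

/-- Used with exponents `2` (square integrability, where `β > 2` enters), `1` and `-1` (the means
behind `Q` and `Q₂`). -/
theorem paretoMeasure_rpow_moment {a b : ℝ} (hb : 0 < b) (hab : a < b) :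
    Integrable (fun x : ℝ => x ^ a) (paretoMeasure 1 b) ∧
      ∫ x, x ^ a ∂paretoMeasure 1 b = b / (b - a) := by
  have e : (fun x : ℝ => (paretoPDF 1 b x).toReal • x ^ a)
      = (Set.Ici 1).indicator fun x => b * x ^ (a - b - 1) := by
    ext x
    rw [paretoPDF, ENNReal.toReal_ofReal (paretoPDFReal_nonneg zero_le_one hb.le x),
      paretoPDFReal, smul_eq_mul]
    by_cases hx : 1 ≤ x
    · rw [if_pos hx, Set.indicator_of_mem (by exact hx), Real.one_rpow, mul_one, mul_assoc,
        ← Real.rpow_add (by linarith)]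
      congr 2; ring
    · rw [if_neg hx, Set.indicator_of_notMem (by exact hx), zero_mul]
  have hm : Measurable (paretoPDF 1 b) :=
    (measurable_paretoPDF_uncurry b).comp measurable_prodMk_left
  have hlt : ∀ᵐ x : ℝ, paretoPDF 1 b x < ∞ := ae_of_all _ fun x => ENNReal.ofReal_lt_top
  constructor
  · rw [paretoMeasure, integrable_withDensity_iff_integrable_smul' hm hlt, e,
      integrable_indicator_iff measurableSet_Ici, integrableOn_Ici_iff_integrableOn_Ioi]
    exact (integrableOn_Ioi_rpow_of_lt (by linarith) one_pos).const_mul b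
  · rw [paretoMeasure, integral_withDensity_eq_integral_toReal_smul hm hlt, e,
      integral_indicator measurableSet_Ici, integral_Ici_eq_integral_Ioi, integral_const_mul,
      integral_Ioi_rpow_of_lt (by linarith) one_pos, Real.one_rpow]
    have : b - a ≠ 0 := by linarith
    rw [show a - b - 1 + 1 = -(b - a) by ring]
    field_simp

theorem integral_uniform_mul (x : ℝ) :
    ∫ w in Set.Icc (0 : ℝ) 1, x * w = x / 2 := by
  rw [integral_Icc_eq_integral_Ioc, ← intervalIntegral.integral_of_le zero_le_one,
    intervalIntegral.integral_const_mul, integral_id]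
  ring

theorem integral_uniform_max {x : ℝ} (hx : 1 ≤ x) :
    ∫ w in Set.Icc (0 : ℝ) 1, 1 ⊔ x * w = (x + x⁻¹) / 2 := by
  have hx0 : 0 < x := by linarith
  have hxi : x⁻¹ ≤ 1 := inv_le_one_of_one_le₀ hx
  have hc : Continuous fun w : ℝ => 1 ⊔ x * w := by fun_prop
  -- The integral is split at `x⁻¹`, where the maximum changes branch.
  rw [integral_Icc_eq_integral_Ioc, ← intervalIntegral.integral_of_le zero_le_one,
    ← intervalIntegral.integral_add_adjacent_intervals (b := x⁻¹)
      (hc.intervalIntegrable _ _) (hc.intervalIntegrable _ _)]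
  have h1 : ∫ w in (0 : ℝ)..x⁻¹, 1 ⊔ x * w = ∫ w in (0 : ℝ)..x⁻¹, (1 : ℝ) := by
    refine intervalIntegral.integral_congr fun w hw => ?_
    rw [Set.uIcc_of_le (by positivity)] at hw
    exact sup_eq_left.2 (by have := mul_le_mul_of_nonneg_left hw.2 hx0.le; rwa [mul_inv_cancel₀ hx0.ne'] at this)
  have h2 : ∫ w in x⁻¹..1, 1 ⊔ x * w = ∫ w in x⁻¹..1, x * w := by
    refine intervalIntegral.integral_congr fun w hw => ?_
    rw [Set.uIcc_of_le hxi] at hw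
    exact sup_eq_right.2 (by have := mul_le_mul_of_nonneg_left hw.1 hx0.le; rwa [mul_inv_cancel₀ hx0.ne'] at this)
  rw [h1, h2, intervalIntegral.integral_const_mul, integral_id, intervalIntegral.integral_const,
    smul_eq_mul]
  field_simp
  ring

variable {m d : ℕ}

/-- The law of a standardized parameter and uniform variables on the unit cube. -/
def unitLaw (b : Fin d → ℝ) : Measure ((Fin d → ℝ) × (Fin d → ℝ)) :=
  (paretoUnit b).prod (unitCube d)

theorem isProbabilityMeasure_unitLaw {b : Fin d → ℝ} (hb : ∀ i, 0 < b i) :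
    IsProbabilityMeasure (unitLaw b) := by
  have := isProbabilityMeasure_paretoUnit hb
  unfold unitLaw; infer_instance

theorem integral_paretoUnit_eval {b : Fin d → ℝ} (hb : ∀ i, 0 < b i) (i : Fin d) {f : ℝ → ℝ}
    (hf : Measurable f) :
    ∫ x, f (x i) ∂paretoUnit b = ∫ y, f y ∂paretoMeasure 1 (b i) := by
  have := fun i => isProbabilityMeasure_paretoMeasure one_pos (hb i)
  exact integral_comp_eval (μ := fun i => paretoMeasure 1 (b i)) hf.aestronglyMeasurable

theorem integral_unitCube_eval (i : Fin d) {f : ℝ → ℝ} (hf : Measurable f) :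
    ∫ x, f (x i) ∂unitCube d = ∫ y in Set.Icc (0 : ℝ) 1, f y :=
  integral_comp_eval (μ := fun _ : Fin d => (volume : Measure ℝ).restrict (Set.Icc 0 1))
    hf.aestronglyMeasurable

theorem memLp_paretoUnit {b : Fin d → ℝ} (hb : ∀ i, 2 < b i) (i : Fin d) :
    MemLp (fun x => x i) 2 (paretoUnit b) := by
  have hb0 : ∀ i, 0 < b i := fun i => two_pos.trans (hb i)
  have := fun i => isProbabilityMeasure_paretoMeasure one_pos (hb0 i)
  rw [memLp_two_iff_integrable_sq (measurable_pi_apply i).aestronglyMeasurable]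
  have h := (paretoMeasure_rpow_moment (hb0 i) (hb i)).1
  simp only [Real.rpow_two] at h
  exact integrable_comp_eval (μ := fun i => paretoMeasure 1 (b i)) h

theorem memLp_unitLaw_fst {b : Fin d → ℝ} (hb : ∀ i, 2 < b i) (i : Fin d) :
    MemLp (fun q => q.1 i) 2 (unitLaw b) := by
  have := isProbabilityMeasure_paretoUnit fun i => two_pos.trans (hb i)
  exact (memLp_paretoUnit hb i).comp_measurePreserving measurePreserving_fst

theorem ae_unitLaw {b : Fin d → ℝ} (hb : ∀ i, 0 < b i) :
    ∀ᵐ q ∂unitLaw b, ∀ i, 1 ≤ q.1 i ∧ 0 ≤ q.2 i ∧ q.2 i ≤ 1 := by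
  have := isProbabilityMeasure_paretoUnit hb
  filter_upwards [(measurePreserving_fst (μ := paretoUnit b)
      (ν := unitCube d)).quasiMeasurePreserving.ae (ae_paretoUnit_ge hb),
    (measurePreserving_snd (μ := paretoUnit b)
      (ν := unitCube d)).quasiMeasurePreserving.ae ae_unitCube] with q h1 h2 i
  exact ⟨h1 i, h2 i⟩

theorem memLp_unitLaw_mul {b : Fin d → ℝ} (hb : ∀ i, 2 < b i) (i : Fin d) :
    MemLp (fun q => (q.1 * q.2) i) 2 (unitLaw b) := by
  refine (memLp_unitLaw_fst hb i).mono (by fun_prop) ?_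
  filter_upwards [ae_unitLaw fun i => two_pos.trans (hb i)] with q hq
  obtain ⟨h1, h2, h3⟩ := hq i
  rw [Pi.mul_apply, Real.norm_of_nonneg (by positivity), Real.norm_of_nonneg (by linarith)]
  nlinarith

theorem memLp_unitLaw_sup {b : Fin d → ℝ} (hb : ∀ i, 2 < b i) (i : Fin d) :
    MemLp (fun q => (1 ⊔ q.1 * q.2) i) 2 (unitLaw b) := by
  have hm : Measurable fun q : (Fin d → ℝ) × (Fin d → ℝ) => (1 ⊔ q.1 * q.2) i := by
    simp only [Pi.sup_apply, Pi.mul_apply, Pi.one_apply]; fun_prop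
  refine (memLp_unitLaw_fst hb i).mono hm.aestronglyMeasurable ?_
  filter_upwards [ae_unitLaw fun i => two_pos.trans (hb i)] with q hq
  obtain ⟨h1, h2, h3⟩ := hq i
  rw [Pi.sup_apply, Pi.mul_apply, Pi.one_apply,
    Real.norm_of_nonneg (le_sup_of_le_left zero_le_one), Real.norm_of_nonneg (by linarith)]
  exact sup_le h1 (by nlinarith)

theorem integral_unitLaw_mul {b : Fin d → ℝ} (hb : ∀ i, 2 < b i) (i : Fin d) :
    ∫ q, (q.1 * q.2) i ∂unitLaw b = b i / (2 * (b i - 1)) := by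
  have hb0 : ∀ i, 0 < b i := fun i => two_pos.trans (hb i)
  have := isProbabilityMeasure_paretoUnit hb0
  have := isProbabilityMeasure_unitLaw hb0
  rw [unitLaw, integral_prod _ ((memLp_unitLaw_mul hb i).integrable one_le_two)]
  simp only [Pi.mul_apply]
  have h1 (x : Fin d → ℝ) : ∫ w, x i * w i ∂unitCube d = x i / 2 := by
    rw [integral_unitCube_eval i (f := fun w => x i * w) (by fun_prop), integral_uniform_mul]
  have h2 := (paretoMeasure_rpow_moment (a := 1) (hb0 i) (by linarith [hb i])).2
  simp only [Real.rpow_one] at h2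
  simp only [h1]
  rw [integral_div, integral_paretoUnit_eval hb0 i (f := fun y => y) (by fun_prop), h2,
    div_div, mul_comm]

/-- Averaging `(x + x⁻¹) / 2` over the Pareto law gives `(b/(b-1) + b/(b+1)) / 2`, which is the
entry of `Q₂`. -/
theorem integral_unitLaw_sup {b : Fin d → ℝ} (hb : ∀ i, 2 < b i) (i : Fin d) :
    ∫ q, (1 ⊔ q.1 * q.2) i ∂unitLaw b = b i ^ 2 / (b i ^ 2 - 1) := by
  have hb0 : ∀ i, 0 < b i := fun i => two_pos.trans (hb i)
  have := isProbabilityMeasure_paretoUnit hb0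
  have := isProbabilityMeasure_unitLaw hb0
  rw [unitLaw, integral_prod _ ((memLp_unitLaw_sup hb i).integrable one_le_two)]
  simp only [Pi.sup_apply, Pi.mul_apply, Pi.one_apply]
  have h1 : ∀ᵐ x ∂paretoUnit b, ∫ w, 1 ⊔ x i * w i ∂unitCube d = (x i + (x i)⁻¹) / 2 := by
    filter_upwards [ae_paretoUnit_ge hb0] with x hx
    rw [integral_unitCube_eval i (f := fun w => 1 ⊔ x i * w) (by fun_prop),
      integral_uniform_max (hx i)]
  obtain ⟨i2, h2⟩ := paretoMeasure_rpow_moment (a := 1) (hb0 i) (by linarith [hb i])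
  obtain ⟨i3, h3⟩ := paretoMeasure_rpow_moment (a := -1) (hb0 i) (by linarith [hb i])
  simp only [Real.rpow_one, Real.rpow_neg_one] at i2 i3 h2 h3
  rw [integral_congr_ae h1, integral_paretoUnit_eval hb0 i (f := fun y => (y + y⁻¹) / 2)
    (by fun_prop), integral_div, integral_add i2 i3, h2, h3]
  have := hb i
  have h4 : b i - 1 ≠ 0 := by linarith
  have h5 : b i - -1 ≠ 0 := by linarith
  have h6 : b i ^ 2 - 1 ≠ 0 := by nlinarith
  field_simp
  ring

theorem pad_mul (x y : Fin d → ℝ) : (pad (x * y) : Fin m → ℝ) = pad x * pad y := by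
  ext i; by_cases h : (i : ℕ) < d <;> simp [pad, h]

theorem pad_add (x y : Fin d → ℝ) : (pad (x + y) : Fin m → ℝ) = pad x + pad y := by
  ext i; by_cases h : (i : ℕ) < d <;> simp [pad, h]

theorem pad_smul (a : ℝ) (x : Fin d → ℝ) : (pad (a • x) : Fin m → ℝ) = a • pad x := by
  ext i; by_cases h : (i : ℕ) < d <;> simp [pad, h]

@[fun_prop]
theorem measurable_pad : Measurable (pad : (Fin d → ℝ) → Fin m → ℝ) := by
  refine measurable_pi_lambda _ fun i => ?_
  by_cases h : (i : ℕ) < d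
  · simp only [pad, h, dif_pos]; fun_prop
  · simp only [pad, h, dif_neg, not_false_eq_true]; fun_prop

section Moments

variable {Ω : Type*} [MeasurableSpace Ω] {μ : Measure Ω} {ι κ : Type*} [Fintype ι] [Fintype κ]

theorem memLp_pad {X : Ω → Fin d → ℝ} (hX : ∀ i, MemLp (fun ω => X ω i) 2 μ) (i : Fin m) :
    MemLp (fun ω => (pad (X ω) : Fin m → ℝ) i) 2 μ := by
  by_cases h : (i : ℕ) < d
  · simp only [pad, h, dif_pos]; exact hX _
  · simp only [pad, h, dif_neg, not_false_eq_true]; exact MemLp.zero'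

theorem integral_pad (X : Ω → Fin d → ℝ) (i : Fin m) :
    ∫ ω, (pad (X ω) : Fin m → ℝ) i ∂μ = (pad fun j => ∫ ω, X ω j ∂μ : Fin m → ℝ) i := by
  by_cases h : (i : ℕ) < d <;> simp [pad, h]

/-- The matrix of a bilinear form in scaled random vectors, after averaging. -/
def averagedMatrix (μ : Measure Ω) (M : Matrix ι κ ℝ) (X : Ω → ι → ℝ) (Y : Ω → κ → ℝ) :
    Matrix ι κ ℝ :=
  Matrix.of fun i j => M i j * ∫ ω, X ω i * Y ω j ∂μ

theorem integral_bilin_scaled (M : Matrix ι κ ℝ) {X : Ω → ι → ℝ} {Y : Ω → κ → ℝ}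
    (hX : ∀ i, MemLp (fun ω => X ω i) 2 μ) (hY : ∀ i, MemLp (fun ω => Y ω i) 2 μ)
    (s : ι → ℝ) (t : κ → ℝ) :
    Integrable (fun ω => (s * X ω) ⬝ᵥ (M *ᵥ (t * Y ω))) μ ∧
      ∫ ω, (s * X ω) ⬝ᵥ (M *ᵥ (t * Y ω)) ∂μ = s ⬝ᵥ (averagedMatrix μ M X Y *ᵥ t) := by
  have hi (i : ι) (j : κ) : Integrable (fun ω => s i * (M i j * t j) * (X ω i * Y ω j)) μ :=
    ((hX i).integrable_mul (hY j)).const_mul _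
  have e : (fun ω => (s * X ω) ⬝ᵥ (M *ᵥ (t * Y ω)))
      = fun ω => ∑ i, ∑ j, s i * (M i j * t j) * (X ω i * Y ω j) := by
    ext ω
    simp only [dotProduct, Matrix.mulVec, Finset.mul_sum, Pi.mul_apply]
    exact Finset.sum_congr rfl fun i _ => Finset.sum_congr rfl fun j _ => by ring
  rw [e]
  refine ⟨integrable_finsetSum _ fun i _ => integrable_finsetSum _ fun j _ => hi i j, ?_⟩
  rw [integral_finsetSum _ fun i _ => integrable_finsetSum _ fun j _ => hi i j]
  simp only [dotProduct, Matrix.mulVec, Finset.mul_sum, averagedMatrix, Matrix.of_apply]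
  refine Finset.sum_congr rfl fun i _ => ?_
  rw [integral_finsetSum _ fun j _ => hi i j]
  exact Finset.sum_congr rfl fun j _ => by rw [integral_const_mul]; ring

theorem integral_dot_scaled [IsFiniteMeasure μ] (v : ι → ℝ) {X : Ω → ι → ℝ}
    (hX : ∀ i, MemLp (fun ω => X ω i) 2 μ) (s : ι → ℝ) :
    Integrable (fun ω => v ⬝ᵥ (s * X ω)) μ ∧
      ∫ ω, v ⬝ᵥ (s * X ω) ∂μ = v ⬝ᵥ (s * fun i => ∫ ω, X ω i ∂μ) := by
  have hi (i : ι) : Integrable (fun ω => v i * s i * X ω i) μ :=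
    ((hX i).integrable one_le_two).const_mul _
  have e : (fun ω => v ⬝ᵥ (s * X ω)) = fun ω => ∑ i, v i * s i * X ω i := by
    ext ω
    simp only [dotProduct, Pi.mul_apply, mul_assoc]
  rw [e]
  refine ⟨integrable_finsetSum _ fun i _ => hi i, ?_⟩
  rw [integral_finsetSum _ fun i _ => hi i]
  simp only [dotProduct, Pi.mul_apply, integral_const_mul, mul_assoc]

end Moments

/-- The quadratic form `xᵀ A x + 2 rᵀ B x + 2 rᵀ C r`. -/
def quadForm (A B C : Matrix (Fin m) (Fin m) ℝ) (x r : Fin m → ℝ) : ℝ :=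
  x ⬝ᵥ (A *ᵥ x) + 2 * (r ⬝ᵥ (B *ᵥ x)) + 2 * (r ⬝ᵥ (C *ᵥ r))

theorem dotProduct_mulVec_comm {ι κ : Type*} [Fintype ι] [Fintype κ] (M : Matrix ι κ ℝ)
    (x : ι → ℝ) (y : κ → ℝ) : x ⬝ᵥ (M *ᵥ y) = y ⬝ᵥ (Mᵀ *ᵥ x) := by
  rw [Matrix.dotProduct_mulVec, ← Matrix.mulVec_transpose, dotProduct_comm]

/-- The mean of the quadratic form at the next state and posterior scale. -/
theorem exists_integral_quadForm {b : Fin d → ℝ} (hb : ∀ i, 2 < b i)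
    (A B C c : Matrix (Fin m) (Fin m) ℝ) (hA : A.IsSymm) :
    ∃ D : Matrix (Fin m) (Fin m) ℝ, ∀ (a : Fin m → ℝ) (t : Fin d → ℝ), (∀ i, 0 < t i) →
      Integrable (fun q => quadForm A B C (a + c *ᵥ pad (t * q.1 * q.2))
        (pad (t ⊔ (t * q.1 * q.2)))) (unitLaw b) ∧
      ∫ q, quadForm A B C (a + c *ᵥ pad (t * q.1 * q.2)) (pad (t ⊔ (t * q.1 * q.2))) ∂unitLaw b
        = a ⬝ᵥ (A *ᵥ a)
          + 2 * (a ⬝ᵥ ((A * c) *ᵥ (pad t * pad fun i => b i / (2 * (b i - 1)))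
              + Bᵀ *ᵥ (pad t * pad fun i => b i ^ 2 / (b i ^ 2 - 1))))
          + 2 * (pad t ⬝ᵥ (D *ᵥ pad t)) := by
  have := isProbabilityMeasure_unitLaw fun i => two_pos.trans (hb i)
  set μ := unitLaw b
  set Z : (Fin d → ℝ) × (Fin d → ℝ) → Fin m → ℝ := fun q => pad (q.1 * q.2) with hZdef
  set R : (Fin d → ℝ) × (Fin d → ℝ) → Fin m → ℝ := fun q => pad (1 ⊔ q.1 * q.2) with hRdef
  have hZ : ∀ i, MemLp (fun q => Z q i) 2 μ := memLp_pad (memLp_unitLaw_mul hb)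
  have hR : ∀ i, MemLp (fun q => R q i) 2 μ := memLp_pad (memLp_unitLaw_sup hb)
  have eZ : (fun i => ∫ q, Z q i ∂μ) = pad fun i => b i / (2 * (b i - 1)) := by
    ext i
    rw [hZdef, integral_pad]
    exact congrFun (congrArg pad (funext (integral_unitLaw_mul hb))) i
  have eR : (fun i => ∫ q, R q i ∂μ) = pad fun i => b i ^ 2 / (b i ^ 2 - 1) := by
    ext i
    rw [hRdef, integral_pad]
    exact congrFun (congrArg pad (funext (integral_unitLaw_sup hb))) i
  -- `D` collects the terms free of `a`. The factor `1/2` compensates for the `2` in front of `D` in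
  -- the claim, since the disturbance's own quadratic term comes without one.
  refine ⟨(1 / 2 : ℝ) • averagedMatrix μ (cᵀ * A * c) Z Z + averagedMatrix μ (B * c) R Z
    + averagedMatrix μ C R R, fun a t ht => ?_⟩
  have e : (fun q => quadForm A B C (a + c *ᵥ pad (t * q.1 * q.2)) (pad (t ⊔ (t * q.1 * q.2))))
      = fun q => a ⬝ᵥ (A *ᵥ a) + 2 * (((A * c)ᵀ *ᵥ a) ⬝ᵥ (pad t * Z q))
        + 2 * ((B *ᵥ a) ⬝ᵥ (pad t * R q))
        + (pad t * Z q) ⬝ᵥ ((cᵀ * A * c) *ᵥ (pad t * Z q))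
        + 2 * ((pad t * R q) ⬝ᵥ ((B * c) *ᵥ (pad t * Z q)))
        + 2 * ((pad t * R q) ⬝ᵥ (C *ᵥ (pad t * R q))) := by
    ext q
    have e1 : (pad (t * q.1 * q.2) : Fin m → ℝ) = pad t * Z q := by
      rw [hZdef, mul_assoc, pad_mul]
    have e2 : (pad (t ⊔ (t * q.1 * q.2)) : Fin m → ℝ) = pad t * R q := by
      rw [hRdef, ← pad_mul]
      congr 1
      ext i
      simp only [Pi.sup_apply, Pi.mul_apply, Pi.one_apply]
      -- A positive scale factors out of the maximum: `t ⊔ t z = t (1 ⊔ z)`.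
      rw [mul_max_of_nonneg _ _ (ht i).le, mul_one, mul_assoc]
    rw [e1, e2]
    generalize pad t * Z q = z
    generalize pad t * R q = ρ
    have h1 : a ⬝ᵥ ((A * c) *ᵥ z) = ((A * c)ᵀ *ᵥ a) ⬝ᵥ z := by
      rw [dotProduct_mulVec_comm, dotProduct_comm]
    have h2 : (c *ᵥ z) ⬝ᵥ (A *ᵥ a) = ((A * c)ᵀ *ᵥ a) ⬝ᵥ z := by
      rw [dotProduct_mulVec_comm, hA.eq, Matrix.mulVec_mulVec, h1]
    have h3 : (c *ᵥ z) ⬝ᵥ ((A * c) *ᵥ z) = z ⬝ᵥ ((cᵀ * A * c) *ᵥ z) := by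
      rw [dotProduct_comm, dotProduct_mulVec_comm, dotProduct_comm, dotProduct_mulVec_comm,
        Matrix.mulVec_mulVec, dotProduct_mulVec_comm, Matrix.transpose_mul, Matrix.transpose_mul,
        Matrix.transpose_transpose, Matrix.transpose_transpose, dotProduct_comm, mul_assoc]
    simp only [quadForm, Matrix.mulVec_add, add_dotProduct, dotProduct_add, h1, h2, h3,
      Matrix.mulVec_mulVec]
    rw [dotProduct_comm ρ (B *ᵥ a)]
    ring
  obtain ⟨i1, j1⟩ := integral_dot_scaled ((A * c)ᵀ *ᵥ a) hZ (pad t)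
  obtain ⟨i2, j2⟩ := integral_dot_scaled (B *ᵥ a) hR (pad t)
  obtain ⟨i3, j3⟩ := integral_bilin_scaled (cᵀ * A * c) hZ hZ (pad t) (pad t)
  obtain ⟨i4, j4⟩ := integral_bilin_scaled (B * c) hR hZ (pad t) (pad t)
  obtain ⟨i5, j5⟩ := integral_bilin_scaled C hR hR (pad t) (pad t)
  have k0 : Integrable (fun _ : (Fin d → ℝ) × (Fin d → ℝ) => a ⬝ᵥ (A *ᵥ a)) μ :=
    integrable_const _
  have k1 := k0.add (i1.const_mul 2)
  have k2 := k1.add (i2.const_mul 2)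
  have k3 := k2.add i3
  have k4 := k3.add (i4.const_mul 2)
  have k5 := k4.add (i5.const_mul 2)
  rw [e]
  refine ⟨k5, ?_⟩
  have s5 := integral_add k4 (i5.const_mul 2)
  have s4 := integral_add k3 (i4.const_mul 2)
  have s3 := integral_add k2 i3
  have s2 := integral_add k1 (i2.const_mul 2)
  have s1 := integral_add k0 (i1.const_mul 2)
  simp only [Pi.add_apply] at s1 s2 s3 s4 s5
  rw [s5, s4, s3, s2, s1, integral_const_mul, integral_const_mul, integral_const_mul,
    integral_const_mul, j1, j2, j3, j4, j5, integral_const, eZ, eR]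
  simp only [probReal_univ, dotProduct_add, Matrix.add_mulVec,
    Matrix.smul_mulVec, dotProduct_smul, smul_eq_mul]
  rw [dotProduct_mulVec_comm (A * c), dotProduct_comm _ ((A * c)ᵀ *ᵥ a),
    dotProduct_mulVec_comm Bᵀ, Matrix.transpose_transpose, dotProduct_comm _ (B *ᵥ a)]
  ring

/-- The mean of the quadratic form in the state and the parameter. -/
theorem exists_integral_stage {b : Fin d → ℝ} (hb : ∀ i, 2 < b i)
    (s : Matrix (Fin m ⊕ Fin m) (Fin m ⊕ Fin m) ℝ) :
    ∃ A B C : Matrix (Fin m) (Fin m) ℝ, ∀ (x : Fin m → ℝ) (t : Fin d → ℝ),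
      Integrable (fun y => Sum.elim x (pad (t * y)) ⬝ᵥ (s *ᵥ Sum.elim x (pad (t * y))))
        (paretoUnit b) ∧
      ∫ y, Sum.elim x (pad (t * y)) ⬝ᵥ (s *ᵥ Sum.elim x (pad (t * y))) ∂paretoUnit b
        = quadForm A B C x (pad t) := by
  have := isProbabilityMeasure_paretoUnit fun i => two_pos.trans (hb i)
  set μ := paretoUnit b
  -- The deterministic block is represented by the constant vector `1`, so that `(x, t y)` is the
  -- fixed vector `(x, t)` times the random vector `(1, y)` and the scaled bilinear formula applies.
  have hX : ∀ i : Fin m ⊕ Fin m,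
      MemLp (fun y => Sum.elim (1 : Fin m → ℝ) (pad y) i) 2 μ := by
    rintro (i | i)
    · exact memLp_const _
    · exact memLp_pad (fun i => memLp_paretoUnit hb i) i
  set D := averagedMatrix μ s (fun y => Sum.elim (1 : Fin m → ℝ) (pad y))
    (fun y => Sum.elim (1 : Fin m → ℝ) (pad y)) with hD
  refine ⟨D.toBlocks₁₁, (1 / 2 : ℝ) • (D.toBlocks₂₁ + D.toBlocks₁₂ᵀ), (1 / 2 : ℝ) • D.toBlocks₂₂,
    fun x t => ?_⟩
  have e : ∀ y : Fin d → ℝ, (Sum.elim x (pad (t * y)) : Fin m ⊕ Fin m → ℝ)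
      = Sum.elim x (pad t) * Sum.elim (1 : Fin m → ℝ) (pad y) := fun y => by
    rw [pad_mul]
    ext i
    rcases i with i | i <;> simp
  simp_rw [e]
  obtain ⟨i1, j1⟩ := integral_bilin_scaled s hX hX (Sum.elim x (pad t)) (Sum.elim x (pad t))
  refine ⟨i1, j1.trans ?_⟩
  rw [← hD]
  conv_lhs => rw [← D.fromBlocks_toBlocks]
  rw [Matrix.fromBlocks_mulVec, quadForm]
  simp only [sumElim_dotProduct_sumElim, Sum.elim_comp_inl, Sum.elim_comp_inr, dotProduct_add,
    Matrix.add_mulVec, Matrix.smul_mulVec, dotProduct_smul, smul_eq_mul]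
  rw [dotProduct_mulVec_comm D.toBlocks₁₂]
  ring

end BayesControl

end

/-! ### Information, policies, costs and Bayes risks -/

noncomputable section

namespace BayesControl

section CondLExp

variable {Ω : Type*} {m₁ m₂ m₀ : MeasurableSpace Ω} {P : Measure[m₀] Ω} [IsFiniteMeasure P]
  {X Y : Ω → ℝ≥0∞}

theorem condLExp_condLExp (h₁₂ : m₁ ≤ m₂) (h₂ : m₂ ≤ m₀) (X : Ω → ℝ≥0∞) :
    P⁻[P⁻[X|m₂]|m₁] =ᵐ[P] P⁻[X|m₁] := by
  refine ae_eq_condLExp (h₁₂.trans h₂) _ _ (measurable_condLExp _ _ _) fun s hs => ?_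
  rw [setLIntegral_condLExp (h₁₂.trans h₂) _ _ hs, setLIntegral_condLExp h₂ _ _ (h₁₂ s hs)]

/-- An inequality with equal means is an equality where the means are finite. This is how optimality
at time `n` is passed to time `n + 1`. -/
theorem ae_eq_of_condLExp_ae_eq (h₁ : m₁ ≤ m₀) (hY : Measurable[m₀] Y) (hXY : X ≤ᵐ[P] Y)
    (h : P⁻[X|m₁] =ᵐ[P] P⁻[Y|m₁]) (hfin : ∀ᵐ ω ∂P, P⁻[X|m₁] ω < ∞) : X =ᵐ[P] Y := by
  have hm : Measurable[m₁] P⁻[X|m₁] := measurable_condLExp _ _ _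
  -- Localizing to the events where the conditional mean is at most `k` makes the integrals finite;
  -- these events exhaust the space up to a null set.
  have hs (k : ℕ) : MeasurableSet[m₁] {ω | P⁻[X|m₁] ω ≤ k} :=
    hm measurableSet_Iic
  have key (k : ℕ) : ∀ᵐ ω ∂P, P⁻[X|m₁] ω ≤ k → X ω = Y ω := by
    refine (ae_restrict_iff' (h₁ _ (hs k))).1 ?_
    refine ae_eq_of_ae_le_of_lintegral_le (ae_restrict_of_ae hXY) ?_ hY.aemeasurable ?_
    · rw [← setLIntegral_condLExp h₁ _ _ (hs k)]
      refine ne_top_of_le_ne_top ?_ (setLIntegral_mono_ae' (h₁ _ (hs k))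
        (ae_of_all _ fun ω (hω : P⁻[X|m₁] ω ≤ k) => hω))
      rw [setLIntegral_const]
      finiteness
    · rw [← setLIntegral_condLExp h₁ _ _ (hs k), ← setLIntegral_condLExp h₁ _ X (hs k)]
      exact (setLIntegral_congr_fun_ae (h₁ _ (hs k))
        (h.mono fun ω hω _ => hω.symm)).le
  filter_upwards [ae_all_iff.2 key, hfin] with ω h1 h2
  obtain ⟨k, hk⟩ := ENNReal.exists_nat_gt h2.ne
  exact h1 k hk.le

end CondLExp

variable {m d : ℕ}

/-- `pad` as a linear map. -/
def padLinear (m d : ℕ) : (Fin d → ℝ) →ₗ[ℝ] Fin m → ℝ where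
  toFun := pad
  map_add' := pad_add
  map_smul' := pad_smul

namespace ControlSystem

variable (S : ControlSystem m d)

theorem history_congr {n : ℕ} {U V : Policy m} (h : V.AgreeBefore n U) (x₀ : Fin m → ℝ)
    (ω : S.Outcome) : S.history V x₀ ω n = S.history U x₀ ω n := by
  induction n with
  | zero => rfl
  | succ n ih =>
    simp only [history]
    rw [ih fun j hj => h j (hj.trans n.lt_succ_self), h n n.lt_succ_self]

theorem state_congr {n : ℕ} {U V : Policy m} (h : V.AgreeBefore n U) (x₀ : Fin m → ℝ) :
    S.state V x₀ n = S.state U x₀ n :=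
  funext fun ω => congrFun (S.history_congr h x₀ ω) _

theorem state_succ (U : Policy m) (x₀ : Fin m → ℝ) (n : ℕ) (ω : S.Outcome) :
    S.state U x₀ (n + 1) ω = S.α n *ᵥ S.state U x₀ n ω + S.b n *ᵥ S.control U x₀ n ω
      + S.c n *ᵥ pad (S.disturbance ω n) := by
  simp [state, history, control]

theorem pastInfo_mono (n : ℕ) : S.pastInfo n ≤ S.pastInfo (n + 1) := by
  rw [pastInfo, ← measurable_iff_comap_le]
  exact (by fun_prop : Measurable fun p : Fin (n + 1) → Fin d → ℝ =>
    fun j : Fin n => p j.castSucc).comp (comap_measurable (S.past (n + 1)))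

theorem measurable_mulVec (A : Matrix (Fin m) (Fin m) ℝ) : Measurable fun x => A *ᵥ x :=
  A.mulVecLin.continuous_of_finiteDimensional.measurable

theorem measurable_history_past (U : Policy m) (x₀ : Fin m → ℝ) (n : ℕ) :
    Measurable[S.pastInfo n] fun ω => S.history U x₀ ω n := by
  induction n with
  | zero => exact @measurable_const _ _ _ (S.pastInfo 0) _
  | succ n ih =>
    have h1 := ih.mono (S.pastInfo_mono n) le_rfl
    have h2 : Measurable[S.pastInfo (n + 1)] fun ω => S.disturbance ω n :=
      (measurable_pi_apply (Fin.last n)).comp (comap_measurable (S.past (n + 1)))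
    have h3 : Measurable fun q : (Fin (n + 1) → Fin m → ℝ) × (Fin d → ℝ) =>
        Fin.snoc (α := fun _ => Fin m → ℝ) q.1 (S.α n *ᵥ q.1 (Fin.last n) + S.b n *ᵥ U.act n q.1
          + S.c n *ᵥ pad q.2) := by
      refine (measurable_snoc (E := Fin m → ℝ) (n + 1)).comp (measurable_fst.prodMk ?_)
      have := U.measurable_act n
      refine Measurable.add (Measurable.add ?_ ?_) ?_
      · exact (measurable_mulVec _).comp (by fun_prop)
      · exact (measurable_mulVec _).comp (by fun_prop)
      · exact (measurable_mulVec _).comp (by fun_prop)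
    exact h3.comp (h1.prodMk h2)

theorem measurable_state (U : Policy m) (x₀ : Fin m → ℝ) (n : ℕ) :
    Measurable[S.pastInfo n] (S.state U x₀ n) :=
  (measurable_pi_apply (Fin.last n)).comp (S.measurable_history_past U x₀ n)

theorem measurable_control (U : Policy m) (x₀ : Fin m → ℝ) (n : ℕ) :
    Measurable[S.pastInfo n] (S.control U x₀ n) :=
  (U.measurable_act n).comp (S.measurable_history_past U x₀ n)

theorem measurable_scale (r : Fin d → ℝ) (n : ℕ) :
    Measurable[S.pastInfo n] fun ω => S.scale r ω n := by
  simp_rw [scale_eq]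
  exact (measurable_scaleOf r n).comp (comap_measurable (S.past n))

theorem history_castSucc (U : Policy m) (x₀ : Fin m → ℝ) (n : ℕ) (ω : S.Outcome) :
    (fun j : Fin (n + 1) => S.history U x₀ ω (n + 1) j.castSucc) = S.history U x₀ ω n := by
  funext j
  simp [history]

/-- The states and the past disturbances carry the same information. -/
theorem information_eq (hc : ∀ j < S.M, ∀ z : Fin d → ℝ, S.c j *ᵥ pad z = 0 → z = 0)
    (U : Policy m) (x₀ : Fin m → ℝ) {n : ℕ} (hn : n ≤ S.M) :
    S.information U x₀ n = S.pastInfo n := by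
  refine le_antisymm (measurable_iff_comap_le.1 (S.measurable_history_past U x₀ n)) ?_
  induction n with
  | zero =>
    have e : S.past 0 = fun _ => default := funext fun ω => Subsingleton.elim _ _
    rw [pastInfo, e, MeasurableSpace.comap_const]
    exact bot_le
  | succ n ih =>
    have hh : Measurable[S.information U x₀ (n + 1)] fun ω => S.history U x₀ ω (n + 1) :=
      comap_measurable _
    have hle : S.information U x₀ n ≤ S.information U x₀ (n + 1) := by
      rw [information, ← measurable_iff_comap_le]
      have h := (by fun_prop : Measurable fun p : Fin (n + 1 + 1) → Fin m → ℝ =>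
        fun j : Fin (n + 1) => p j.castSucc).comp hh
      have e : (fun p : Fin (n + 1 + 1) → Fin m → ℝ => fun j : Fin (n + 1) => p j.castSucc) ∘
          (fun ω => S.history U x₀ ω (n + 1)) = fun ω => S.history U x₀ ω n :=
        funext fun ω => S.history_castSucc U x₀ n ω
      rwa [e] at h
    have hpast : Measurable[S.information U x₀ (n + 1)] (S.past n) :=
      measurable_iff_comap_le.2 ((ih (n.le_succ.trans hn)).trans hle)
    -- A linear left inverse of `z ↦ c_n (pad z)` recovers `v_n` from `x_{n+1} - α_n x_n - b_n u_n`,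
    -- which is a function of the observed states.
    obtain ⟨g, hg⟩ := LinearMap.exists_leftInverse_of_injective
      ((S.c n).mulVecLin.comp (padLinear m d)) (LinearMap.ker_eq_bot'.2 fun z hz => hc n hn z hz)
    have hgm : Measurable g := g.continuous_of_finiteDimensional.measurable
    have e : (fun ω => S.disturbance ω n) = (fun p : Fin (n + 1 + 1) → Fin m → ℝ =>
        g (p (Fin.last (n + 1)) - (S.α n *ᵥ p (Fin.last n).castSucc
          + S.b n *ᵥ U.act n fun j => p j.castSucc))) ∘ fun ω => S.history U x₀ ω (n + 1) := by
      funext ω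
      have h1 := LinearMap.congr_fun hg (S.disturbance ω n)
      have h2 : S.history U x₀ ω (n + 1) (Fin.last n).castSucc = S.state U x₀ n ω :=
        congrFun (S.history_castSucc U x₀ n ω) (Fin.last n)
      simp only [Function.comp_apply, history_castSucc, h2]
      change _ = g (S.state U x₀ (n + 1) ω - (S.α n *ᵥ S.state U x₀ n ω
        + S.b n *ᵥ S.control U x₀ n ω))
      rw [state_succ, add_sub_cancel_left]
      exact h1.symm
    have hv : Measurable[S.information U x₀ (n + 1)] fun ω => S.disturbance ω n := by
      rw [e]
      refine Measurable.comp (hgm.comp (Measurable.sub (by fun_prop) (Measurable.add ?_ ?_))) hh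
      · exact (measurable_mulVec _).comp (by fun_prop)
      · exact (measurable_mulVec _).comp ((U.measurable_act n).comp (by fun_prop))
    rw [pastInfo, ← measurable_iff_comap_le]
    have e2 : S.past (n + 1) = fun ω =>
        Fin.snoc (α := fun _ => Fin d → ℝ) (S.past n ω) (S.disturbance ω n) :=
      funext fun ω => S.past_succ n ω
    rw [e2]
    exact (measurable_snoc (E := Fin d → ℝ) n).comp (hpast.prodMk hv)

/-- Every control that depends on the past disturbances only is applied by some policy. -/
theorem exists_policy_control
    (hc : ∀ j < S.M, ∀ z : Fin d → ℝ, S.c j *ᵥ pad z = 0 → z = 0)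
    (U : Policy m) (x₀ : Fin m → ℝ) {n : ℕ} (hn : n ≤ S.M) {g : S.Outcome → Fin m → ℝ}
    (hg : Measurable[S.pastInfo n] g) :
    ∃ V : Policy m, V.AgreeBefore n U ∧ S.control V x₀ n = g := by
  rw [← S.information_eq hc U x₀ hn] at hg
  obtain ⟨h, hh, rfl⟩ := hg.exists_eq_measurable_comp
  have hV : ∀ j, Measurable (Function.update U.act n h j) := fun j => by
    by_cases hj : j = n
    · subst hj; rwa [Function.update_self]
    · rw [Function.update_of_ne hj]; exact U.measurable_act j
  have ha : Policy.AgreeBefore n ⟨Function.update U.act n h, hV⟩ U := fun j hj => by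
    exact Function.update_of_ne hj.ne _ _
  refine ⟨_, ha, funext fun ω => ?_⟩
  rw [control, S.history_congr ha]
  simp

/-- The cost from time `n` up to the horizon, averaged over the horizon's conditional law. -/
def cost (U : Policy m) (x₀ : Fin m → ℝ) (n : ℕ) (ω : S.Outcome) : ℝ :=
  ∑ N ∈ Finset.Icc n S.M, S.p N / S.tailProb n * ∑ i ∈ Finset.Icc n N, S.stageCost U x₀ i ω

theorem tailProb_pos (hp : ∀ j ≤ S.M, 0 ≤ S.p j) (hp_last : S.p S.M ≠ 0) {n : ℕ}
    (hn : n ≤ S.M) : 0 < S.tailProb n :=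
  ((hp S.M le_rfl).lt_of_ne' hp_last).trans_le
    (Finset.single_le_sum (f := S.p) (fun j hj => hp j (Finset.mem_Icc.1 hj).2)
      (Finset.mem_Icc.2 ⟨hn, le_rfl⟩))

theorem tailProb_last : S.tailProb (S.M + 1) = 0 := by simp [tailProb]

theorem continueProb_last : S.continueProb S.M = 0 := by simp [continueProb, tailProb_last]

theorem continueProb_pos (hp : ∀ j ≤ S.M, 0 ≤ S.p j) (hp_last : S.p S.M ≠ 0) {n : ℕ}
    (hn : n < S.M) : 0 < S.continueProb n :=
  div_pos (S.tailProb_pos hp hp_last hn) (S.tailProb_pos hp hp_last hn.le)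

/-- The one-step recursion of dynamic programming: the weights of the stage cost at `n` add up to
`1`, and the other weights satisfy `p_N / φ_n = (φ_{n+1} / φ_n) (p_N / φ_{n+1})`. -/
theorem cost_eq (hp : ∀ j ≤ S.M, 0 ≤ S.p j) (hp_last : S.p S.M ≠ 0) {n : ℕ} (hn : n ≤ S.M)
    (U : Policy m) (x₀ : Fin m → ℝ) (ω : S.Outcome) :
    S.cost U x₀ n ω
      = S.stageCost U x₀ n ω + S.continueProb n * S.cost U x₀ (n + 1) ω := by
  have h0 := S.tailProb_pos hp hp_last hn
  have hI (a b : ℕ) : Finset.Ioc a b = Finset.Icc (a + 1) b := by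
    ext; simp only [Finset.mem_Ioc, Finset.mem_Icc]; omega
  have h1 : S.cost U x₀ n ω = ∑ N ∈ Finset.Icc n S.M, (S.p N / S.tailProb n * S.stageCost U x₀ n ω
      + S.p N / S.tailProb n * ∑ i ∈ Finset.Icc (n + 1) N, S.stageCost U x₀ i ω) := by
    refine Finset.sum_congr rfl fun N hN => ?_
    rw [← mul_add, ← Finset.add_sum_Ioc_eq_sum_Icc (Finset.mem_Icc.1 hN).1, hI]
  rw [h1, Finset.sum_add_distrib, ← Finset.sum_mul, ← Finset.sum_div]
  congr 1
  · rw [← tailProb, div_self h0.ne', one_mul]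
  -- The term `N = n` drops out, as it has no cost after time `n`.
  · rw [← Finset.add_sum_Ioc_eq_sum_Icc hn, Finset.Icc_eq_empty (by simp), Finset.sum_empty, mul_zero,
      zero_add, cost, Finset.mul_sum, hI]
    refine Finset.sum_congr rfl fun N hN => ?_
    -- The presence of a summand `N` gives `n + 1 ≤ M`, so that `φ_{n+1}` is positive and cancels.
    have hnM : n + 1 ≤ S.M := (Finset.mem_Icc.1 hN).1.trans (Finset.mem_Icc.1 hN).2
    have h2 := S.tailProb_pos hp hp_last hnM
    rw [continueProb, ← mul_assoc]
    congr 1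
    field_simp

theorem stageCost_nonneg (hk : ∀ j ≤ S.M, (S.k j).PosSemidef)
    (hs : ∀ j ≤ S.M, ∀ y : Fin m ⊕ Fin m → ℝ, 0 ≤ y ⬝ᵥ (S.s j *ᵥ y)) {n : ℕ} (hn : n ≤ S.M)
    (U : Policy m) (x₀ : Fin m → ℝ) (ω : S.Outcome) : 0 ≤ S.stageCost U x₀ n ω := by
  have := (hk n hn).dotProduct_mulVec_nonneg (S.control U x₀ n ω)
  rw [star_trivial] at this
  exact add_nonneg (hs n hn _) this

theorem cost_nonneg (hp : ∀ j ≤ S.M, 0 ≤ S.p j) (hk : ∀ j ≤ S.M, (S.k j).PosSemidef)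
    (hs : ∀ j ≤ S.M, ∀ y : Fin m ⊕ Fin m → ℝ, 0 ≤ y ⬝ᵥ (S.s j *ᵥ y)) (n : ℕ)
    (U : Policy m) (x₀ : Fin m → ℝ) (ω : S.Outcome) : 0 ≤ S.cost U x₀ n ω := by
  refine Finset.sum_nonneg fun N hN => mul_nonneg (div_nonneg (hp N (Finset.mem_Icc.1 hN).2) ?_) ?_
  · exact Finset.sum_nonneg fun j hj => hp j (Finset.mem_Icc.1 hj).2
  · exact Finset.sum_nonneg fun i hi => S.stageCost_nonneg hk hs
      ((Finset.mem_Icc.1 hi).2.trans (Finset.mem_Icc.1 hN).2) U x₀ ω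

theorem measurable_dotProduct_mulVec {ι : Type*} [Fintype ι] (A : Matrix ι ι ℝ) :
    Measurable fun x : ι → ℝ => x ⬝ᵥ (A *ᵥ x) := by
  simp only [dotProduct, Matrix.mulVec]; fun_prop

theorem measurable_sumElim :
    Measurable fun q : (Fin m → ℝ) × (Fin m → ℝ) => (Sum.elim q.1 q.2 : Fin m ⊕ Fin m → ℝ) := by
  refine measurable_pi_lambda _ fun i => ?_
  rcases i with i | i
  · simp only [Sum.elim_inl]; fun_prop
  · simp only [Sum.elim_inr]; fun_prop

theorem measurable_stageCost (U : Policy m) (x₀ : Fin m → ℝ) (n : ℕ) :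
    Measurable (S.stageCost U x₀ n) := by
  have h1 : Measurable (S.state U x₀ n) := (S.measurable_state U x₀ n).mono (S.pastInfo_le n) le_rfl
  have h2 : Measurable (S.control U x₀ n) :=
    (S.measurable_control U x₀ n).mono (S.pastInfo_le n) le_rfl
  refine Measurable.add ?_ ((measurable_dotProduct_mulVec _).comp h2)
  exact (measurable_dotProduct_mulVec _).comp
    (measurable_sumElim.comp (h1.prodMk (measurable_pad.comp measurable_fst)))

theorem measurable_risk (r : Fin d → ℝ) (U : Policy m) (x₀ : Fin m → ℝ) (n : ℕ) :
    Measurable (S.risk r U x₀ n) := measurable_condLExp' _ _ _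

theorem risk_eq (hc : ∀ j < S.M, ∀ z : Fin d → ℝ, S.c j *ᵥ pad z = 0 → z = 0)
    (r : Fin d → ℝ) (U : Policy m) (x₀ : Fin m → ℝ) {n : ℕ} (hn : n ≤ S.M) :
    S.risk r U x₀ n = (S.law r)⁻[fun ω => ENNReal.ofReal (S.cost U x₀ n ω) | S.pastInfo n] := by
  rw [risk, S.information_eq hc U x₀ hn]
  rfl

variable {S} in
theorem IsBayesRisk.congr_ae {r : Fin d → ℝ} {U : Policy m} {x₀ : Fin m → ℝ} {n : ℕ}
    {W W' : S.Outcome → ℝ≥0∞} (h : S.IsBayesRisk r U x₀ n W) (hW' : Measurable W')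
    (e : W =ᵐ[S.law r] W') : S.IsBayesRisk r U x₀ n W' :=
  ⟨hW', fun V hV => e.symm.le.trans (h.2.1 V hV), fun X hX hle => (h.2.2 X hX hle).trans e.le⟩

variable {S} in
theorem IsBayesRisk.ae_eq {r : Fin d → ℝ} {U : Policy m} {x₀ : Fin m → ℝ} {n : ℕ}
    {W W' : S.Outcome → ℝ≥0∞} (h : S.IsBayesRisk r U x₀ n W) (h' : S.IsBayesRisk r U x₀ n W') :
    W =ᵐ[S.law r] W' :=
  (h'.2.2 W h.1 h.2.1).antisymm (h.2.2 W' h'.1 h'.2.1)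

theorem isBayesRisk_congr_policy {r : Fin d → ℝ} {U V : Policy m} {x₀ : Fin m → ℝ} {n : ℕ}
    {W : S.Outcome → ℝ≥0∞} (h : S.IsBayesRisk r U x₀ n W) (hV : V.AgreeBefore n U) :
    S.IsBayesRisk r V x₀ n W := by
  have h1 : ∀ V' : Policy m, V'.AgreeBefore n V → V'.AgreeBefore n U :=
    fun V' h' j hj => (h' j hj).trans (hV j hj)
  have h2 : ∀ V' : Policy m, V'.AgreeBefore n U → V'.AgreeBefore n V :=
    fun V' h' j hj => (h' j hj).trans (hV j hj).symm
  exact ⟨h.1, fun V' h' => h.2.1 V' (h1 V' h'),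
    fun X hX hle => h.2.2 X hX fun V' h' => hle V' (h2 V' h')⟩

theorem isBayesPolicy_of_gt (r : Fin d → ℝ) (U : Policy m) (x₀ : Fin m → ℝ) {n : ℕ}
    (hn : S.M < n) : S.IsBayesPolicy r U x₀ n := by
  have h (V : Policy m) : S.risk r V x₀ n = 0 := by
    unfold risk
    simp only [Finset.Icc_eq_empty (not_le.2 hn), Finset.sum_empty, ENNReal.ofReal_zero]
    exact condLExp_zero _
  refine ⟨S.measurable_risk r U x₀ n, fun V _ => ?_, fun W _ hle => hle U fun _ _ => rfl⟩
  rw [h U, h V]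

/-- The risk form is a real quadratic form that is nonnegative only almost surely, while risks live
in `[0, ∞]`. This lemma passes from one to the other, so that the moment formulas apply. -/
theorem condLExp_joint_ofReal {r : Fin d → ℝ} (hr : ∀ i, 0 < r i) (hβ : ∀ i, 0 < S.β i)
    {n : ℕ} (hn : n < S.M) {E : Type*} [MeasurableSpace E] [StandardBorelSpace E] [Nonempty E]
    {X : S.Outcome → E} (hX : Measurable[S.pastInfo n] X)
    {f : E × (Fin d → ℝ) × (Fin d → ℝ) → ℝ} (hf : Measurable f)
    (hnn : ∀ᵐ ω ∂S.law r, 0 ≤ f (X ω, ω.1, S.disturbance ω n))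
    (hint : ∀ ω, Integrable (fun q => f (X ω, S.scale r ω n * q.1, S.scale r ω n * q.1 * q.2))
      (unitLaw (S.shape n))) :
    ∀ᵐ ω ∂S.law r,
      (S.law r)⁻[fun ω => ENNReal.ofReal (f (X ω, ω.1, S.disturbance ω n)) | S.pastInfo n] ω
        = ENNReal.ofReal (∫ q, f (X ω, S.scale r ω n * q.1, S.scale r ω n * q.1 * q.2)
            ∂unitLaw (S.shape n)) ∧
      0 ≤ ∫ q, f (X ω, S.scale r ω n * q.1, S.scale r ω n * q.1 * q.2) ∂unitLaw (S.shape n) := by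
  have h1 := S.condLExp_joint hr hβ hn hX (f := fun z => ENNReal.ofReal (f z)) (by fun_prop)
  have hsm : MeasurableSet {z | f z < 0} := measurableSet_lt hf measurable_const
  -- The event `f < 0` is null, hence it is null under almost every conditional law; this gives
  -- nonnegativity under the conditional law.
  have h2 := S.condLExp_joint hr hβ hn hX (f := {z | f z < 0}.indicator fun _ => 1)
    (measurable_const.indicator hsm)
  have h3 : (fun ω => {z | f z < 0}.indicator (fun _ => (1 : ℝ≥0∞)) (X ω, ω.1, S.disturbance ω n))
      =ᵐ[S.law r] 0 := by
    filter_upwards [hnn] with ω hω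
    exact Set.indicator_of_notMem (by simpa using hω) _
  have h4 := condLExp_congr_ae (mΩ := S.pastInfo n) h3
  rw [condLExp_zero] at h4
  have hsc : Measurable fun ω => S.scale r ω n := (S.measurable_scale r n).mono (S.pastInfo_le n) le_rfl
  filter_upwards [h1, h2, h4] with ω e1 e2 e4
  rw [e4, Pi.zero_apply, eq_comm, lintegral_eq_zero_iff] at e2
  · have hq : 0 ≤ᵐ[unitLaw (S.shape n)]
        fun q => f (X ω, S.scale r ω n * q.1, S.scale r ω n * q.1 * q.2) := by
      filter_upwards [e2] with q hq
      by_contra hlt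
      rw [Set.indicator_of_mem (by simpa using hlt)] at hq
      exact one_ne_zero hq
    exact ⟨e1.trans (ofReal_integral_eq_lintegral_ofReal (hint ω) hq).symm,
      integral_nonneg_of_ae hq⟩
  · exact (measurable_const.indicator hsm).comp (by fun_prop)

end ControlSystem

end BayesControl

end

/-! ### The Bellman equation -/

noncomputable section

namespace BayesControl

variable {m d : ℕ}

theorem quadForm_add (A A' B B' C C' : Matrix (Fin m) (Fin m) ℝ) (x r : Fin m → ℝ) :
    quadForm (A + A') (B + B') (C + C') x r = quadForm A B C x r + quadForm A' B' C' x r := by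
  simp only [quadForm, Matrix.add_mulVec, dotProduct_add]; ring

theorem quadForm_smul (a : ℝ) (A B C : Matrix (Fin m) (Fin m) ℝ) (x r : Fin m → ℝ) :
    quadForm (a • A) (a • B) (a • C) x r = a * quadForm A B C x r := by
  simp only [quadForm, Matrix.smul_mulVec, dotProduct_smul, smul_eq_mul]; ring

theorem measurable_quadForm (A B C : Matrix (Fin m) (Fin m) ℝ) :
    Measurable fun q : (Fin m → ℝ) × (Fin m → ℝ) => quadForm A B C q.1 q.2 := by
  simp only [quadForm, dotProduct, Matrix.mulVec]; fun_prop

namespace ControlSystem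

variable (S : ControlSystem m d)

/-- `A n, B n, C n` are the coefficients of the Bayes risk at time `n`. -/
def HasRiskForm (A B C : ℕ → Matrix (Fin m) (Fin m) ℝ) (n : ℕ) : Prop :=
  (A n).IsSymm ∧ ∀ (x₀ : Fin m → ℝ) (r : Fin d → ℝ), (∀ i, 0 < r i) → ∀ U : Policy m,
    (∀ᵐ ω ∂S.law r, 0 ≤ S.riskForm A B C r U x₀ n ω) ∧
    S.IsBayesRisk r U x₀ n fun ω => ENNReal.ofReal (S.riskForm A B C r U x₀ n ω)

theorem riskForm_eq (A B C : ℕ → Matrix (Fin m) (Fin m) ℝ) (r : Fin d → ℝ) (U : Policy m)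
    (x₀ : Fin m → ℝ) (n : ℕ) (ω : S.Outcome) :
    S.riskForm A B C r U x₀ n ω
      = quadForm (A n) (B n) (C n) (S.state U x₀ n ω) (pad (S.scale r ω n)) := rfl

/-- The conditional mean of the cost from time `n` on, as a function of the control at time `n`,
when the later controls are Bayes controls. -/
def stepCost (A B : ℕ → Matrix (Fin m) (Fin m) ℝ) (A' B' C' : Matrix (Fin m) (Fin m) ℝ)
    (r : Fin d → ℝ) (U : Policy m) (x₀ : Fin m → ℝ) (n : ℕ) (ω : S.Outcome) (u : Fin m → ℝ) : ℝ :=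
  u ⬝ᵥ (S.K A n *ᵥ u) - 2 * (u ⬝ᵥ S.L A B r U x₀ n ω)
    + quadForm A' B' C' (S.state U x₀ n ω) (pad (S.scale r ω n))

theorem shape_gt (hβ : ∀ i, 2 < S.β i) (n : ℕ) (i : Fin d) : 2 < S.shape n i :=
  (hβ i).trans_le (le_add_of_nonneg_right n.cast_nonneg)

/-- The matrices are chosen before `x₀`, `r` and `U`, as the coefficients of the Bayes risk must not
depend on these; this order of quantifiers is kept throughout. -/
theorem exists_condLExp_stageCost (hβ : ∀ i, 2 < S.β i)
    (hk : ∀ j ≤ S.M, (S.k j).PosSemidef)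
    (hs : ∀ j ≤ S.M, ∀ y : Fin m ⊕ Fin m → ℝ, 0 ≤ y ⬝ᵥ (S.s j *ᵥ y)) {n : ℕ} (hn : n ≤ S.M) :
    ∃ A' B' C' : Matrix (Fin m) (Fin m) ℝ, ∀ (x₀ : Fin m → ℝ) (r : Fin d → ℝ), (∀ i, 0 < r i) →
      ∀ U : Policy m, ∀ᵐ ω ∂S.law r,
        (S.law r)⁻[fun ω => ENNReal.ofReal (S.stageCost U x₀ n ω) | S.pastInfo n] ω
          = ENNReal.ofReal (quadForm A' B' C' (S.state U x₀ n ω) (pad (S.scale r ω n))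
              + S.control U x₀ n ω ⬝ᵥ (S.k n *ᵥ S.control U x₀ n ω)) ∧
        0 ≤ quadForm A' B' C' (S.state U x₀ n ω) (pad (S.scale r ω n))
              + S.control U x₀ n ω ⬝ᵥ (S.k n *ᵥ S.control U x₀ n ω) := by
  have hβ0 : ∀ i, 0 < S.β i := fun i => two_pos.trans (hβ i)
  obtain ⟨A', B', C', h⟩ := exists_integral_stage (S.shape_gt hβ n) (S.s n)
  refine ⟨A', B', C', fun x₀ r hr U => ?_⟩
  have := isProbabilityMeasure_paretoUnit (S.shape_pos hβ0 n)
  have hkn : ∀ u : Fin m → ℝ, 0 ≤ u ⬝ᵥ (S.k n *ᵥ u) := fun u => by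
    have := (hk n hn).dotProduct_mulVec_nonneg u
    rwa [star_trivial] at this
  have hX := (S.measurable_state U x₀ n).prodMk (S.measurable_control U x₀ n)
  have hf : Measurable fun z : ((Fin m → ℝ) × (Fin m → ℝ)) × (Fin d → ℝ) =>
      ENNReal.ofReal (Sum.elim z.1.1 (pad z.2) ⬝ᵥ (S.s n *ᵥ Sum.elim z.1.1 (pad z.2))
        + z.1.2 ⬝ᵥ (S.k n *ᵥ z.1.2)) := by
    refine ENNReal.measurable_ofReal.comp (Measurable.add ?_ ?_)
    · exact (measurable_dotProduct_mulVec (S.s n)).comp (measurable_sumElim.comp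
        (f := fun z : ((Fin m → ℝ) × (Fin m → ℝ)) × (Fin d → ℝ) => (z.1.1, pad z.2)) (by fun_prop))
    · exact (measurable_dotProduct_mulVec (S.k n)).comp (by fun_prop)
  filter_upwards [S.condLExp_marginal hr hβ0 hn hX hf] with ω hω
  obtain ⟨i1, j1⟩ := h (S.state U x₀ n ω) (S.scale r ω n)
  have i2 := i1.add (integrable_const (S.control U x₀ n ω ⬝ᵥ (S.k n *ᵥ S.control U x₀ n ω)))
  have e := integral_add i1 (integrable_const (S.control U x₀ n ω ⬝ᵥ (S.k n *ᵥ S.control U x₀ n ω)))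
  rw [j1, integral_const, probReal_univ, one_smul] at e
  have hnn (y : Fin d → ℝ) : 0 ≤ Sum.elim (S.state U x₀ n ω) (pad (S.scale r ω n * y)) ⬝ᵥ
      (S.s n *ᵥ Sum.elim (S.state U x₀ n ω) (pad (S.scale r ω n * y)))
        + S.control U x₀ n ω ⬝ᵥ (S.k n *ᵥ S.control U x₀ n ω) :=
    add_nonneg (hs n hn _) (hkn _)
  rw [← e]
  exact ⟨hω.trans (ofReal_integral_eq_lintegral_ofReal i2 (ae_of_all _ hnn)).symm,
    integral_nonneg hnn⟩

theorem Q_mulVec_pad (n : ℕ) (t : Fin d → ℝ) :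
    (S.Q n *ᵥ pad t : Fin m → ℝ)
      = pad t * pad fun i => S.shape n i / (2 * (S.shape n i - 1)) := by
  ext i; rw [Q, Matrix.mulVec_diagonal, Pi.mul_apply, mul_comm]

theorem Q₂_mulVec_pad (n : ℕ) (t : Fin d → ℝ) :
    (S.Q₂ n *ᵥ pad t : Fin m → ℝ)
      = pad t * pad fun i => S.shape n i ^ 2 / (S.shape n i ^ 2 - 1) := by
  ext i; rw [Q₂, Matrix.mulVec_diagonal, Pi.mul_apply, mul_comm]

/-- Sorting the expected next risk by powers of `u` identifies `K` and `L` as the coefficients of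
the quadratic and linear parts; `Q` and `Q₂` encode the conditional means of `v_n` and `r̄_{n+1}`.
-/
theorem stepCost_eq (A B : ℕ → Matrix (Fin m) (Fin m) ℝ) (A' B' C' D : Matrix (Fin m) (Fin m) ℝ)
    (r : Fin d → ℝ) (U : Policy m) (x₀ : Fin m → ℝ) (n : ℕ) (hA : (A (n + 1)).IsSymm)
    (ω : S.Outcome) (u : Fin m → ℝ) :
    S.stepCost A B (A' + S.continueProb n • ((S.α n)ᵀ * A (n + 1) * S.α n))
        (B' + S.continueProb n •
          ((A (n + 1) * S.c n * S.Q n + (B (n + 1))ᵀ * S.Q₂ n)ᵀ * S.α n))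
        (C' + S.continueProb n • D) r U x₀ n ω u
      = quadForm A' B' C' (S.state U x₀ n ω) (pad (S.scale r ω n)) + u ⬝ᵥ (S.k n *ᵥ u)
        + S.continueProb n *
          ((S.α n *ᵥ S.state U x₀ n ω + S.b n *ᵥ u) ⬝ᵥ
              (A (n + 1) *ᵥ (S.α n *ᵥ S.state U x₀ n ω + S.b n *ᵥ u))
            + 2 * ((S.α n *ᵥ S.state U x₀ n ω + S.b n *ᵥ u) ⬝ᵥ ((A (n + 1) * S.c n) *ᵥ
                (pad (S.scale r ω n) * pad fun i => S.shape n i / (2 * (S.shape n i - 1)))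
              + (B (n + 1))ᵀ *ᵥ (pad (S.scale r ω n) *
                  pad fun i => S.shape n i ^ 2 / (S.shape n i ^ 2 - 1))))
            + 2 * (pad (S.scale r ω n) ⬝ᵥ (D *ᵥ pad (S.scale r ω n)))) := by
  rw [← Q_mulVec_pad, ← Q₂_mulVec_pad, stepCost, quadForm_add, quadForm_smul, K, L]
  generalize S.state U x₀ n ω = x
  generalize (pad (S.scale r ω n) : Fin m → ℝ) = t
  generalize S.continueProb n = ρ
  set N := A (n + 1) * S.c n * S.Q n + (B (n + 1))ᵀ * S.Q₂ n with hN
  have h0 : (A (n + 1) * S.c n) *ᵥ (S.Q n *ᵥ t) + (B (n + 1))ᵀ *ᵥ (S.Q₂ n *ᵥ t) = N *ᵥ t := by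
    rw [hN, Matrix.add_mulVec, Matrix.mulVec_mulVec, Matrix.mulVec_mulVec]
  rw [h0]
  generalize N = N
  set a := S.α n *ᵥ x with ha
  have h1 (y : Fin m → ℝ) : u ⬝ᵥ ((S.b n)ᵀ *ᵥ y) = (S.b n *ᵥ u) ⬝ᵥ y := by
    rw [dotProduct_mulVec_comm, Matrix.transpose_transpose, dotProduct_comm]
  have h2 : u ⬝ᵥ (((S.b n)ᵀ * A (n + 1) * S.b n) *ᵥ u)
      = (S.b n *ᵥ u) ⬝ᵥ (A (n + 1) *ᵥ (S.b n *ᵥ u)) := by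
    rw [← h1, Matrix.mulVec_mulVec, Matrix.mulVec_mulVec]
  have h3 : x ⬝ᵥ (((S.α n)ᵀ * A (n + 1) * S.α n) *ᵥ x) = a ⬝ᵥ (A (n + 1) *ᵥ a) := by
    rw [ha, mul_assoc, ← Matrix.mulVec_mulVec, ← Matrix.mulVec_mulVec, dotProduct_mulVec_comm,
      Matrix.transpose_transpose, dotProduct_comm]
  have h4 : t ⬝ᵥ ((Nᵀ * S.α n) *ᵥ x) = a ⬝ᵥ (N *ᵥ t) := by
    rw [← Matrix.mulVec_mulVec, dotProduct_mulVec_comm, Matrix.transpose_transpose]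
  have h5 : a ⬝ᵥ (A (n + 1) *ᵥ (S.b n *ᵥ u)) = (S.b n *ᵥ u) ⬝ᵥ (A (n + 1) *ᵥ a) := by
    rw [dotProduct_mulVec_comm, hA.eq]
  rw [quadForm, quadForm, h3, h4]
  simp only [Matrix.add_mulVec, Matrix.smul_mulVec, dotProduct_add, add_dotProduct, dotProduct_neg,
    dotProduct_smul, smul_eq_mul, h1, h2, Matrix.mulVec_add, h5]
  ring

theorem condLExp_riskForm_succ (hβ : ∀ i, 2 < S.β i) {n : ℕ} (hn : n < S.M)
    (A B C : ℕ → Matrix (Fin m) (Fin m) ℝ) (hA : (A (n + 1)).IsSymm) :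
    ∃ D : Matrix (Fin m) (Fin m) ℝ, ∀ (x₀ : Fin m → ℝ) (r : Fin d → ℝ), (∀ i, 0 < r i) →
      ∀ U : Policy m, (∀ᵐ ω ∂S.law r, 0 ≤ S.riskForm A B C r U x₀ (n + 1) ω) →
      ∀ A' B' C' : Matrix (Fin m) (Fin m) ℝ, ∀ᵐ ω ∂S.law r, ∃ c : ℝ, 0 ≤ c ∧
        (S.law r)⁻[fun ω => ENNReal.ofReal (S.riskForm A B C r U x₀ (n + 1) ω) | S.pastInfo n] ω
          = ENNReal.ofReal c ∧
        S.stepCost A B (A' + S.continueProb n • ((S.α n)ᵀ * A (n + 1) * S.α n))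
          (B' + S.continueProb n •
            ((A (n + 1) * S.c n * S.Q n + (B (n + 1))ᵀ * S.Q₂ n)ᵀ * S.α n))
          (C' + S.continueProb n • D) r U x₀ n ω (S.control U x₀ n ω)
        = quadForm A' B' C' (S.state U x₀ n ω) (pad (S.scale r ω n))
            + S.control U x₀ n ω ⬝ᵥ (S.k n *ᵥ S.control U x₀ n ω) + S.continueProb n * c := by
  have hβ0 : ∀ i, 0 < S.β i := fun i => two_pos.trans (hβ i)
  obtain ⟨D, hD⟩ := exists_integral_quadForm (S.shape_gt hβ n) (A (n + 1)) (B (n + 1)) (C (n + 1))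
    (S.c n) hA
  refine ⟨D, fun x₀ r hr U hnn A' B' C' => ?_⟩
  have hX : Measurable[S.pastInfo n] fun ω =>
      (S.α n *ᵥ S.state U x₀ n ω + S.b n *ᵥ S.control U x₀ n ω, S.scale r ω n) :=
    (((measurable_mulVec _).comp (S.measurable_state U x₀ n)).add
      ((measurable_mulVec _).comp (S.measurable_control U x₀ n))).prodMk (S.measurable_scale r n)
  have hf : Measurable fun z : ((Fin m → ℝ) × (Fin d → ℝ)) × (Fin d → ℝ) × (Fin d → ℝ) =>
      quadForm (A (n + 1)) (B (n + 1)) (C (n + 1)) (z.1.1 + S.c n *ᵥ pad z.2.2)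
        (pad (z.1.2 ⊔ z.2.2)) := by
    refine (measurable_quadForm _ _ _).comp (f := fun z : ((Fin m → ℝ) × (Fin d → ℝ)) ×
      (Fin d → ℝ) × (Fin d → ℝ) => (z.1.1 + S.c n *ᵥ pad z.2.2, pad (z.1.2 ⊔ z.2.2)))
      (Measurable.prodMk (Measurable.add (by fun_prop) ?_) (measurable_pad.comp ?_))
    · exact (measurable_mulVec _).comp (by fun_prop)
    · exact measurable_sup_pi.comp (f := fun z : ((Fin m → ℝ) × (Fin d → ℝ)) ×
        (Fin d → ℝ) × (Fin d → ℝ) => (z.1.2, z.2.2)) (by fun_prop)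
  have hsc : ∀ ω i, 0 < S.scale r ω n i := fun ω i => by
    rw [scale_eq]; exact scaleOf_pos hr n _ i
  have e : S.riskForm A B C r U x₀ (n + 1) = fun ω =>
      quadForm (A (n + 1)) (B (n + 1)) (C (n + 1))
        (S.α n *ᵥ S.state U x₀ n ω + S.b n *ᵥ S.control U x₀ n ω
          + S.c n *ᵥ pad (S.disturbance ω n)) (pad (S.scale r ω n ⊔ S.disturbance ω n)) := by
    funext ω
    rw [riskForm_eq, state_succ]
    rfl
  rw [e] at hnn ⊢
  filter_upwards [S.condLExp_joint_ofReal hr hβ0 hn hX hf hnn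
    fun ω => (hD _ (S.scale r ω n) (hsc ω)).1] with ω hω
  refine ⟨_, hω.2, hω.1, ?_⟩
  rw [S.stepCost_eq A B A' B' C' D r U x₀ n hA]
  exact congrArg _ (congrArg _ (hD _ (S.scale r ω n) (hsc ω)).2.symm)

/-- The Bellman equation: the conditional mean of the cost, with Bayes controls after time `n`, is a
quadratic function of the control at time `n`. -/
theorem exists_stepCost (hβ : ∀ i, 2 < S.β i)
    (hp : ∀ j ≤ S.M, 0 ≤ S.p j) (hp_last : S.p S.M ≠ 0)
    (hk : ∀ j ≤ S.M, (S.k j).PosSemidef)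
    (hs : ∀ j ≤ S.M, ∀ y : Fin m ⊕ Fin m → ℝ, 0 ≤ y ⬝ᵥ (S.s j *ᵥ y))
    (hc : ∀ j < S.M, ∀ z : Fin d → ℝ, S.c j *ᵥ pad z = 0 → z = 0)
    {n : ℕ} (hn : n ≤ S.M) (A B C : ℕ → Matrix (Fin m) (Fin m) ℝ)
    (hABC : n < S.M → S.HasRiskForm A B C (n + 1)) :
    ∃ A' B' C' : Matrix (Fin m) (Fin m) ℝ, ∀ (x₀ : Fin m → ℝ) (r : Fin d → ℝ), (∀ i, 0 < r i) →
      ∀ U : Policy m,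
        (∀ᵐ ω ∂S.law r, 0 ≤ S.stepCost A B A' B' C' r U x₀ n ω (S.control U x₀ n ω)) ∧
        (∀ᵐ ω ∂S.law r, ENNReal.ofReal
          (S.stepCost A B A' B' C' r U x₀ n ω (S.control U x₀ n ω)) ≤ S.risk r U x₀ n ω) ∧
        (S.IsBayesPolicy r U x₀ (n + 1) ↔ ∀ᵐ ω ∂S.law r, S.risk r U x₀ n ω
          = ENNReal.ofReal (S.stepCost A B A' B' C' r U x₀ n ω (S.control U x₀ n ω))) := by
  have hβ0 : ∀ i, 0 < S.β i := fun i => two_pos.trans (hβ i)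
  obtain ⟨As, Bs, Cs, hstage⟩ := S.exists_condLExp_stageCost hβ hk hs hn
  rcases hn.lt_or_eq with hlt | rfl
  · obtain ⟨hA, hform⟩ := hABC hlt
    have hρ := S.continueProb_pos hp hp_last hlt
    obtain ⟨D, hD⟩ := S.condLExp_riskForm_succ hβ hlt A B C hA
    refine ⟨As + S.continueProb n • ((S.α n)ᵀ * A (n + 1) * S.α n), Bs + S.continueProb n •
      ((A (n + 1) * S.c n * S.Q n + (B (n + 1))ᵀ * S.Q₂ n)ᵀ * S.α n), Cs + S.continueProb n • D,
      fun x₀ r hr U => ?_⟩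
    have := S.isProbabilityMeasure_law hr hβ0
    obtain ⟨hnn, hW⟩ := hform x₀ r hr U
    have hD' := hD x₀ r hr U hnn As Bs Cs
    have hms : Measurable fun ω => ENNReal.ofReal (S.stageCost U x₀ n ω) :=
      (S.measurable_stageCost U x₀ n).ennreal_ofReal
    have e1 : (fun ω => ENNReal.ofReal (S.cost U x₀ n ω))
        = (fun ω => ENNReal.ofReal (S.stageCost U x₀ n ω))
          + ENNReal.ofReal (S.continueProb n) • fun ω =>
              ENNReal.ofReal (S.cost U x₀ (n + 1) ω) := by
      funext ω
      rw [S.cost_eq hp hp_last hn, ENNReal.ofReal_add (S.stageCost_nonneg hk hs hn U x₀ ω)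
        (mul_nonneg hρ.le (S.cost_nonneg hp hk hs (n + 1) U x₀ ω)), ENNReal.ofReal_mul hρ.le]
      rfl
    -- Tower property along the policy-independent filtration: the risk at `n` is the mean stage
    -- cost plus `ρ_n` times the conditional mean of the risk at `n + 1`.
    have e2 : S.risk r U x₀ n =ᵐ[S.law r]
        (S.law r)⁻[fun ω => ENNReal.ofReal (S.stageCost U x₀ n ω) | S.pastInfo n]
          + ENNReal.ofReal (S.continueProb n) •
            (S.law r)⁻[S.risk r U x₀ (n + 1) | S.pastInfo n] := by
      rw [S.risk_eq hc r U x₀ hn, e1]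
      refine (condLExp_add_left _ hms.aemeasurable).trans ?_
      refine Filter.EventuallyEq.add Filter.EventuallyEq.rfl ?_
      refine (condLExp_smul' _ ENNReal.ofReal_ne_top).trans ?_
      refine Filter.EventuallyEq.const_smul ?_ _
      rw [S.risk_eq hc r U x₀ hlt]
      exact (condLExp_condLExp (S.pastInfo_mono n) (S.pastInfo_le (n + 1)) _).symm
    have hle : (fun ω => ENNReal.ofReal (S.riskForm A B C r U x₀ (n + 1) ω))
        ≤ᵐ[S.law r] S.risk r U x₀ (n + 1) := hW.2.1 U fun _ _ => rfl
    have hcle := condLExp_mono (mΩ := S.pastInfo n) hle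
    refine ⟨?_, ?_, ?_, ?_⟩
    · filter_upwards [hstage x₀ r hr U, hD'] with ω h1 ⟨c, h2, h3, h4⟩
      rw [h4]
      exact add_nonneg h1.2 (mul_nonneg hρ.le h2)
    · filter_upwards [hstage x₀ r hr U, hD', hcle, e2] with ω h1 ⟨c, h2, h3, h4⟩ h5 h6
      rw [h4, h6, ENNReal.ofReal_add h1.2 (mul_nonneg hρ.le h2), ENNReal.ofReal_mul hρ.le, ← h1.1,
        ← h3, Pi.add_apply, Pi.smul_apply, smul_eq_mul]
      gcongr
    · intro hB
      have e3 := condLExp_congr_ae (mΩ := S.pastInfo n) (IsBayesRisk.ae_eq hB hW)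
      filter_upwards [hstage x₀ r hr U, hD', e3, e2] with ω h1 ⟨c, h2, h3, h4⟩ h5 h6
      rw [h4, h6, ENNReal.ofReal_add h1.2 (mul_nonneg hρ.le h2), ENNReal.ofReal_mul hρ.le, ← h1.1,
        ← h3, Pi.add_apply, Pi.smul_apply, smul_eq_mul, h5]
    · intro hr'
      refine IsBayesRisk.congr_ae hW (S.measurable_risk r U x₀ (n + 1)) ?_
      -- Equality at time `n` gives, after cancelling the finite stage cost and `ρ_n > 0`, equal
      -- conditional means of the Bayes risk and of the actual risk at `n + 1`.
      refine ae_eq_of_condLExp_ae_eq (S.pastInfo_le n) (S.measurable_risk r U x₀ (n + 1)) hle ?_ ?_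
      · filter_upwards [hstage x₀ r hr U, hD', hr', e2] with ω h1 ⟨c, h2, h3, h4⟩ h5 h6
        rw [h4, h6, ENNReal.ofReal_add h1.2 (mul_nonneg hρ.le h2), ENNReal.ofReal_mul hρ.le,
          ← h1.1, ← h3, Pi.add_apply, Pi.smul_apply, smul_eq_mul,
          ENNReal.add_right_inj (by rw [h1.1]; exact ENNReal.ofReal_ne_top),
          ENNReal.mul_right_inj (by simpa using hρ) ENNReal.ofReal_ne_top] at h5
        exact h5.symm
      · filter_upwards [hD'] with ω ⟨c, h2, h3, h4⟩
        rw [h3]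
        exact ENNReal.ofReal_lt_top
  -- At `n = M` the continuation probability vanishes, so the values of `A` and `B` at `M + 1` play
  -- no role and every policy is Bayes afterwards.
  · refine ⟨As, Bs, Cs, fun x₀ r hr U => ?_⟩
    have hcost : S.cost U x₀ S.M = S.stageCost U x₀ S.M := by
      funext ω
      rw [S.cost_eq hp hp_last le_rfl, continueProb_last, zero_mul, add_zero]
    have hstep (ω : S.Outcome) : S.stepCost A B As Bs Cs r U x₀ S.M ω (S.control U x₀ S.M ω)
        = quadForm As Bs Cs (S.state U x₀ S.M ω) (pad (S.scale r ω S.M))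
              + S.control U x₀ S.M ω ⬝ᵥ (S.k S.M *ᵥ S.control U x₀ S.M ω) := by
      simp only [stepCost, K, L, continueProb_last, zero_smul, neg_zero, dotProduct_zero, mul_zero,
        sub_zero, add_zero]
      ring
    have hrisk : ∀ᵐ ω ∂S.law r, S.risk r U x₀ S.M ω
        = ENNReal.ofReal (S.stepCost A B As Bs Cs r U x₀ S.M ω (S.control U x₀ S.M ω)) := by
      filter_upwards [hstage x₀ r hr U] with ω hω
      rw [S.risk_eq hc r U x₀ le_rfl, hcost, hstep]
      exact hω.1
    refine ⟨?_, hrisk.mono fun ω hω => hω.ge, fun _ => hrisk,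
      fun _ => S.isBayesPolicy_of_gt r U x₀ S.M.lt_succ_self⟩
    filter_upwards [hstage x₀ r hr U] with ω hω
    rw [hstep]
    exact hω.2

end ControlSystem

end BayesControl

end

/-! ### Singular quadratic minimization and regularized least squares -/

noncomputable section

namespace BayesControl

section LinearAlgebra

variable {m l : ℕ}

/-- A right inverse of the map onto its range, extended to the whole space. A fixed matrix is needed
so that the minimizer `G L` is linear in `L`, hence Borel, and the minimum quadratic. -/
theorem exists_generalized_inverse (K : Matrix (Fin m) (Fin m) ℝ) :
    ∃ G : Matrix (Fin m) (Fin m) ℝ, K * G * K = K := by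
  obtain ⟨g, hg⟩ := (Matrix.toLin' K).rangeRestrict.exists_rightInverse_of_surjective
    (LinearMap.range_rangeRestrict _)
  obtain ⟨g', hg'⟩ := g.exists_extend
  refine ⟨LinearMap.toMatrix' g', Matrix.toLin'.injective ?_⟩
  rw [Matrix.toLin'_mul, Matrix.toLin'_mul, Matrix.toLin'_toMatrix']
  ext1 x
  refine LinearMap.ext fun c => ?_
  have h3 := LinearMap.congr_fun hg' ((Matrix.toLin' K).rangeRestrict (Pi.single x c))
  have h4 := congrArg Subtype.val
    (LinearMap.congr_fun hg ((Matrix.toLin' K).rangeRestrict (Pi.single x c)))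
  change Matrix.toLin' K (g ((Matrix.toLin' K).rangeRestrict (Pi.single x c)))
    = Matrix.toLin' K (Pi.single x c) at h4
  change g' (Matrix.toLin' K (Pi.single x c)) = _ at h3
  change Matrix.toLin' K (g' (Matrix.toLin' K (Pi.single x c))) = Matrix.toLin' K (Pi.single x c)
  rw [h3, h4]

theorem isUnit_of_rank_eq {K : Matrix (Fin m) (Fin m) ℝ} (h : K.rank = m) : IsUnit K := by
  rw [← Matrix.mulVec_surjective_iff_isUnit]
  have : LinearMap.range K.mulVecLin = ⊤ := by
    apply Submodule.eq_top_of_finrank_eq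
    rw [Module.finrank_fin_fun]
    exact h
  exact LinearMap.range_eq_top.1 this

theorem dotProduct_self_nonneg' (v : Fin m → ℝ) : 0 ≤ v ⬝ᵥ v :=
  Finset.sum_nonneg fun _ _ => mul_self_nonneg _

theorem mulVec_dotProduct_self_le (A : Matrix (Fin l) (Fin m) ℝ) (v : Fin m → ℝ) :
    (A *ᵥ v) ⬝ᵥ (A *ᵥ v) ≤ ‖A‖ ^ 2 * (v ⬝ᵥ v) := by
  have h := Matrix.l2_opNorm_mulVec A (WithLp.toLp 2 v)
  have h2 := pow_le_pow_left₀ (norm_nonneg _) h 2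
  rw [mul_pow, EuclideanSpace.real_norm_sq_eq, EuclideanSpace.real_norm_sq_eq] at h2
  simp only [dotProduct, ← sq]
  exact h2

theorem two_mul_dotProduct_le (v w : Fin m → ℝ) : 2 * (v ⬝ᵥ w) ≤ v ⬝ᵥ v + w ⬝ᵥ w := by
  have := dotProduct_self_nonneg' (v - w)
  rw [sub_dotProduct, dotProduct_sub, dotProduct_sub, dotProduct_comm w v] at this
  linarith

variable {K G : Matrix (Fin m) (Fin m) ℝ} {L : Fin m → ℝ}

theorem posSemidef_of_quadratic_nonneg (hK : K.IsSymm) {g : ℝ}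
    (h : ∀ u : Fin m → ℝ, 0 ≤ u ⬝ᵥ (K *ᵥ u) - 2 * (u ⬝ᵥ L) + g) : K.PosSemidef := by
  refine Matrix.PosSemidef.of_dotProduct_mulVec_nonneg
    (by rw [Matrix.IsHermitian, Matrix.conjTranspose_eq_transpose_of_trivial, hK.eq]) fun u => ?_
  rw [star_trivial]
  have hg : 0 ≤ g := by simpa using h 0
  -- Nonnegativity on the line through `u` bounds the discriminant. Taking `g + 1` instead of `g`
  -- makes the constant coefficient strictly positive.
  have hd : discrim (u ⬝ᵥ (K *ᵥ u)) (-2 * (u ⬝ᵥ L)) (g + 1) ≤ 0 := by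
    refine discrim_le_zero fun t => ?_
    have := h (t • u)
    simp only [Matrix.mulVec_smul, dotProduct_smul, smul_dotProduct, smul_eq_mul] at this
    linarith
  unfold discrim at hd
  by_contra! hneg
  nlinarith [sq_nonneg (-2 * (u ⬝ᵥ L)), mul_pos (neg_pos.2 hneg) (by linarith : 0 < g + 1)]

/-- On `ker K` the function is affine and bounded below, so `L` is orthogonal to `ker K`. As `v - Gᵀ
K v` lies in `ker K` for every `v`, the vector `L - K G L` is orthogonal to everything. -/
theorem mulVec_generalized_inverse (hK : K.IsSymm) (hG : K * G * K = K) {g : ℝ}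
    (h : ∀ u : Fin m → ℝ, 0 ≤ u ⬝ᵥ (K *ᵥ u) - 2 * (u ⬝ᵥ L) + g) : K *ᵥ (G *ᵥ L) = L := by
  have hker : ∀ u : Fin m → ℝ, K *ᵥ u = 0 → u ⬝ᵥ L = 0 := fun u hu => by
    have hd : discrim 0 (-2 * (u ⬝ᵥ L)) g ≤ 0 := by
      refine discrim_le_zero fun t => ?_
      have := h (t • u)
      simp only [Matrix.mulVec_smul, dotProduct_smul, smul_dotProduct, smul_eq_mul, hu,
        dotProduct_zero, mul_zero] at this
      linarith
    unfold discrim at hd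
    nlinarith [sq_nonneg (u ⬝ᵥ L)]
  have hG' : K * Gᵀ * K = K := by
    have := congrArg Matrix.transpose hG
    rwa [Matrix.transpose_mul, Matrix.transpose_mul, hK.eq, ← mul_assoc] at this
  have h0 : ∀ v : Fin m → ℝ, v ⬝ᵥ (L - K *ᵥ (G *ᵥ L)) = 0 := fun v => by
    have h1 := hker (v - Gᵀ *ᵥ (K *ᵥ v)) (by
      rw [Matrix.mulVec_sub, Matrix.mulVec_mulVec, Matrix.mulVec_mulVec, hG', sub_self])
    rw [sub_dotProduct, dotProduct_comm (Gᵀ *ᵥ (K *ᵥ v)), dotProduct_mulVec_comm,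
      Matrix.transpose_transpose, dotProduct_comm (K *ᵥ v), dotProduct_mulVec_comm, hK.eq] at h1
    rw [dotProduct_sub, h1]
  have h2 := h0 (L - K *ᵥ (G *ᵥ L))
  rw [dotProduct_self_eq_zero] at h2
  exact (sub_eq_zero.1 h2).symm

theorem quadratic_sub_eq (hK : K.IsSymm) {v : Fin m → ℝ} (hv : K *ᵥ v = L) (u : Fin m → ℝ) :
    u ⬝ᵥ (K *ᵥ u) - 2 * (u ⬝ᵥ L)
      = v ⬝ᵥ (K *ᵥ v) - 2 * (v ⬝ᵥ L) + (u - v) ⬝ᵥ (K *ᵥ (u - v)) := by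
  have h : v ⬝ᵥ (K *ᵥ u) = u ⬝ᵥ L := by rw [dotProduct_mulVec_comm, hK.eq, hv]
  rw [Matrix.mulVec_sub, sub_dotProduct, dotProduct_sub, dotProduct_sub, hv, h]
  ring

/-- From `K = K G K` follows `δ·Kδ = Kδ·G(Kδ)`: the excess is controlled by the residual `Kδ` alone,
even if `δ` has a large component in `ker K`. -/
theorem excess_le (hK : K.IsSymm) (hG : K * G * K = K) (δ : Fin m → ℝ) :
    δ ⬝ᵥ (K *ᵥ δ) ≤ (1 + ‖G‖ ^ 2) * ((K *ᵥ δ) ⬝ᵥ (K *ᵥ δ)) := by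
  have h1 : δ ⬝ᵥ (K *ᵥ δ) = (K *ᵥ δ) ⬝ᵥ (G *ᵥ (K *ᵥ δ)) := by
    conv_lhs => rw [← hG]
    rw [mul_assoc, ← Matrix.mulVec_mulVec, dotProduct_mulVec_comm, hK.eq, dotProduct_comm,
      ← Matrix.mulVec_mulVec]
  have h2 := two_mul_dotProduct_le (K *ᵥ δ) (G *ᵥ (K *ᵥ δ))
  have h3 := mulVec_dotProduct_self_le G (K *ᵥ δ)
  have h4 := dotProduct_self_nonneg' (K *ᵥ δ)
  have h5 := mul_nonneg (sq_nonneg ‖G‖) h4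
  rw [h1]
  linarith

/-- Pythagoras: the normal equation at the minimizer cancels the cross terms. -/
theorem regularized_eq (E : Matrix (Fin l) (Fin m) ℝ) (hN : IsUnit (Kᵀ * K + Eᵀ * E))
    (L : Fin m → ℝ) (u : Fin m → ℝ) :
    (K *ᵥ u - L) ⬝ᵥ (K *ᵥ u - L) + (E *ᵥ u) ⬝ᵥ (E *ᵥ u)
      = (K *ᵥ ((Kᵀ * K + Eᵀ * E)⁻¹ *ᵥ (Kᵀ *ᵥ L)) - L) ⬝ᵥ
          (K *ᵥ ((Kᵀ * K + Eᵀ * E)⁻¹ *ᵥ (Kᵀ *ᵥ L)) - L)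
        + (E *ᵥ ((Kᵀ * K + Eᵀ * E)⁻¹ *ᵥ (Kᵀ *ᵥ L))) ⬝ᵥ
          (E *ᵥ ((Kᵀ * K + Eᵀ * E)⁻¹ *ᵥ (Kᵀ *ᵥ L)))
        + ((K *ᵥ (u - (Kᵀ * K + Eᵀ * E)⁻¹ *ᵥ (Kᵀ *ᵥ L))) ⬝ᵥ
            (K *ᵥ (u - (Kᵀ * K + Eᵀ * E)⁻¹ *ᵥ (Kᵀ *ᵥ L)))
          + (E *ᵥ (u - (Kᵀ * K + Eᵀ * E)⁻¹ *ᵥ (Kᵀ *ᵥ L))) ⬝ᵥ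
            (E *ᵥ (u - (Kᵀ * K + Eᵀ * E)⁻¹ *ᵥ (Kᵀ *ᵥ L)))) := by
  set v := (Kᵀ * K + Eᵀ * E)⁻¹ *ᵥ (Kᵀ *ᵥ L) with hv
  have hNv : (Kᵀ * K + Eᵀ * E) *ᵥ v = Kᵀ *ᵥ L := by
    rw [hv, Matrix.mulVec_mulVec, Matrix.mul_nonsing_inv _ ((Matrix.isUnit_iff_isUnit_det _).1 hN),
      Matrix.one_mulVec]
  obtain ⟨δ, rfl⟩ : ∃ δ, u = v + δ := ⟨u - v, by abel⟩
  have h1 : (K *ᵥ δ) ⬝ᵥ (K *ᵥ v) + (E *ᵥ δ) ⬝ᵥ (E *ᵥ v) = (K *ᵥ δ) ⬝ᵥ L := by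
    have := congrArg (δ ⬝ᵥ ·) hNv
    simp only [Matrix.add_mulVec, dotProduct_add, ← Matrix.mulVec_mulVec] at this
    rw [dotProduct_mulVec_comm, dotProduct_mulVec_comm Eᵀ, dotProduct_mulVec_comm Kᵀ,
      Matrix.transpose_transpose, Matrix.transpose_transpose] at this
    rw [dotProduct_comm _ (K *ᵥ v), dotProduct_comm _ (E *ᵥ v), dotProduct_comm _ L]
    exact this
  rw [add_sub_cancel_left, Matrix.mulVec_add, Matrix.mulVec_add]
  simp only [add_dotProduct, sub_dotProduct, dotProduct_add, dotProduct_sub]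
  rw [dotProduct_comm (K *ᵥ v) (K *ᵥ δ), dotProduct_comm (E *ᵥ v) (E *ᵥ δ),
    dotProduct_comm L (K *ᵥ δ)]
  linarith

theorem regularized_lt (E : Matrix (Fin l) (Fin m) ℝ) (hN : IsUnit (Kᵀ * K + Eᵀ * E))
    (L : Fin m → ℝ) {u : Fin m → ℝ} (hu : u ≠ (Kᵀ * K + Eᵀ * E)⁻¹ *ᵥ (Kᵀ *ᵥ L)) :
    (K *ᵥ ((Kᵀ * K + Eᵀ * E)⁻¹ *ᵥ (Kᵀ *ᵥ L)) - L) ⬝ᵥ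
          (K *ᵥ ((Kᵀ * K + Eᵀ * E)⁻¹ *ᵥ (Kᵀ *ᵥ L)) - L)
        + (E *ᵥ ((Kᵀ * K + Eᵀ * E)⁻¹ *ᵥ (Kᵀ *ᵥ L))) ⬝ᵥ
          (E *ᵥ ((Kᵀ * K + Eᵀ * E)⁻¹ *ᵥ (Kᵀ *ᵥ L)))
      < (K *ᵥ u - L) ⬝ᵥ (K *ᵥ u - L) + (E *ᵥ u) ⬝ᵥ (E *ᵥ u) := by
  rw [regularized_eq E hN L u]
  refine lt_add_of_pos_right _ ?_
  set δ := u - (Kᵀ * K + Eᵀ * E)⁻¹ *ᵥ (Kᵀ *ᵥ L) with hδ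
  have h1 := dotProduct_self_nonneg' (K *ᵥ δ)
  have h2 := dotProduct_self_nonneg' (E *ᵥ δ)
  refine (add_nonneg h1 h2).lt_of_ne fun h0 => hu ?_
  have e1 : K *ᵥ δ = 0 := dotProduct_self_eq_zero.1 (by linarith)
  have e2 : E *ᵥ δ = 0 := dotProduct_self_eq_zero.1 (by linarith)
  have e3 : (Kᵀ * K + Eᵀ * E) *ᵥ δ = (Kᵀ * K + Eᵀ * E) *ᵥ 0 := by
    rw [Matrix.add_mulVec, ← Matrix.mulVec_mulVec, ← Matrix.mulVec_mulVec, e1, e2]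
    simp
  exact sub_eq_zero.1 (Matrix.mulVec_injective_of_isUnit hN e3)

/-- The competitor `G L` has zero residual and penalty `‖E G L‖²`, which bounds the minimum of the
regularized functional. The bound does not involve the inverse of `Kᵀ K + Eᵀ E`. -/
theorem regularized_residual_le (hv : K *ᵥ (G *ᵥ L) = L) (E : Matrix (Fin l) (Fin m) ℝ)
    (hN : IsUnit (Kᵀ * K + Eᵀ * E)) :
    (K *ᵥ ((Kᵀ * K + Eᵀ * E)⁻¹ *ᵥ (Kᵀ *ᵥ L)) - L) ⬝ᵥ
        (K *ᵥ ((Kᵀ * K + Eᵀ * E)⁻¹ *ᵥ (Kᵀ *ᵥ L)) - L) ≤ ‖G‖ ^ 2 * ‖E‖ ^ 2 * (L ⬝ᵥ L) := by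
  have h := regularized_eq E hN L (G *ᵥ L)
  rw [hv, sub_self, dotProduct_zero, zero_add] at h
  set v := (Kᵀ * K + Eᵀ * E)⁻¹ *ᵥ (Kᵀ *ᵥ L)
  have h1 := dotProduct_self_nonneg' (K *ᵥ (G *ᵥ L - v))
  have h2 := dotProduct_self_nonneg' (E *ᵥ (G *ᵥ L - v))
  have h3 := dotProduct_self_nonneg' (E *ᵥ v)
  have h4 := mulVec_dotProduct_self_le E (G *ᵥ L)
  have h5 := mul_le_mul_of_nonneg_left (mulVec_dotProduct_self_le G L) (sq_nonneg ‖E‖)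
  linarith

end LinearAlgebra

end BayesControl

end

/-! ### The optimal control in one step -/

noncomputable section

namespace BayesControl

variable {m d : ℕ}

namespace ControlSystem

variable (S : ControlSystem m d)

theorem control_congr {n : ℕ} {U V : Policy m} (h : V.AgreeBefore (n + 1) U) (x₀ : Fin m → ℝ) :
    S.control V x₀ n = S.control U x₀ n := by
  funext ω
  rw [control, control, S.history_congr (fun j hj => h j (hj.trans n.lt_succ_self)),
    h n n.lt_succ_self]

/-- The function `stepCost` is the conditional mean of the cost when the later controls are Bayes
controls, and a lower bound for it otherwise. -/
def IsStepCost (A B : ℕ → Matrix (Fin m) (Fin m) ℝ) (A' B' C' : Matrix (Fin m) (Fin m) ℝ)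
    (n : ℕ) : Prop :=
  ∀ (x₀ : Fin m → ℝ) (r : Fin d → ℝ), (∀ i, 0 < r i) → ∀ U : Policy m,
    (∀ᵐ ω ∂S.law r, 0 ≤ S.stepCost A B A' B' C' r U x₀ n ω (S.control U x₀ n ω)) ∧
    (∀ᵐ ω ∂S.law r, ENNReal.ofReal (S.stepCost A B A' B' C' r U x₀ n ω (S.control U x₀ n ω))
      ≤ S.risk r U x₀ n ω) ∧
    (S.IsBayesPolicy r U x₀ (n + 1) ↔ ∀ᵐ ω ∂S.law r, S.risk r U x₀ n ω
      = ENNReal.ofReal (S.stepCost A B A' B' C' r U x₀ n ω (S.control U x₀ n ω)))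

/-- Any past controls can be continued by Bayes controls from time `n` on. -/
def HasBayesPolicy (n : ℕ) : Prop :=
  ∀ (x₀ : Fin m → ℝ) (r : Fin d → ℝ), (∀ i, 0 < r i) → ∀ U : Policy m,
    ∃ V : Policy m, V.AgreeBefore n U ∧ S.IsBayesPolicy r V x₀ n

variable {S} {A B : ℕ → Matrix (Fin m) (Fin m) ℝ} {A' B' C' G : Matrix (Fin m) (Fin m) ℝ}
  {r : Fin d → ℝ} {U V : Policy m} {x₀ : Fin m → ℝ} {n : ℕ}

theorem L_congr (h : V.AgreeBefore n U) : S.L A B r V x₀ n = S.L A B r U x₀ n := by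
  funext ω
  rw [L, L, S.state_congr h]

theorem stepCost_congr (h : V.AgreeBefore n U) :
    S.stepCost A B A' B' C' r V x₀ n = S.stepCost A B A' B' C' r U x₀ n := by
  funext ω u
  rw [stepCost, stepCost, S.state_congr h, L_congr h]

theorem L_eq_add : S.L A B r U x₀ n = fun ω =>
    (-(S.continueProb n • ((S.b n)ᵀ * A (n + 1) * S.α n))) *ᵥ S.state U x₀ n ω
      + (-(S.continueProb n • ((S.b n)ᵀ * (A (n + 1) * S.c n * S.Q n + (B (n + 1))ᵀ * S.Q₂ n))))
        *ᵥ pad (S.scale r ω n) := by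
  funext ω
  simp only [L, Matrix.neg_mulVec, Matrix.smul_mulVec, Matrix.mulVec_add, ← Matrix.mulVec_mulVec,
    smul_add, neg_add]

theorem measurable_L (A B : ℕ → Matrix (Fin m) (Fin m) ℝ) (r : Fin d → ℝ) (U : Policy m)
    (x₀ : Fin m → ℝ) (n : ℕ) : Measurable[S.pastInfo n] (S.L A B r U x₀ n) := by
  rw [L_eq_add]
  exact ((measurable_mulVec _).comp (S.measurable_state U x₀ n)).add
    ((measurable_mulVec _).comp (measurable_pad.comp (S.measurable_scale r n)))

theorem K_isSymm (hk : ∀ j ≤ S.M, (S.k j).PosSemidef) (hn : n ≤ S.M)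
    (hA : n < S.M → (A (n + 1)).IsSymm) : (S.K A n).IsSymm := by
  have h1 : (S.k n).IsSymm := by
    have := (hk n hn).isHermitian.eq
    rwa [Matrix.conjTranspose_eq_transpose_of_trivial] at this
  rcases hn.lt_or_eq with h | rfl
  · rw [Matrix.IsSymm, K, Matrix.transpose_add, h1.eq, Matrix.transpose_smul,
      Matrix.transpose_mul, Matrix.transpose_mul, (hA h).eq, Matrix.transpose_transpose, mul_assoc]
  · rwa [K, continueProb_last, zero_smul, add_zero]

/-- For each constant control the exceptional null set may differ; a countable dense set of controls
and continuity in `u` give a common one. -/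
theorem IsStepCost.ae_forall_nonneg (h : S.IsStepCost A B A' B' C' n)
    (hc : ∀ j < S.M, ∀ z : Fin d → ℝ, S.c j *ᵥ pad z = 0 → z = 0) (hn : n ≤ S.M)
    (hr : ∀ i, 0 < r i) (U : Policy m) (x₀ : Fin m → ℝ) :
    ∀ᵐ ω ∂S.law r, ∀ u, 0 ≤ S.stepCost A B A' B' C' r U x₀ n ω u := by
  have h1 : ∀ᵐ ω ∂S.law r, ∀ k, 0 ≤ S.stepCost A B A' B' C' r U x₀ n ω
      (TopologicalSpace.denseSeq (Fin m → ℝ) k) := ae_all_iff.2 fun k => by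
    obtain ⟨V, hV, hg⟩ := S.exists_policy_control hc U x₀ hn
      (measurable_const (a := TopologicalSpace.denseSeq (Fin m → ℝ) k))
    have h2 := (h x₀ r hr V).1
    rwa [stepCost_congr hV, hg] at h2
  filter_upwards [h1] with ω hω u
  refine (TopologicalSpace.denseRange_denseSeq (Fin m → ℝ)).induction_on
    (p := fun u => 0 ≤ S.stepCost A B A' B' C' r U x₀ n ω u) u ?_ hω
  refine isClosed_le continuous_const ?_
  unfold stepCost dotProduct Matrix.mulVec dotProduct
  fun_prop

theorem IsStepCost.posSemidef_K (h : S.IsStepCost A B A' B' C' n) (hβ : ∀ i, 0 < S.β i)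
    (hc : ∀ j < S.M, ∀ z : Fin d → ℝ, S.c j *ᵥ pad z = 0 → z = 0) (hn : n ≤ S.M)
    (hK : (S.K A n).IsSymm) : (S.K A n).PosSemidef := by
  -- `K` is deterministic, so a single outcome of a single instance of the problem suffices.
  have := S.isProbabilityMeasure_law (r := fun _ => 1) (fun _ => one_pos) hβ
  obtain ⟨ω, hω⟩ := (h.ae_forall_nonneg hc hn (fun _ => one_pos)
    ⟨fun _ _ => 0, fun _ => measurable_const⟩ 0).exists
  exact posSemidef_of_quadratic_nonneg hK hω

theorem IsStepCost.ae_mulVec_eq (h : S.IsStepCost A B A' B' C' n)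
    (hc : ∀ j < S.M, ∀ z : Fin d → ℝ, S.c j *ᵥ pad z = 0 → z = 0) (hn : n ≤ S.M)
    (hK : (S.K A n).IsSymm) (hG : S.K A n * G * S.K A n = S.K A n)
    (hr : ∀ i, 0 < r i) (U : Policy m) (x₀ : Fin m → ℝ) :
    ∀ᵐ ω ∂S.law r, S.K A n *ᵥ (G *ᵥ S.L A B r U x₀ n ω) = S.L A B r U x₀ n ω := by
  filter_upwards [h.ae_forall_nonneg hc hn hr U x₀] with ω hω
  exact mulVec_generalized_inverse hK hG hω

theorem stepCost_sub_eq (hK : (S.K A n).IsSymm) {ω : S.Outcome} {v : Fin m → ℝ}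
    (hv : S.K A n *ᵥ v = S.L A B r U x₀ n ω) (u : Fin m → ℝ) :
    S.stepCost A B A' B' C' r U x₀ n ω u = S.stepCost A B A' B' C' r U x₀ n ω v
      + (u - v) ⬝ᵥ (S.K A n *ᵥ (u - v)) := by
  rw [stepCost, quadratic_sub_eq hK hv u, stepCost]
  ring

theorem HasBayesPolicy.exists_control (h : S.HasBayesPolicy (n + 1))
    (hc : ∀ j < S.M, ∀ z : Fin d → ℝ, S.c j *ᵥ pad z = 0 → z = 0) (hn : n ≤ S.M)
    (hr : ∀ i, 0 < r i) (U : Policy m) (x₀ : Fin m → ℝ) {g : S.Outcome → Fin m → ℝ}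
    (hg : Measurable[S.pastInfo n] g) :
    ∃ V : Policy m, V.AgreeBefore n U ∧ S.control V x₀ n = g ∧ S.IsBayesPolicy r V x₀ (n + 1) := by
  obtain ⟨V₀, hV₀, hg₀⟩ := S.exists_policy_control hc U x₀ hn hg
  obtain ⟨V, hV, hB⟩ := h x₀ r hr V₀
  exact ⟨V, fun j hj => (hV j (hj.trans n.lt_succ_self)).trans (hV₀ j hj),
    (S.control_congr hV x₀).trans hg₀, hB⟩

theorem measurable_stepCost {g : S.Outcome → Fin m → ℝ} (hg : Measurable[S.pastInfo n] g)
    (r : Fin d → ℝ) (U : Policy m) (x₀ : Fin m → ℝ) :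
    Measurable fun ω => S.stepCost A B A' B' C' r U x₀ n ω (g ω) := by
  have h1 := hg.mono (S.pastInfo_le n) le_rfl
  have h2 := (S.measurable_L A B r U x₀ n).mono (S.pastInfo_le n) le_rfl
  have h3 := (S.measurable_state U x₀ n).mono (S.pastInfo_le n) le_rfl
  have h4 := (S.measurable_scale r n).mono (S.pastInfo_le n) le_rfl
  refine Measurable.add (Measurable.sub ((measurable_dotProduct_mulVec _).comp h1)
    (Measurable.const_mul ?_ _))
    ((measurable_quadForm A' B' C').comp (h3.prodMk (measurable_pad.comp h4)))
  simp only [dotProduct]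
  fun_prop

/-- The value at `G L` is a lower bound for all risks, by completing the square, and is attained by
applying `G L` and then continuing with a Bayes policy. -/
theorem IsStepCost.isBayesRisk (h : S.IsStepCost A B A' B' C' n) (hβ : ∀ i, 0 < S.β i)
    (hc : ∀ j < S.M, ∀ z : Fin d → ℝ, S.c j *ᵥ pad z = 0 → z = 0) (hn : n ≤ S.M)
    (hB : S.HasBayesPolicy (n + 1))
    (hK : (S.K A n).IsSymm) (hG : S.K A n * G * S.K A n = S.K A n)
    (hr : ∀ i, 0 < r i) (U : Policy m) (x₀ : Fin m → ℝ) :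
    S.IsBayesRisk r U x₀ n (fun ω => ENNReal.ofReal
      (S.stepCost A B A' B' C' r U x₀ n ω (G *ᵥ S.L A B r U x₀ n ω))) ∧
    ∃ V : Policy m, V.AgreeBefore n U ∧ S.IsBayesPolicy r V x₀ n := by
  have hg : Measurable[S.pastInfo n] fun ω => G *ᵥ S.L A B r U x₀ n ω :=
    (measurable_mulVec G).comp (measurable_L A B r U x₀ n)
  obtain ⟨V, hV, hVc, hVB⟩ := hB.exists_control hc hn hr U x₀ hg
  have hm := (measurable_stepCost (A := A) (B := B) (A' := A') (B' := B') (C' := C') hg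
    r U x₀).ennreal_ofReal
  have hrisk : S.risk r V x₀ n =ᵐ[S.law r] fun ω => ENNReal.ofReal
      (S.stepCost A B A' B' C' r U x₀ n ω (G *ᵥ S.L A B r U x₀ n ω)) := by
    have h1 := (h x₀ r hr V).2.2.1 hVB
    rwa [stepCost_congr hV, hVc] at h1
  have hbayes : S.IsBayesRisk r U x₀ n (fun ω => ENNReal.ofReal
      (S.stepCost A B A' B' C' r U x₀ n ω (G *ᵥ S.L A B r U x₀ n ω))) := by
    refine ⟨hm, fun U' hU' => ?_, fun W _ hle => (hle V hV).trans hrisk.le⟩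
    have h1 := (h x₀ r hr U').2.1
    rw [stepCost_congr hU'] at h1
    filter_upwards [h1, h.ae_mulVec_eq hc hn hK hG hr U x₀] with ω h1 h2
    refine le_trans (ENNReal.ofReal_le_ofReal ?_) h1
    rw [stepCost_sub_eq hK h2 (S.control U' x₀ n ω)]
    have := (h.posSemidef_K hβ hc hn hK).dotProduct_mulVec_nonneg
      (S.control U' x₀ n ω - G *ᵥ S.L A B r U x₀ n ω)
    rw [star_trivial] at this
    linarith
  exact ⟨hbayes, V, hV, (S.isBayesRisk_congr_policy hbayes hV).congr_ae
    (S.measurable_risk r V x₀ n) hrisk.symm⟩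

theorem IsStepCost.exists_hasRiskForm (h : S.IsStepCost A B A' B' C' n) (hβ : ∀ i, 0 < S.β i)
    (hc : ∀ j < S.M, ∀ z : Fin d → ℝ, S.c j *ᵥ pad z = 0 → z = 0) (hn : n ≤ S.M)
    (hB : S.HasBayesPolicy (n + 1)) (hK : (S.K A n).IsSymm) :
    ∃ a b c : Matrix (Fin m) (Fin m) ℝ,
      S.HasRiskForm (fun _ => a) (fun _ => b) (fun _ => c) n := by
  obtain ⟨G, hG⟩ := exists_generalized_inverse (S.K A n)
  -- `L = L₁ x + L₂ r̄`. As `K G L = L`, the minimum equals the `u`-free part minus `G L · L`, and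
  -- expanding the latter gives the coefficients below; the quadratic part in `x` is symmetrized.
  set L₁ := -(S.continueProb n • ((S.b n)ᵀ * A (n + 1) * S.α n)) with hL₁
  set L₂ := -(S.continueProb n •
    ((S.b n)ᵀ * (A (n + 1) * S.c n * S.Q n + (B (n + 1))ᵀ * S.Q₂ n))) with hL₂
  set D := A' - L₁ᵀ * G * L₁ with hD
  refine ⟨(2⁻¹ : ℝ) • (D + Dᵀ), B' - (2⁻¹ : ℝ) • (L₂ᵀ * G * L₁ + (L₁ᵀ * G * L₂)ᵀ),
    C' - (2⁻¹ : ℝ) • (L₂ᵀ * G * L₂), ?_, fun x₀ r hr U => ?_⟩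
  · rw [Matrix.IsSymm, Matrix.transpose_smul, Matrix.transpose_add, Matrix.transpose_transpose,
      add_comm]
  have key : ∀ᵐ ω ∂S.law r, S.stepCost A B A' B' C' r U x₀ n ω (G *ᵥ S.L A B r U x₀ n ω)
      = S.riskForm (fun _ => (2⁻¹ : ℝ) • (D + Dᵀ))
        (fun _ => B' - (2⁻¹ : ℝ) • (L₂ᵀ * G * L₁ + (L₁ᵀ * G * L₂)ᵀ))
        (fun _ => C' - (2⁻¹ : ℝ) • (L₂ᵀ * G * L₂)) r U x₀ n ω := by
    filter_upwards [h.ae_mulVec_eq hc hn hK hG hr U x₀] with ω hω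
    rw [stepCost, hω, riskForm_eq]
    have hL := congrFun (L_eq_add (S := S) (A := A) (B := B) (r := r) (U := U) (x₀ := x₀) (n := n)) ω
    simp only [← hL₁, ← hL₂] at hL
    set x := S.state U x₀ n ω
    set t : Fin m → ℝ := pad (S.scale r ω n)
    have e1 : ∀ (M : Matrix (Fin m) (Fin m) ℝ) (y z : Fin m → ℝ),
        y ⬝ᵥ (Mᵀ *ᵥ z) = z ⬝ᵥ (M *ᵥ y) := fun M y z => (dotProduct_mulVec_comm M z y).symm
    have e2 : ∀ (P R : Matrix (Fin m) (Fin m) ℝ) (y z : Fin m → ℝ),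
        y ⬝ᵥ ((Pᵀ * G * R) *ᵥ z) = (G *ᵥ (R *ᵥ z)) ⬝ᵥ (P *ᵥ y) := fun P R y z => by
      rw [mul_assoc, ← Matrix.mulVec_mulVec, e1, ← Matrix.mulVec_mulVec]
    rw [hL]
    simp only [quadForm, hD, Matrix.sub_mulVec, Matrix.add_mulVec, Matrix.smul_mulVec,
      dotProduct_sub, dotProduct_add, dotProduct_smul, smul_eq_mul, Matrix.mulVec_add,
      add_dotProduct, Matrix.transpose_sub, e1, e2]
    ring
  obtain ⟨hbayes, -⟩ := h.isBayesRisk hβ hc hn hB hK hG hr U x₀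
  refine ⟨?_, ?_⟩
  · filter_upwards [key, h.ae_forall_nonneg hc hn hr U x₀] with ω h1 h2
    rw [← h1]; exact h2 _
  · refine hbayes.congr_ae ?_ ?_
    · have h3 := (S.measurable_state U x₀ n).mono (S.pastInfo_le n) le_rfl
      have h4 := (S.measurable_scale r n).mono (S.pastInfo_le n) le_rfl
      exact ((measurable_quadForm _ _ _).comp (h3.prodMk (measurable_pad.comp h4))).ennreal_ofReal
    · filter_upwards [key] with ω h1
      rw [h1]

end ControlSystem

end BayesControl

end

/-! ### Backward recursion and properties of Bayes policies -/

noncomputable section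

namespace BayesControl

variable {m d : ℕ}

namespace ControlSystem

variable {S : ControlSystem m d} {A B C : ℕ → Matrix (Fin m) (Fin m) ℝ}
  {A' B' C' G : Matrix (Fin m) (Fin m) ℝ}
  {r : Fin d → ℝ} {U V : Policy m} {x₀ : Fin m → ℝ} {n : ℕ}

theorem exists_hasRiskForm (hβ : ∀ i, 2 < S.β i)
    (hp : ∀ j ≤ S.M, 0 ≤ S.p j) (hp_last : S.p S.M ≠ 0)
    (hk : ∀ j ≤ S.M, (S.k j).PosSemidef)
    (hs : ∀ j ≤ S.M, ∀ y : Fin m ⊕ Fin m → ℝ, 0 ≤ y ⬝ᵥ (S.s j *ᵥ y))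
    (hc : ∀ j < S.M, ∀ z : Fin d → ℝ, S.c j *ᵥ pad z = 0 → z = 0) (hn : n ≤ S.M) :
    (∃ a b c : Matrix (Fin m) (Fin m) ℝ,
      S.HasRiskForm (fun _ => a) (fun _ => b) (fun _ => c) n) ∧ S.HasBayesPolicy n := by
  have hβ0 : ∀ i, 0 < S.β i := fun i => two_pos.trans (hβ i)
  have main : ∀ (A B C : ℕ → Matrix (Fin m) (Fin m) ℝ) (n : ℕ), n ≤ S.M →
      (n < S.M → S.HasRiskForm A B C (n + 1)) → S.HasBayesPolicy (n + 1) →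
      (∃ a b c : Matrix (Fin m) (Fin m) ℝ,
        S.HasRiskForm (fun _ => a) (fun _ => b) (fun _ => c) n) ∧ S.HasBayesPolicy n := by
    intro A B C n hn hABC hB
    obtain ⟨A', B', C', h⟩ := S.exists_stepCost hβ hp hp_last hk hs hc hn A B C hABC
    have h : S.IsStepCost A B A' B' C' n := h
    have hK := K_isSymm hk hn fun hlt => (hABC hlt).1
    obtain ⟨G, hG⟩ := exists_generalized_inverse (S.K A n)
    exact ⟨h.exists_hasRiskForm hβ0 hc hn hB hK,
      fun x₀ r hr U => (h.isBayesRisk hβ0 hc hn hB hK hG hr U x₀).2⟩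
  induction hn using Nat.decreasingInduction with
  | self =>
    -- The coefficients at `M + 1` are immaterial, so zero matrices start the recursion.
    exact main 0 0 0 S.M le_rfl (fun h => absurd h (lt_irrefl _)) fun x₀ r _ U =>
      ⟨U, fun _ _ => rfl, S.isBayesPolicy_of_gt r U x₀ (Nat.lt_succ_self _)⟩
  | of_succ k hk' ih =>
    obtain ⟨⟨a, b, c, h⟩, hB⟩ := ih
    exact main (fun _ => a) (fun _ => b) (fun _ => c) k hk'.le (fun _ => h) hB

theorem exists_isRiskCoefficients (hβ : ∀ i, 2 < S.β i)
    (hp : ∀ j ≤ S.M, 0 ≤ S.p j) (hp_last : S.p S.M ≠ 0)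
    (hk : ∀ j ≤ S.M, (S.k j).PosSemidef)
    (hs : ∀ j ≤ S.M, ∀ y : Fin m ⊕ Fin m → ℝ, 0 ≤ y ⬝ᵥ (S.s j *ᵥ y))
    (hc : ∀ j < S.M, ∀ z : Fin d → ℝ, S.c j *ᵥ pad z = 0 → z = 0) :
    ∃ A B C : ℕ → Matrix (Fin m) (Fin m) ℝ, S.IsRiskCoefficients A B C := by
  have h : ∀ n, ∃ a b c : Matrix (Fin m) (Fin m) ℝ, n ≤ S.M →
      S.HasRiskForm (fun _ => a) (fun _ => b) (fun _ => c) n := fun n => by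
    by_cases hn : n ≤ S.M
    · obtain ⟨a, b, c, h⟩ := (exists_hasRiskForm hβ hp hp_last hk hs hc hn).1
      exact ⟨a, b, c, fun _ => h⟩
    · exact ⟨0, 0, 0, fun h => absurd h hn⟩
  choose A B C h using h
  exact ⟨A, B, C, fun n hn => h n hn⟩

/-- The given coefficients need not be those built by the recursion; the Bellman equation only needs
that they represent the Bayes risk at `n + 1`. -/
theorem IsRiskCoefficients.exists_isStepCost (h : S.IsRiskCoefficients A B C)
    (hβ : ∀ i, 2 < S.β i) (hp : ∀ j ≤ S.M, 0 ≤ S.p j) (hp_last : S.p S.M ≠ 0)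
    (hk : ∀ j ≤ S.M, (S.k j).PosSemidef)
    (hs : ∀ j ≤ S.M, ∀ y : Fin m ⊕ Fin m → ℝ, 0 ≤ y ⬝ᵥ (S.s j *ᵥ y))
    (hc : ∀ j < S.M, ∀ z : Fin d → ℝ, S.c j *ᵥ pad z = 0 → z = 0) (hn : n ≤ S.M) :
    (∃ A' B' C', S.IsStepCost A B A' B' C' n) ∧ S.HasBayesPolicy (n + 1) ∧ (S.K A n).IsSymm := by
  refine ⟨S.exists_stepCost hβ hp hp_last hk hs hc hn A B C fun hlt => h (n + 1) hlt, ?_,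
    K_isSymm hk hn fun hlt => (h (n + 1) hlt).1⟩
  rcases hn.lt_or_eq with hlt | rfl
  · exact (exists_hasRiskForm hβ hp hp_last hk hs hc hlt).2
  · exact fun x₀ r _ U =>
      ⟨U, fun _ _ => rfl, S.isBayesPolicy_of_gt r U x₀ (Nat.lt_succ_self _)⟩

/-- A Bayes policy remains a Bayes policy after one step, and its control solves the normal
equation. -/
theorem IsStepCost.of_isBayesPolicy (h : S.IsStepCost A B A' B' C' n) (hβ : ∀ i, 0 < S.β i)
    (hc : ∀ j < S.M, ∀ z : Fin d → ℝ, S.c j *ᵥ pad z = 0 → z = 0) (hn : n ≤ S.M)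
    (hB : S.HasBayesPolicy (n + 1)) (hK : (S.K A n).IsSymm)
    (hr : ∀ i, 0 < r i) (hU : S.IsBayesPolicy r U x₀ n) :
    S.IsBayesPolicy r U x₀ (n + 1) ∧
      ∀ᵐ ω ∂S.law r, S.K A n *ᵥ S.control U x₀ n ω = S.L A B r U x₀ n ω := by
  obtain ⟨G, hG⟩ := exists_generalized_inverse (S.K A n)
  have hpsd := h.posSemidef_K hβ hc hn hK
  have key : ∀ᵐ ω ∂S.law r, S.risk r U x₀ n ω
      = ENNReal.ofReal (S.stepCost A B A' B' C' r U x₀ n ω (S.control U x₀ n ω)) ∧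
      S.K A n *ᵥ S.control U x₀ n ω = S.L A B r U x₀ n ω := by
    filter_upwards [hU.ae_eq (h.isBayesRisk hβ hc hn hB hK hG hr U x₀).1, (h x₀ r hr U).2.1,
      h.ae_mulVec_eq hc hn hK hG hr U x₀, h.ae_forall_nonneg hc hn hr U x₀] with ω h1 h2 h3 h4
    set v := G *ᵥ S.L A B r U x₀ n ω
    have h5 := stepCost_sub_eq (A' := A') (B' := B') (C' := C') hK h3 (S.control U x₀ n ω)
    have h6 := hpsd.dotProduct_mulVec_nonneg (S.control U x₀ n ω - v)
    rw [star_trivial] at h6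
    -- The risk dominates the step cost at the applied control, which dominates the minimum, which
    -- is the risk again. Hence the excess vanishes, and a null vector of a positive semidefinite
    -- form lies in its kernel.
    have h7 := (ENNReal.ofReal_le_ofReal_iff (h4 v)).1 (h2.trans h1.le)
    have h8 : (S.control U x₀ n ω - v) ⬝ᵥ (S.K A n *ᵥ (S.control U x₀ n ω - v)) = 0 := by linarith
    have h9 := (hpsd.dotProduct_mulVec_zero_iff (S.control U x₀ n ω - v)).1
      (by rwa [star_trivial])
    refine ⟨?_, ?_⟩
    · rw [h1, h5, h8, add_zero]
    · rw [Matrix.mulVec_sub, sub_eq_zero] at h9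
      rw [h9, h3]
  exact ⟨(h x₀ r hr U).2.2.2 (key.mono fun _ h => h.1), key.mono fun _ h => h.2⟩

/-- With a Bayes continuation the excess over the Bayes risk is exactly the quadratic excess at time
`n`, which `excess_le` bounds by the residual. -/
theorem IsStepCost.risk_le (h : S.IsStepCost A B A' B' C' n) (hβ : ∀ i, 0 < S.β i)
    (hc : ∀ j < S.M, ∀ z : Fin d → ℝ, S.c j *ᵥ pad z = 0 → z = 0) (hn : n ≤ S.M)
    (hB : S.HasBayesPolicy (n + 1)) (hK : (S.K A n).IsSymm)
    (hG : S.K A n * G * S.K A n = S.K A n) (hr : ∀ i, 0 < r i) (hV : V.AgreeBefore n U)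
    (hVB : S.IsBayesPolicy r V x₀ (n + 1)) {W : S.Outcome → ℝ≥0∞} (hW : S.IsBayesRisk r U x₀ n W) :
    ∀ᵐ ω ∂S.law r, S.risk r V x₀ n ω ≤ W ω + ENNReal.ofReal ((1 + ‖G‖ ^ 2) *
      ((S.K A n *ᵥ S.control V x₀ n ω - S.L A B r U x₀ n ω) ⬝ᵥ
        (S.K A n *ᵥ S.control V x₀ n ω - S.L A B r U x₀ n ω))) := by
  have h0 := (h x₀ r hr V).2.2.1 hVB
  rw [stepCost_congr hV] at h0
  filter_upwards [h0, hW.ae_eq (h.isBayesRisk hβ hc hn hB hK hG hr U x₀).1,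
    h.ae_mulVec_eq hc hn hK hG hr U x₀] with ω h1 h2 h3
  rw [h1, h2, stepCost_sub_eq hK h3]
  refine ENNReal.ofReal_add_le.trans (add_le_add_right (ENNReal.ofReal_le_ofReal ?_) _)
  refine (excess_le hK hG _).trans_eq ?_
  rw [Matrix.mulVec_sub, h3]

end ControlSystem

end BayesControl

end

/-! ### The main theorem -/

theorem theorem3p2 {m d : ℕ} (hd : d ≤ m) (S : BayesControl.ControlSystem m d)
    (hβ : ∀ i, 2 < S.β i)
    (hp : ∀ j ≤ S.M, 0 ≤ S.p j) (hp_sum : ∑ j ∈ Finset.range (S.M + 1), S.p j = 1)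
    (hp_last : S.p S.M ≠ 0)
    (hk : ∀ j ≤ S.M, (S.k j).PosSemidef)
    (hs : ∀ j ≤ S.M, ∀ y : Fin m ⊕ Fin m → ℝ, 0 ≤ y ⬝ᵥ (S.s j *ᵥ y))
    (hc : ∀ j < S.M, ∀ z : Fin d → ℝ, S.c j *ᵥ BayesControl.pad z = 0 → z = 0) :
    (∃ A B C : ℕ → Matrix (Fin m) (Fin m) ℝ, S.IsRiskCoefficients A B C) ∧
    ∀ A B C : ℕ → Matrix (Fin m) (Fin m) ℝ, S.IsRiskCoefficients A B C → ∀ n ≤ S.M,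
      -- (a) full rank
      ((S.K A n).rank = m →
        ∀ (x₀ : Fin m → ℝ) (r : Fin d → ℝ), (∀ i, 0 < r i) →
          (∀ U : BayesControl.Policy m, ∃ U' : BayesControl.Policy m,
            U'.AgreeBefore n U ∧ S.IsBayesPolicy r U' x₀ n) ∧
          ∀ (U : BayesControl.Policy m) (j : ℕ), j ≤ n → S.IsBayesPolicy r U x₀ j →
            ∀ᵐ ω ∂S.law r, S.control U x₀ n ω = (S.K A n)⁻¹ *ᵥ S.L A B r U x₀ n ω) ∧
      -- (b) rank deficient
      ((S.K A n).rank < m →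
        ∃ κ : ℝ, 0 ≤ κ ∧
          ∀ (x₀ : Fin m → ℝ) (r : Fin d → ℝ), (∀ i, 0 < r i) →
          ∀ (U : BayesControl.Policy m) (l : ℕ) (E : Matrix (Fin l) (Fin m) ℝ) (θ : ℝ),
            0 < θ → ‖E‖ = θ → IsUnit ((S.K A n)ᵀ * S.K A n + Eᵀ * E) →
            -- the unique solution of the regularized least-squares problem
            (∀ (ω : S.Outcome) (u : Fin m → ℝ),
              u ≠ S.regularizedControl A B r U x₀ n E ω →
              S.regularizedResidual A B r U x₀ n E ω (S.regularizedControl A B r U x₀ n E ω)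
                < S.regularizedResidual A B r U x₀ n E ω u) ∧
            -- it solves the linear system `K u = L` up to `O(θ)`
            (∀ᵐ ω ∂S.law r,
              (S.K A n *ᵥ S.regularizedControl A B r U x₀ n E ω - S.L A B r U x₀ n ω) ⬝ᵥ
                (S.K A n *ᵥ S.regularizedControl A B r U x₀ n E ω - S.L A B r U x₀ n ω)
                ≤ κ * θ ^ 2 * (S.L A B r U x₀ n ω ⬝ᵥ S.L A B r U x₀ n ω)) ∧
            -- it can be applied at time `n` and continued in a Bayes way
            (∃ V : BayesControl.Policy m, V.AgreeBefore n U ∧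
              (∀ᵐ ω ∂S.law r, S.control V x₀ n ω = S.regularizedControl A B r U x₀ n E ω) ∧
              S.IsBayesPolicy r V x₀ (n + 1)) ∧
            -- it then attains the Bayes risk up to `O(θ ^ 2)`
            ∀ V : BayesControl.Policy m, V.AgreeBefore n U →
              (∀ᵐ ω ∂S.law r, S.control V x₀ n ω = S.regularizedControl A B r U x₀ n E ω) →
              S.IsBayesPolicy r V x₀ (n + 1) →
              ∀ W : S.Outcome → ℝ≥0∞, S.IsBayesRisk r U x₀ n W →
                ∀ᵐ ω ∂S.law r, S.risk r V x₀ n ω ≤ W ω +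
                  ENNReal.ofReal (κ * θ ^ 2 * (S.L A B r U x₀ n ω ⬝ᵥ S.L A B r U x₀ n ω))) := by
  have hβ0 : ∀ i, 0 < S.β i := fun i => two_pos.trans (hβ i)
  refine ⟨S.exists_isRiskCoefficients hβ hp hp_last hk hs hc, fun A B C hABC n hn => ?_⟩
  have hstep := fun {n : ℕ} (hn : n ≤ S.M) =>
    hABC.exists_isStepCost hβ hp hp_last hk hs hc hn
  obtain ⟨⟨A', B', C', h⟩, hB, hK⟩ := hstep hn
  obtain ⟨G, hG⟩ := BayesControl.exists_generalized_inverse (S.K A n)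
  refine ⟨fun hrank x₀ r hr => ⟨fun U => (h.isBayesRisk hβ0 hc hn hB hK hG hr U x₀).2,
    fun U j hj hU => ?_⟩, fun _ => ?_⟩
  · have hUn : S.IsBayesPolicy r U x₀ n := by
      -- Being Bayes is carried forward from `j` to `n` one step at a time.
      refine Nat.le_induction (P := fun i _ => i ≤ S.M → S.IsBayesPolicy r U x₀ i)
        (fun _ => hU) (fun i _ ih hi => ?_) n hj hn
      obtain ⟨⟨A', B', C', h⟩, hB, hK⟩ := hstep (i.le_succ.trans hi)
      exact (h.of_isBayesPolicy hβ0 hc (i.le_succ.trans hi) hB hK hr (ih (i.le_succ.trans hi))).1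
    filter_upwards [(h.of_isBayesPolicy hβ0 hc hn hB hK hr hUn).2] with ω hω
    have hdet := (Matrix.isUnit_iff_isUnit_det _).1 (BayesControl.isUnit_of_rank_eq hrank)
    rw [← hω, Matrix.mulVec_mulVec, Matrix.nonsing_inv_mul _ hdet, Matrix.one_mulVec]
  -- The product of the residual constant `‖G‖²` and the excess constant `1 + ‖G‖²`; it also
  -- dominates `‖G‖²`, so one `κ` serves both estimates.
  · refine ⟨‖G‖ ^ 2 * (1 + ‖G‖ ^ 2), by positivity, ?_⟩
    intro x₀ r hr U l E θ _ hθ hE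
    subst hθ
    have hres := fun ω (hω : S.K A n *ᵥ (G *ᵥ S.L A B r U x₀ n ω) = S.L A B r U x₀ n ω) =>
      BayesControl.regularized_residual_le hω E hE
    have hLL : ∀ ω, 0 ≤ S.L A B r U x₀ n ω ⬝ᵥ S.L A B r U x₀ n ω :=
      fun ω => BayesControl.dotProduct_self_nonneg' _
    refine ⟨fun ω u hu => BayesControl.regularized_lt E hE _ hu, ?_, ?_, ?_⟩
    · filter_upwards [h.ae_mulVec_eq hc hn hK hG hr U x₀] with ω hω
      refine (hres ω hω).trans ?_
      refine mul_le_mul_of_nonneg_right (mul_le_mul_of_nonneg_right ?_ (sq_nonneg _)) (hLL ω)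
      nlinarith [sq_nonneg (‖G‖ ^ 2)]
    · obtain ⟨V, hV, hVc, hVB⟩ := hB.exists_control hc hn hr U x₀
        (g := S.regularizedControl A B r U x₀ n E)
        ((BayesControl.ControlSystem.measurable_mulVec _).comp
          ((BayesControl.ControlSystem.measurable_mulVec _).comp
          (S.measurable_L A B r U x₀ n)))
      exact ⟨V, hV, by rw [hVc]; simp, hVB⟩
    · intro V hV hVc hVB W hW
      filter_upwards [h.risk_le hβ0 hc hn hB hK hG hr hV hVB hW, hVc,
        h.ae_mulVec_eq hc hn hK hG hr U x₀] with ω h1 h2 h3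
      refine h1.trans (add_le_add_right (ENNReal.ofReal_le_ofReal ?_) _)
      rw [h2, mul_comm (‖G‖ ^ 2), mul_assoc (1 + ‖G‖ ^ 2), mul_assoc (1 + ‖G‖ ^ 2)]
      exact mul_le_mul_of_nonneg_left (hres ω h3) (by positivity)
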